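/- Fix a universal model of uniform computation with classical control, random bits and a quantum memory; an algorithm is efficient (PPT, resp. QPT) if it always halts within a number of steps polynomial in the size of its classical input. A function $\mu:\mathbb N\to\mathbb R$ is negligible if $\lambda^{c}\mu(\lambda)\to 0$ for every $c$, and noticeable if for some $d$, $\mu(\lambda)\ge\lambda^{-d}$ for all large $\lambda$. A function $n:\mathbb N\to\mathbb N$ is efficiently computable if $1^\lambda\mapsto 1^{n(\lambda)}$ is computable in deterministic polynomial time (so $n$ is polynomially bounded). A 1-of-2 puzzle $\mathcal Z=(G,O,S,V)$ consists of four efficient algorithms, all given the security parameter $1^\lambda$: a classical randomized $G$ with $(p,v)\leftarrow G(1^\lambda)$; a quantum $O$ with $(o,\rho)\leftarrow O(p)$, where $o$ is classical and $\rho$ is a quantum state; a quantum $S$ with $a\leftarrow S(p,o,\rho,b)$ for $b\in\{0,1\}$, where $a$ is classical; and a classical deterministic $V(p,v,o,b,a)\in\{0,1\}$. It has completeness $\eta$ if for some negligible $\mu$ and all $\lambda$, $$\Pr[(p,v)\leftarrow G(1^\lambda),\,(o,\rho)\leftarrow O(p),\,b\leftarrow\{0,1\},\,a\leftarrow S(p,o,\rho,b):\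 V(p,v,o,b,a)=1]\ \ge\ \eta(\lambda)-\mu(\lambda).$$ For $h:\mathbb N\to[0,1]$ it is $1-h$ hard if for every QPT algorithm $\mathcal T$ there is a negligible $\mu$ such that for all $\lambda$, $$\Pr[(p,v)\leftarrow G(1^\lambda),\,(o,a_0,a_1)\leftarrow\mathcal T(1^\lambda,p):\ V(p,v,o,0,a_0)=V(p,v,o,1,a_1)=1]\ \le\ h(\lambda)+\mu(\lambda).$$ The puzzle is weak (with parameter $h$) if it has completeness $1$, is $1-h$ hard, and $1-h$ is noticeable; it is strong if it has completeness $1$ and is $1$-hard (that is, $h=0$). The $n$-fold repetition $\mathcal Z^n=(G^n,O^n,S^n,V^n)$ runs $G,O,S$ independently $n(\lambda)$ times, with the product state $\rho_1\otimes\cdots\otimes\rho_n$ as quantum state and one common challenge bit $b$, and $V^n$ accepts if and only if $V(p_i,v_i,o_i,b,a_i)=1$ for all $i\in\{1,\dots,n(\lambda)\}$. **Corollary.** A weak 1-of-2 puzzle implies a strong 1-of-2 puzzle. More precisely, let $\mathcal Z$ be a weak 1-of-2 puzzle with parameter $h$. Then there are efficiently computable functions $n:\mathbb N\to\mathbb N$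 with $$h(\lambda)^{n(\lambda)}\le \lambda^{-\log\lambda}\quad\text{for all sufficiently large }\lambda$$ (for $0<h(\lambda)<1$ this says $n(\lambda)\ge \log^2\lambda/\log(1/h(\lambda))$), where $\log$ is the natural logarithm; and for every such $n$, the $n$-fold repetition $\mathcal Z^n$ is realized by a 1-of-2 puzzle, and every 1-of-2 puzzle that realizes $\mathcal Z^n$ is strong. -/

import Mathlib

open Filter Topology

noncomputable section

namespace QPuzzle

/-! ## Classical data

Classical values are finite binary trees, which represent bits, strings, tuples and unary numbers. -/

/-- Finite binary trees. -/
inductive Data : Type where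
  | nil : Data
  | cons : Data → Data → Data

namespace Data

/-- The number of nodes. -/
def size : Data → ℕ
  | nil => 1
  | cons a b => 1 + a.size + b.size

/-- First component (`nil` on `nil`). -/
def hd : Data → Data
  | nil => nil
  | cons a _ => a

/-- Second component (`nil` on `nil`). -/
def tl : Data → Data
  | nil => nil
  | cons _ b => b

/-- Finite tuples, written as right-nested pairs ending in `nil`. -/
def list : List Data → Data
  | [] => nil
  | a :: l => cons a (list l)

/-- Unary numbers; `num k` plays the role of the string `1^k`. -/
def num : ℕ → Data
  | 0 => nil
  | k + 1 => cons nil (num k)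

/-- Bits: `0` is `nil`, and `1` is `cons nil nil`. -/
def bit : Bool → Data
  | false => nil
  | true => cons nil nil

end Data

/-! ## Quantum memory

Qubits are addressed by `Data`. A computational basis state in which only finitely many qubits are
`1` is the finite set of the addresses of these qubits, and a pure state is a finite superposition
of such basis states. States are not normalised: a nonzero vector stands for its ray. -/

/-- Vectors of the quantum memory. -/
abbrev QMem : Type := Finset Data →₀ ℂ

namespace QMem

open Classical in
/-- All qubits are `0`. -/
def blank : QMem := Finsupp.single ∅ 1

/-- Squared norm. -/
def normSq (ψ : QMem) : NNReal := ∑ s ∈ ψ.support, ‖ψ s‖₊ ^ 2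

open Classical in
/-- Hadamard gate on qubit `q`. -/
def hadamard (q : Data) : QMem →ₗ[ℂ] QMem :=
  Finsupp.linearCombination ℂ fun s : Finset Data =>
    ((Real.sqrt 2 : ℂ))⁻¹ •
      ((Finsupp.single (s.erase q) 1 : QMem) +
        Finsupp.single (insert q s) (if q ∈ s then -1 else 1))

open Classical in
/-- The gate `T = diag (1, e^{iπ/4})` on qubit `q`. -/
def tGate (q : Data) : QMem →ₗ[ℂ] QMem :=
  Finsupp.linearCombination ℂ fun s : Finset Data =>
    (Finsupp.single s (if q ∈ s then Complex.exp (Complex.I * Real.pi / 4) else 1) : QMem)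

open Classical in
/-- Controlled-not gate with control `c` and target `t` (the identity if `c = t`). -/
def cnot (c t : Data) : QMem →ₗ[ℂ] QMem :=
  Finsupp.linearCombination ℂ fun s : Finset Data =>
    (Finsupp.single (if c ∈ s ∧ c ≠ t then symmDiff s {t} else s) 1 : QMem)

open Classical in
/-- Projection onto the basis states in which qubit `q` has value `b`. -/
def proj (q : Data) (b : Bool) (ψ : QMem) : QMem :=
  ψ.filter fun s => decide (q ∈ s) = b

lemma normSq_proj_le (q : Data) (b : Bool) (ψ : QMem) : normSq (proj q b ψ) ≤ normSq ψ := by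
  classical
  unfold normSq proj
  rw [Finsupp.support_filter]
  refine le_trans (le_of_eq (Finset.sum_congr rfl ?_)) (Finset.sum_le_sum_of_subset
    (Finset.filter_subset (fun s => decide (q ∈ s) = b) ψ.support))
  intro s hs
  have h := (Finset.mem_filter.mp hs).2
  rw [Finsupp.filter_apply_pos (fun s => decide (q ∈ s) = b) ψ h]

/-- Probability that measuring qubit `q` of the state `ψ` gives `1`. -/
def prob (q : Data) (ψ : QMem) : NNReal := normSq (proj q true ψ) / normSq ψ

lemma prob_le_one (q : Data) (ψ : QMem) : prob q ψ ≤ 1 :=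
  div_le_one_of_le₀ (normSq_proj_le q true ψ) bot_le

open Classical in
/-- The product state `ψ_i ⊗ ψ_{i+1} ⊗ ⋯` of a list of states, where qubit `a` of the factor
with index `j` is stored at address `cons (num j) a`. -/
def tensorFrom : ℕ → List QMem → QMem
  | _, [] => blank
  | i, ψ :: l =>
    ψ.sum fun s z => (tensorFrom (i + 1) l).sum fun t w =>
      Finsupp.single (s.image (Data.cons (Data.num i)) ∪ t) (z * w)

/-- The product state `ψ_0 ⊗ ⋯ ⊗ ψ_{n-1}`. -/
def tensor (l : List QMem) : QMem := tensorFrom 0 l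

end QMem

/-! ## The machine model

A structured programming language for a machine with classical control, random bits, and a quantum
memory (universal gate set `H`, `T`, `CNOT`, and measurements in the computational basis). Every
instruction is charged at least one step, and it is charged for the size of the data it writes. -/

/-- Expressions over the classical variables `0, 1, 2, …`. -/
inductive Expr : Type where
  | var : ℕ → Expr
  | nil : Expr
  | cons : Expr → Expr → Expr
  | hd : Expr → Expr
  | tl : Expr → Expr

/-- Value of an expression. -/
def Expr.eval (m : ℕ → Data) : Expr → Data
  | .var i => m i
  | .nil => .nil
  | .cons a b => .cons (a.eval m) (b.eval m)
  | .hd a => (a.eval m).hd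
  | .tl a => (a.eval m).tl

/-- Programs. -/
inductive Prog : Type where
  /-- do nothing -/
  | skip : Prog
  /-- `x := e` -/
  | assign (x : ℕ) (e : Expr) : Prog
  /-- sequential composition -/
  | seq (P Q : Prog) : Prog
  /-- run `P` if variable `x` is not `nil`, and `Q` otherwise -/
  | cond (x : ℕ) (P Q : Prog) : Prog
  /-- run `P` as long as variable `x` is not `nil` -/
  | loop (x : ℕ) (P : Prog) : Prog
  /-- `x :=` a fair random bit -/
  | flip (x : ℕ) : Prog
  /-- Hadamard gate on the qubit with address `e` -/
  | gateH (e : Expr) : Prog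
  /-- `T` gate on the qubit with address `e` -/
  | gateT (e : Expr) : Prog
  /-- controlled-not gate with control `e` and target `e'` -/
  | gateCNOT (e e' : Expr) : Prog
  /-- `x :=` result of measuring the qubit with address `e` -/
  | measure (x : ℕ) (e : Expr) : Prog
  /-- `x :=` output of the subroutine `P` on input `e`, run on classical and quantum memories of
  its own, which are freshly initialised and discarded at the end -/
  | call (x : ℕ) (P : Prog) (e : Expr) : Prog
  /-- the same, but the quantum memory of `P` is the segment `r` of the memory of the caller:
  qubit `a` of `P` is qubit `cons r a` of the caller -/
  | callOn (x : ℕ) (r : Expr) (P : Prog) (e : Expr) : Prog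

/-- No quantum instructions. -/
def Prog.IsClassical : Prog → Prop
  | .skip | .assign _ _ | .flip _ => True
  | .seq P Q | .cond _ P Q => P.IsClassical ∧ Q.IsClassical
  | .loop _ P | .call _ P _ | .callOn _ _ P _ => P.IsClassical
  | .gateH _ | .gateT _ | .gateCNOT _ _ | .measure _ _ => False

/-- No quantum instructions and no random bits. -/
def Prog.IsDeterministic : Prog → Prop
  | .skip | .assign _ _ => True
  | .seq P Q | .cond _ P Q => P.IsDeterministic ∧ Q.IsDeterministic
  | .loop _ P | .call _ P _ | .callOn _ _ P _ => P.IsDeterministic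
  | .flip _ | .gateH _ | .gateT _ | .gateCNOT _ _ | .measure _ _ => False

/-- A configuration of the machine. -/
structure Conf : Type where
  /-- values of the classical variables -/
  store : ℕ → Data
  /-- state of the quantum memory -/
  mem : QMem
  /-- number of steps made so far -/
  time : ℕ

/-- Initial configuration: the input is in variable `0`, and the other variables are `nil`. -/
def Conf.init (x : Data) (ψ : QMem) (t : ℕ) : Conf :=
  ⟨Function.update (fun _ => Data.nil) 0 x, ψ, t⟩

/-- Charge `t` steps. -/
def Conf.tick (c : Conf) (t : ℕ) : Conf := { c with time := c.time + t }

/-- Write `d` to variable `x`, for `1 + d.size` steps. -/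
def Conf.write (c : Conf) (x : ℕ) (d : Data) : Conf :=
  { c with store := Function.update c.store x d, time := c.time + (1 + d.size) }

/-- A bit that is `true` with probability `p`. -/
def coin (p : NNReal) (hp : p ≤ 1) : PMF Bool :=
  PMF.ofFintype (fun b => ((if b then p else 1 - p : NNReal) : ENNReal)) (by
    simp only [Fintype.univ_bool, Finset.mem_singleton, Bool.true_eq_false, not_false_eq_true,
      Finset.sum_insert, Finset.sum_singleton, if_true, Bool.false_eq_true, if_false]
    rw [← ENNReal.coe_add, add_tsub_cancel_of_le hp, ENNReal.coe_one])

/-- A fair bit. -/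
def fairCoin : PMF Bool := PMF.uniformOfFintype Bool

/-- Sequencing of random computations that may fail to finish (`none`). -/
def andThen {α β : Type} (m : PMF (Option α)) (f : α → PMF (Option β)) : PMF (Option β) :=
  m.bind fun o => o.elim (PMF.pure none) f

/-- A loop with body `F` and loop variable `x`, cut off (result `none`) if the loop variable has
to be tested more than `j` times. Each test takes one step. -/
def iterate (x : ℕ) (F : Conf → PMF (Option Conf)) : ℕ → Conf → PMF (Option Conf)
  | 0, _ => PMF.pure none
  | j + 1, c =>
    match c.store x with
    | .nil => PMF.pure (some (c.tick 1))
    | .cons _ _ => andThen (F (c.tick 1)) (iterate x F j)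

/-- Distribution of the final configuration of a program, where `none` means that some loop was
cut off because it needed more than `k` tests. The qubit with address `a` of the program is the
qubit with address `f a` of the memory. -/
def exec (k : ℕ) : Prog → (Data → Data) → Conf → PMF (Option Conf)
  | .skip, _, c => PMF.pure (some (c.tick 1))
  | .assign x e, _, c => PMF.pure (some (c.write x (e.eval c.store)))
  | .seq P Q, f, c => andThen (exec k P f c) (exec k Q f)
  | .cond x P Q, f, c =>
    match c.store x with
    | .nil => exec k Q f (c.tick 1)
    | .cons _ _ => exec k P f (c.tick 1)
  | .loop x P, f, c => iterate x (exec k P f) k c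
  | .flip x, _, c => fairCoin.map fun b => some (c.write x (.bit b))
  | .gateH e, f, c =>
    PMF.pure (some { c with
      mem := QMem.hadamard (f (e.eval c.store)) c.mem
      time := c.time + (1 + (e.eval c.store).size) })
  | .gateT e, f, c =>
    PMF.pure (some { c with
      mem := QMem.tGate (f (e.eval c.store)) c.mem
      time := c.time + (1 + (e.eval c.store).size) })
  | .gateCNOT e e', f, c =>
    PMF.pure (some { c with
      mem := QMem.cnot (f (e.eval c.store)) (f (e'.eval c.store)) c.mem
      time := c.time + (1 + (e.eval c.store).size + (e'.eval c.store).size) })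
  | .measure x e, f, c =>
    (coin (QMem.prob (f (e.eval c.store)) c.mem) (QMem.prob_le_one _ _)).map fun b =>
      some (Conf.write
        { c with
          mem := QMem.proj (f (e.eval c.store)) b c.mem
          time := c.time + (e.eval c.store).size } x (.bit b))
  | .call x P e, _, c =>
    andThen
      (exec k P id (Conf.init (e.eval c.store) QMem.blank
        (c.time + (1 + (e.eval c.store).size))))
      fun d => PMF.pure (some (Conf.write { c with time := d.time } x (d.store 0)))
  | .callOn x r P e, f, c =>
    andThen
      (exec k P (fun a => f (.cons (r.eval c.store) a)) (Conf.init (e.eval c.store) c.mem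
        (c.time + (1 + (r.eval c.store).size + (e.eval c.store).size))))
      fun d => PMF.pure (some (Conf.write { c with mem := d.mem, time := d.time } x (d.store 0)))

/-- `P` halts within `t` steps, whatever the random outcomes, on input `x` and initial quantum
memory `ψ`. (Every test of a loop takes a step, so no loop of such a run makes more than `t`
tests.) -/
def Prog.HaltsWithin (P : Prog) (t : ℕ) (x : Data) (ψ : QMem) : Prop :=
  ∀ r ∈ (exec t P id (Conf.init x ψ 0)).support, ∃ c : Conf, r = some c ∧ c.time ≤ t

/-- Polynomial-time algorithms whose initial quantum memory is a state from `A`: a program with a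
polynomial that bounds its number of steps in terms of the size of its classical input. -/
structure Alg (A : Set QMem) : Type where
  /-- the program -/
  prog : Prog
  /-- the time bound -/
  bound : Polynomial ℕ
  halts : ∀ (x : Data), ∀ ψ ∈ A, prog.HaltsWithin (bound.eval x.size) x ψ

/-- Joint distribution of the classical output (variable `0`) and of the final state of the
quantum memory. -/
def Alg.run {A : Set QMem} (P : Alg A) (x : Data) (ψ : QMem) : PMF (Data × QMem) :=
  (exec (P.bound.eval x.size) P.prog id (Conf.init x ψ 0)).map fun r =>
    r.elim (Data.nil, ψ) fun c => (c.store 0, c.mem)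

/-- Distribution of the classical output. -/
def Alg.out {A : Set QMem} (P : Alg A) (x : Data) (ψ : QMem) : PMF Data :=
  (P.run x ψ).map Prod.fst

/-- Uniform quantum polynomial-time algorithms with a classical input. -/
abbrev QPT : Type := Alg {QMem.blank}

/-- Uniform quantum polynomial-time algorithms with a classical input and a quantum input. -/
abbrev QPTWithState : Type := Alg {ψ | ψ ≠ 0}

/-- `n` is computable by a deterministic algorithm in time polynomial in the argument, with
argument and value in unary (so that `n` is bounded by a polynomial). -/
def EfficientlyComputable (n : ℕ → ℕ) : Prop :=
  ∃ P : QPT, P.prog.IsDeterministic ∧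
    ∀ k, P.out (.num k) QMem.blank = PMF.pure (.num (n k))

/-- `μ` is negligible. -/
def Negligible (μ : ℕ → ℝ) : Prop :=
  Asymptotics.SuperpolynomialDecay atTop (fun k : ℕ => (k : ℝ)) μ

/-- `μ` is noticeable. -/
def Noticeable (μ : ℕ → ℝ) : Prop :=
  ∃ d : ℕ, ∀ᶠ k : ℕ in atTop, 1 / (k : ℝ) ^ d ≤ μ k

/-! ## 1-of-2 puzzles -/

/-- A 1-of-2 puzzle. All algorithms get the security parameter in unary. -/
structure Puzzle : Type where
  /-- puzzle generator: input `(1^k)`, output `(p, v)` -/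
  G : QPT
  /-- obligation algorithm: input `(1^k, p)`, output `o` and a quantum state -/
  O : QPT
  /-- solver: input `(1^k, p, o, b)` and a quantum state, output `a` -/
  S : QPTWithState
  /-- verifier: input `(1^k, p, v, o, b, a)`; the output `nil` means `0`, and any other output
  means `1` -/
  V : QPT
  G_classical : G.prog.IsClassical
  V_deterministic : V.prog.IsDeterministic

namespace Puzzle

/-- Distribution of `(p, v)`. -/
def gen (Z : Puzzle) (k : ℕ) : PMF (Data × Data) :=
  (Z.G.out (.num k) QMem.blank).map fun x => (x.hd, x.tl)

/-- Distribution of the obligation and the quantum state, for the puzzle `p`. -/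
def obligation (Z : Puzzle) (k : ℕ) (p : Data) : PMF (Data × QMem) :=
  Z.O.run (.list [.num k, p]) QMem.blank

/-- Distribution of the answer to challenge `b`. -/
def answer (Z : Puzzle) (k : ℕ) (p o : Data) (ψ : QMem) (b : Bool) : PMF Data :=
  Z.S.out (.list [.num k, p, o, .bit b]) ψ

/-- `V(p, v, o, b, a) = 1`. -/
def Accepts (Z : Puzzle) (k : ℕ) (p v o : Data) (b : Bool) (a : Data) : Prop :=
  ∃ d, d ≠ Data.nil ∧ Z.V.out (.list [.num k, p, v, o, .bit b, a]) QMem.blank = PMF.pure d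

/-- Outcome of an honest run with a random challenge. -/
def honestGame (Z : Puzzle) (k : ℕ) : PMF Prop :=
  (Z.gen k).bind fun pv =>
    (Z.obligation k pv.1).bind fun oψ =>
      fairCoin.bind fun b =>
        (Z.answer k pv.1 oψ.1 oψ.2 b).map fun a => Z.Accepts k pv.1 pv.2 oψ.1 b a

/-- The puzzle has completeness `η`. -/
def HasCompleteness (Z : Puzzle) (η : ℕ → ℝ) : Prop :=
  ∃ μ : ℕ → ℝ, Negligible μ ∧ ∀ k, η k - μ k ≤ (Z.honestGame k True).toReal

/-- Outcome of the 2-of-2 solving game with the solver `T`, whose input is `(1^k, p)` and whose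
output is read as `(o, a₀, a₁)`. -/
def solveBothGame (Z : Puzzle) (T : QPT) (k : ℕ) : PMF Prop :=
  (Z.gen k).bind fun pv =>
    (T.out (.list [.num k, pv.1]) QMem.blank).map fun y =>
      Z.Accepts k pv.1 pv.2 y.hd false y.tl.hd ∧ Z.Accepts k pv.1 pv.2 y.hd true y.tl.tl.hd

/-- The puzzle is `1 - h` hard. -/
def IsHard (Z : Puzzle) (h : ℕ → ℝ) : Prop :=
  ∀ T : QPT, ∃ μ : ℕ → ℝ, Negligible μ ∧ ∀ k, (Z.solveBothGame T k True).toReal ≤ h k + μ k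

/-- The puzzle is weak, with hardness `1 - h`. -/
structure IsWeak (Z : Puzzle) (h : ℕ → ℝ) : Prop where
  mem_unit : ∀ k, h k ∈ Set.Icc (0 : ℝ) 1
  complete : Z.HasCompleteness fun _ => 1
  hard : Z.IsHard h
  noticeable : Noticeable fun k => 1 - h k

/-- The puzzle is strong. -/
structure IsStrong (Z : Puzzle) : Prop where
  complete : Z.HasCompleteness fun _ => 1
  hard : Z.IsHard fun _ => 0

end Puzzle

/-- Independent samples from a list of distributions. -/
def independent {α : Type} : List (PMF α) → PMF (List α)
  | [] => PMF.pure []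
  | m :: l => m.bind fun a => (independent l).map fun as => a :: as

/-- `W` is the `n`-fold repetition of `Z`: its four algorithms have the input-output behaviour
of `G^n`, `O^n`, `S^n` and `V^n`. -/
structure IsRepetition (Z : Puzzle) (n : ℕ → ℕ) (W : Puzzle) : Prop where
  gen : ∀ k, W.gen k =
    (independent (List.replicate (n k) (Z.gen k))).map fun l =>
      (Data.list (l.map Prod.fst), Data.list (l.map Prod.snd))
  obligation : ∀ (k : ℕ) (p : List Data), p.length = n k →
    W.obligation k (.list p) =
      (independent (p.map (Z.obligation k))).map fun l =>
        (Data.list (l.map Prod.fst), QMem.tensor (l.map Prod.snd))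
  answer : ∀ (k : ℕ) (p o : Fin (n k) → Data) (ψ : Fin (n k) → QMem) (b : Bool),
    (∀ i, ψ i ≠ 0) →
    W.answer k (.list (List.ofFn p)) (.list (List.ofFn o)) (QMem.tensor (List.ofFn ψ)) b =
      (independent (List.ofFn fun i => Z.answer k (p i) (o i) (ψ i) b)).map Data.list
  accepts : ∀ (k : ℕ) (P V O : Data) (b : Bool) (A : Data),
    W.Accepts k P V O b A ↔
      ∃ p v o a : Fin (n k) → Data,
        P = .list (List.ofFn p) ∧ V = .list (List.ofFn v) ∧ O = .list (List.ofFn o) ∧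
          A = .list (List.ofFn a) ∧ ∀ i, Z.Accepts k (p i) (v i) (o i) b (a i)

end QPuzzle

end

open Filter Topology

noncomputable section

namespace QPuzzle

/-! ## Sequencing -/

/-! Hardness is the heart of the matter. Suppose `T` wins the two-answer game for the repetition
with probability ε, and put N = n(λ). For a list r of at most N puzzles let s(r) be the probability
of the following event (`rate`): r is completed to N puzzles by fresh instances, `T` is run, and
both answers are right for every fresh instance. No verification key of r is needed to test this.
Then s ≤ 1, and s ≥ ε for the empty list. For an instance q let u(r,q) (`rateAt`) be the probability
that, with r followed by q as prefix, `T` solves the fresh instances and q as well. Since q can be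
regarded as the first fresh instance, the mean of u(r,q) over q is s(r); trivially u(r,q) ≤ s(r,q).

Conditioning on success, by repeated attempts, does two things. The first fresh instance of a
successful run over r has density u(r,·)/s(r), so r can be extended at random. If instead a
challenge q is appended to r, a successful run answers q correctly with probability u(r,q)/s(r,q).
Let r_0, r_1, … be the prefixes obtained by successive random extensions of the empty list. The
expected success on a challenge placed after r_j is the expectation of s(r_j)/s(r_{j+1}). These
quotients telescope to a product at least ε, so by the inequality of the means their average over j
is at least ε^{1/N}: a challenge at a uniformly random position is solved with probability about
ε^{1/N}. In `le_sumAlong` the inequality of the means is replaced by its tangent-line form, which is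
linear, survives expectations and tolerates the error 1/M of M attempts (`mean_le_retry`). `T` has
classical input and output, so it can be rerun from scratch at will.

If ε > λ^{-c} for arbitrarily large λ, then h^N ≤ ε/2 there, and ε^{1/N} - h ≥ (ε - h^N)/N ≥ ε/(2N).
Taking M a large power of λ makes the sampling errors smaller than this, against the hardness of the
given puzzle (`IsRepetition.hard`).

Completeness: once the common challenge bit is fixed the rounds are independent, and Bernoulli's
inequality loses only a factor n(λ), which is polynomial. Existence of n: if 1 - h ≥ λ^{-d}, then n
= λ^{d+1} gives h^n ≤ e^{-λ}.

The rest makes "efficient" literal. A calculus of total runs with time bounds (`Runs`) and of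
functions computable in polynomial time (`Comp`, `DComp`) shows that the reduction and the four
repeated algorithms are algorithms of the model. The delicate one is the solver: it runs on segments
of one memory and must halt even on states entangled across segments. Slicing along the qubits
outside a segment reduces this to the halting of the original solver; on product states,
`Intertwines` shows that each factor evolves on its own. -/

@[simp] lemma andThen_pure_some {α β : Type} (a : α) (g : α → PMF (Option β)) :
    andThen (PMF.pure (some a)) g = g a := by
  simp [andThen]

@[simp] lemma andThen_pure_none {α β : Type} (g : α → PMF (Option β)) :
    andThen (PMF.pure none) g = PMF.pure none := by
  simp [andThen]

lemma andThen_map_some {α β : Type} (E : PMF α) (g : α → PMF (Option β)) :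
    andThen (E.map some) g = E.bind g := by
  simp only [andThen, PMF.bind_map]
  rfl

lemma andThen_map_option {α β γ : Type} (m : PMF (Option α)) (h : α → β)
    (g : β → PMF (Option γ)) :
    andThen (m.map (Option.map h)) g = andThen m (fun a => g (h a)) := by
  simp only [andThen, PMF.bind_map]
  congr 1
  funext o
  cases o <;> rfl

lemma map_option_andThen {α β γ : Type} (m : PMF (Option α)) (g : α → PMF (Option β))
    (h : β → γ) :
    (andThen m g).map (Option.map h) = andThen m fun a => (g a).map (Option.map h) := by
  simp only [andThen, PMF.map_bind]
  congr 1
  funext o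
  cases o <;> simp [PMF.pure_map]

lemma mem_support_andThen {α β : Type} {m : PMF (Option α)} {g : α → PMF (Option β)}
    {r : Option β} :
    r ∈ (andThen m g).support ↔
      (r = none ∧ none ∈ m.support) ∨ ∃ d, some d ∈ m.support ∧ r ∈ (g d).support := by
  simp only [andThen, PMF.mem_support_bind_iff]
  constructor
  · rintro ⟨o, ho, hr⟩
    cases o with
    | none => left; simpa using And.intro hr ho
    | some d => right; exact ⟨d, ho, hr⟩
  · rintro (⟨rfl, h⟩ | ⟨d, hd, hr⟩)
    · exact ⟨none, h, by simp⟩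
    · exact ⟨some d, hd, hr⟩

lemma bind_congr_support {α β : Type} {m : PMF α} {f g : α → PMF β}
    (h : ∀ a ∈ m.support, f a = g a) : m.bind f = m.bind g := by
  ext b
  simp only [PMF.bind_apply]
  refine tsum_congr fun a => ?_
  by_cases ha : m a = 0
  · simp [ha]
  · rw [h a ((PMF.mem_support_iff _ _).2 ha)]

lemma map_congr_support {α β : Type} {m : PMF α} {f g : α → β}
    (h : ∀ a ∈ m.support, f a = g a) : m.map f = m.map g := by
  rw [← PMF.bind_pure_comp, ← PMF.bind_pure_comp]
  exact bind_congr_support fun a ha => by simp [h a ha]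

lemma andThen_congr_support {α β : Type} {m : PMF (Option α)} {f g : α → PMF (Option β)}
    (h : ∀ a, some a ∈ m.support → f a = g a) : andThen m f = andThen m g := by
  refine bind_congr_support fun o ho => ?_
  cases o with
  | none => rfl
  | some a => exact h a ho

/-! ## Elementary properties of the semantics -/

/-- Increasing the cut-off does not change a run that was not cut off. -/
lemma iterate_mono {x : ℕ} {F F' : Conf → PMF (Option Conf)}
    (hF : ∀ c, none ∉ (F c).support → F' c = F c) (j : ℕ) :
    ∀ (i : ℕ), j ≤ i → ∀ c, none ∉ (iterate x F j c).support →
      iterate x F' i c = iterate x F j c := by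
  induction j with
  | zero => intro i _ c hc; simp [iterate] at hc
  | succ j ih =>
    intro i hi c hc
    obtain ⟨i, rfl⟩ : ∃ i', i = i' + 1 := ⟨i - 1, by omega⟩
    simp only [iterate] at hc ⊢
    cases hx : c.store x with
    | nil => rfl
    | cons a b =>
      simp only [hx, mem_support_andThen, true_and, not_or, not_exists, not_and] at hc
      simp only []
      rw [hF _ hc.1]
      exact andThen_congr_support fun d hd => ih i (by omega) d (hc.2 d hd)

/-- The cut-off enters only through loops, and `iterate_mono` treats those. Hence algorithms with
different time bounds can be run under one common cut-off. -/
theorem exec_mono {k l : ℕ} (hkl : k ≤ l) (P : Prog) :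
    ∀ (f : Data → Data) (c : Conf), none ∉ (exec k P f c).support →
      exec l P f c = exec k P f c := by
  induction P with
  | skip => intros; rfl
  | assign x e => intros; rfl
  | seq P Q ihP ihQ =>
    intro f c hc
    simp only [exec, mem_support_andThen, true_and, not_or, not_exists, not_and] at hc ⊢
    rw [ihP _ _ hc.1]
    exact andThen_congr_support fun d hd => ihQ _ _ (hc.2 d hd)
  | cond x P Q ihP ihQ =>
    intro f c hc
    simp only [exec] at hc ⊢
    cases hx : c.store x with
    | nil => simp only [hx] at hc; exact ihQ _ _ hc
    | cons a b => simp only [hx] at hc; exact ihP _ _ hc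
  | loop x P ih =>
    intro f c hc
    simp only [exec] at hc ⊢
    exact iterate_mono (fun c hc => ih f c hc) k l hkl c hc
  | flip x => intros; rfl
  | gateH e => intros; rfl
  | gateT e => intros; rfl
  | gateCNOT e e' => intros; rfl
  | measure x e => intros; rfl
  | call x P e ih =>
    intro f c hc
    simp only [exec, mem_support_andThen, true_and, not_or, not_exists, not_and] at hc ⊢
    rw [ih _ _ hc.1]
  | callOn x r P e ih =>
    intro f c hc
    simp only [exec, mem_support_andThen, true_and, not_or, not_exists, not_and] at hc ⊢
    rw [ih _ _ hc.1]

/-- `Φ` maps a memory to a memory in which qubit `a` of the former is stored at address `f a`. -/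
structure Intertwines (f : Data → Data) (Φ : QMem → QMem) : Prop where
  hadamard : ∀ q ψ, QMem.hadamard (f q) (Φ ψ) = Φ (QMem.hadamard q ψ)
  tGate : ∀ q ψ, QMem.tGate (f q) (Φ ψ) = Φ (QMem.tGate q ψ)
  cnot : ∀ q t ψ, QMem.cnot (f q) (f t) (Φ ψ) = Φ (QMem.cnot q t ψ)
  proj : ∀ q b ψ, QMem.proj (f q) b (Φ ψ) = Φ (QMem.proj q b ψ)
  prob : ∀ q ψ, QMem.prob (f q) (Φ ψ) = QMem.prob q ψ

lemma Intertwines.id : Intertwines id id :=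
  ⟨fun _ _ => rfl, fun _ _ => rfl, fun _ _ _ => rfl, fun _ _ _ => rfl, fun _ _ => rfl⟩

/-- Replace the memory by its image under `Φ` and advance the clock by `a`. -/
def Conf.push (Φ : QMem → QMem) (a : ℕ) (c : Conf) : Conf := ⟨c.store, Φ c.mem, c.time + a⟩

lemma Conf.push_write (Φ : QMem → QMem) (a : ℕ) (c : Conf) (x : ℕ) (d : Data) :
    (c.push Φ a).write x d = (c.write x d).push Φ a := by
  simp only [Conf.push, Conf.write, Conf.mk.injEq, true_and]
  omega

lemma Conf.push_tick (Φ : QMem → QMem) (a : ℕ) (c : Conf) (t : ℕ) :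
    (c.push Φ a).tick t = (c.tick t).push Φ a := by
  simp only [Conf.push, Conf.tick, Conf.mk.injEq, true_and]
  omega

lemma iterate_push {x : ℕ} {F F' : Conf → PMF (Option Conf)} {Φ : QMem → QMem} {a : ℕ}
    (hF : ∀ c : Conf, F' (c.push Φ a) = (F c).map (Option.map (Conf.push Φ a))) (j : ℕ) :
    ∀ c : Conf, iterate x F' j (c.push Φ a) =
      (iterate x F j c).map (Option.map (Conf.push Φ a)) := by
  induction j with
  | zero => intro c; simp [iterate, PMF.pure_map]
  | succ j ih =>
    intro c
    have hs : (c.push Φ a).store x = c.store x := rfl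
    simp only [iterate, hs]
    cases hx : c.store x with
    | nil => simp only [PMF.pure_map, Option.map_some, Conf.push_tick]
    | cons u v =>
      simp only [Conf.push_tick, hF, andThen_map_option, map_option_andThen, ih]

/-- A program touches its memory only through gates, projections and outcome probabilities, all
respected by `Φ`, and it never reads the clock. With `Φ` the identity this is invariance under time
shifts. The extra map `g` carries the segments opened by nested `callOn`. -/
theorem exec_push {k : ℕ} (P : Prog) :
    ∀ {f : Data → Data} {Φ : QMem → QMem}, Intertwines f Φ → ∀ (a : ℕ) (g : Data → Data)
      (c : Conf), exec k P (fun q => f (g q)) (c.push Φ a) =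
        (exec k P g c).map (Option.map (Conf.push Φ a)) := by
  induction P with
  | skip => intros; simp only [exec, PMF.pure_map, Option.map_some, Conf.push_tick]
  | assign x e =>
    intro f Φ _ a g c
    simp only [exec, PMF.pure_map, Option.map_some, Conf.push_write]
    rfl
  | seq P Q ihP ihQ =>
    intro f Φ h a g c
    simp only [exec, ihP h, andThen_map_option, map_option_andThen, ihQ h]
  | cond x P Q ihP ihQ =>
    intro f Φ h a g c
    have hs : (c.push Φ a).store x = c.store x := rfl
    simp only [exec, hs]
    cases hx : c.store x with
    | nil => simp only [Conf.push_tick, ihQ h]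
    | cons u v => simp only [Conf.push_tick, ihP h]
  | loop x P ih =>
    intro f Φ h a g c
    simp only [exec]
    exact iterate_push (fun c => ih h a g c) k c
  | flip x =>
    intro f Φ _ a g c
    simp only [exec, PMF.map_comp]
    congr 1
    funext b
    simp only [Function.comp, Option.map_some, Conf.push_write]
  | gateH e =>
    intro f Φ h a g c
    have hs : (c.push Φ a).store = c.store := rfl
    have hm : (c.push Φ a).mem = Φ c.mem := rfl
    have ht : (c.push Φ a).time = c.time + a := rfl
    simp only [exec, PMF.pure_map, Option.map_some, hs, hm, ht, h.hadamard]
    simp only [Conf.push, Nat.add_right_comm]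
  | gateT e =>
    intro f Φ h a g c
    have hs : (c.push Φ a).store = c.store := rfl
    have hm : (c.push Φ a).mem = Φ c.mem := rfl
    have ht : (c.push Φ a).time = c.time + a := rfl
    simp only [exec, PMF.pure_map, Option.map_some, hs, hm, ht, h.tGate]
    simp only [Conf.push, Nat.add_right_comm]
  | gateCNOT e e' =>
    intro f Φ h a g c
    have hs : (c.push Φ a).store = c.store := rfl
    have hm : (c.push Φ a).mem = Φ c.mem := rfl
    have ht : (c.push Φ a).time = c.time + a := rfl
    simp only [exec, PMF.pure_map, Option.map_some, hs, hm, ht, h.cnot]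
    simp only [Conf.push, Nat.add_right_comm]
  | measure x e =>
    intro f Φ h a g c
    have hs : (c.push Φ a).store = c.store := rfl
    have hm : (c.push Φ a).mem = Φ c.mem := rfl
    have ht : (c.push Φ a).time = c.time + a := rfl
    simp only [exec, PMF.map_comp, hs, hm, ht, h.prob, h.proj]
    congr 1
    funext b
    simp only [Function.comp, Option.map_some, Conf.push, Conf.write, Option.some.injEq,
      Conf.mk.injEq, true_and]
    omega
  | call x P e ih =>
    intro f Φ h a g c
    have hs : (c.push Φ a).store = c.store := rfl
    have hi : Conf.init (e.eval c.store) QMem.blank ((c.push Φ a).time +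
        (1 + (e.eval c.store).size)) =
        (Conf.init (e.eval c.store) QMem.blank (c.time + (1 + (e.eval c.store).size))).push id a := by
      simp only [Conf.push, Conf.init, Conf.mk.injEq, id, true_and]
      omega
    -- The subroutine has a fresh memory of its own and does not see `Φ`; only the time shift
    -- remains.
    have := ih Intertwines.id a id
      (Conf.init (e.eval c.store) QMem.blank (c.time + (1 + (e.eval c.store).size)))
    simp only [exec, hs, hi]
    rw [show exec k P id = exec k P (fun q => id (id q)) from rfl, this, andThen_map_option,
      map_option_andThen]
    refine andThen_congr_support fun d _ => ?_
    simp only [PMF.pure_map, Option.map_some, Conf.push, Conf.write, Nat.add_right_comm]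
  | callOn x r P e ih =>
    intro f Φ h a g c
    have hs : (c.push Φ a).store = c.store := rfl
    have hm : (c.push Φ a).mem = Φ c.mem := rfl
    have hi : Conf.init (e.eval c.store) (Φ c.mem) ((c.push Φ a).time +
        (1 + (r.eval c.store).size + (e.eval c.store).size)) =
        (Conf.init (e.eval c.store) c.mem
          (c.time + (1 + (r.eval c.store).size + (e.eval c.store).size))).push Φ a := by
      simp only [Conf.push, Conf.init, Conf.mk.injEq, true_and]
      omega
    simp only [exec, hs, hm, hi]
    rw [ih h a (fun q => g (.cons (r.eval c.store) q)), andThen_map_option, map_option_andThen]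
    refine andThen_congr_support fun d _ => ?_
    simp only [PMF.pure_map, Option.map_some, Conf.push, Conf.write, Nat.add_right_comm]

/-! ## Coefficients of the gates -/

namespace QMem

-- Coefficients are read off on the output side: the two basis states that contribute to `s` are `s`
-- without `q` and `s` with `q`. In this form, commutation of gates with embeddings and slices
-- becomes a matter of set identities.
open Classical in
lemma hadamard_apply (q : Data) (ψ : QMem) (s : Finset Data) :
    hadamard q ψ s = ((Real.sqrt 2 : ℂ))⁻¹ *
      (ψ (s.erase q) + (if q ∈ s then -1 else 1) * ψ (insert q s)) := by
  induction ψ using Finsupp.induction_linear with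
  | zero => simp
  | add f g hf hg => simp only [map_add, Finsupp.add_apply, hf, hg]; ring
  | single t z =>
    simp only [hadamard, Finsupp.linearCombination_single, Finsupp.smul_apply, Finsupp.add_apply,
      Finsupp.single_apply, smul_eq_mul]
    by_cases hs : q ∈ s <;> by_cases ht : q ∈ t
    · have h1 : t.erase q ≠ s := fun h => by simp [← h] at hs
      have h2 : t ≠ s.erase q := fun h => by simp [h] at ht
      simp only [h1, h2, Finset.insert_eq_of_mem hs, Finset.insert_eq_of_mem ht, hs, ht, if_true,
        if_false]
      split_ifs <;> ring
    · have h1 : t.erase q ≠ s := fun h => by simp [← h] at hs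
      have h2 : t ≠ insert q s := fun h => by simp [h] at ht
      have h3 : insert q t = s ↔ t = s.erase q :=
        ⟨fun h => by rw [← h, Finset.erase_insert ht], fun h => by rw [h, Finset.insert_erase hs]⟩
      simp only [h1, h2, h3, if_false, ht]
      split_ifs <;> ring
    · have h1 : insert q t ≠ s := fun h => by simp [← h] at hs
      have h2 : t ≠ s.erase q := fun h => by simp [h] at ht
      have h3 : t.erase q = s ↔ t = insert q s :=
        ⟨fun h => by rw [← h, Finset.insert_erase ht], fun h => by rw [h, Finset.erase_insert hs]⟩
      simp only [h1, h2, h3, if_false, hs]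
      split_ifs <;> ring
    · have h1 : insert q t ≠ s := fun h => by simp [← h] at hs
      have h2 : t ≠ insert q s := fun h => by simp [h] at ht
      simp only [h1, h2, Finset.erase_eq_of_notMem hs, Finset.erase_eq_of_notMem ht, hs, ht,
        if_false]
      split_ifs <;> ring

open Classical in
lemma tGate_apply (q : Data) (ψ : QMem) (s : Finset Data) :
    tGate q ψ s = (if q ∈ s then Complex.exp (Complex.I * Real.pi / 4) else 1) * ψ s := by
  induction ψ using Finsupp.induction_linear with
  | zero => simp
  | add f g hf hg => simp only [map_add, Finsupp.add_apply, hf, hg]; ring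
  | single t z =>
    simp only [tGate, Finsupp.linearCombination_single, Finsupp.smul_apply,
      Finsupp.single_apply, smul_eq_mul]
    by_cases h : t = s
    · subst h; simp [mul_comm]
    · simp [h]

open Classical in
lemma cnot_apply (c t : Data) (ψ : QMem) (s : Finset Data) :
    cnot c t ψ s = ψ (if c ∈ s ∧ c ≠ t then symmDiff s {t} else s) := by
  induction ψ using Finsupp.induction_linear with
  | zero => simp
  | add f g hf hg => simp only [map_add, Finsupp.add_apply, hf, hg]
  | single u z =>
    simp only [cnot, Finsupp.linearCombination_single, Finsupp.smul_apply,
      Finsupp.single_apply, smul_eq_mul]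
    have key : ∀ v w : Finset Data, (if c ∈ v ∧ c ≠ t then symmDiff v {t} else v) = w →
        v = (if c ∈ w ∧ c ≠ t then symmDiff w {t} else w) := by
      intro v w h
      subst h
      by_cases h : c ∈ v ∧ c ≠ t
      · have : c ∈ symmDiff v {t} := by simp [Finset.mem_symmDiff, h.1, h.2]
        simp [h, this]
      · simp only [h, if_false]
    have : ((if c ∈ u ∧ c ≠ t then symmDiff u {t} else u) = s) ↔
        u = (if c ∈ s ∧ c ≠ t then symmDiff s {t} else s) :=
      ⟨key u s, fun h => (key s u h.symm).symm⟩
    simp only [this]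
    split_ifs <;> simp

open Classical in
lemma proj_apply (q : Data) (b : Bool) (ψ : QMem) (s : Finset Data) :
    proj q b ψ s = if decide (q ∈ s) = b then ψ s else 0 := by
  simp only [proj, Finsupp.filter_apply]

/-- Invertibility is what guarantees that gates never produce the zero vector. -/
lemma hadamard_hadamard (q : Data) (ψ : QMem) : hadamard q (hadamard q ψ) = ψ := by
  classical
  have h2 : ((Real.sqrt 2 : ℂ))⁻¹ * ((Real.sqrt 2 : ℂ))⁻¹ = 1 / 2 := by
    rw [← mul_inv, ← Complex.ofReal_mul, Real.mul_self_sqrt (by norm_num)]; norm_num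
  ext s
  by_cases hs : q ∈ s
  · simp only [hadamard_apply, hs, if_true, Finset.notMem_erase,
      if_false, Finset.erase_idem, Finset.insert_erase hs, Finset.insert_eq_of_mem hs]
    linear_combination (2 * ψ s) * h2
  · simp only [hadamard_apply, hs, if_true, Finset.mem_insert_self,
      if_false, Finset.erase_insert hs, Finset.erase_eq_of_notMem hs, Finset.insert_idem]
    linear_combination (2 * ψ s) * h2

lemma hadamard_ne_zero {q : Data} {ψ : QMem} (h : ψ ≠ 0) : hadamard q ψ ≠ 0 := fun h0 => h (by
  rw [← hadamard_hadamard q ψ, h0, map_zero])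

lemma tGate_ne_zero {q : Data} {ψ : QMem} (h : ψ ≠ 0) : tGate q ψ ≠ 0 := by
  classical
  obtain ⟨s, hs⟩ := Finsupp.ne_iff.1 h
  refine Finsupp.ne_iff.2 ⟨s, ?_⟩
  rw [tGate_apply]
  refine mul_ne_zero ?_ hs
  split_ifs
  · exact Complex.exp_ne_zero _
  · exact one_ne_zero

lemma cnot_cnot (c t : Data) (ψ : QMem) : cnot c t (cnot c t ψ) = ψ := by
  classical
  ext s
  rw [cnot_apply, cnot_apply]
  congr 1
  by_cases h : c ∈ s ∧ c ≠ t
  · have : c ∈ symmDiff s {t} := by simp [Finset.mem_symmDiff, h.1, h.2]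
    simp [h, this]
  · simp only [h, if_false]

lemma cnot_ne_zero {c t : Data} {ψ : QMem} (h : ψ ≠ 0) : cnot c t ψ ≠ 0 := fun h0 => h (by
  rw [← cnot_cnot c t ψ, h0, map_zero])

lemma proj_zero (q : Data) (b : Bool) : proj q b 0 = 0 := by
  classical
  ext s
  simp [proj_apply]

lemma normSq_eq_zero {ψ : QMem} : normSq ψ = 0 ↔ ψ = 0 := by
  constructor
  · intro h
    by_contra hne
    obtain ⟨s, hs⟩ := Finsupp.ne_iff.1 hne
    have := (Finset.sum_eq_zero_iff.1 h) s (Finsupp.mem_support_iff.2 hs)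
    simp only [pow_eq_zero_iff (two_ne_zero), nnnorm_eq_zero] at this
    exact hs this
  · rintro rfl; simp [normSq]

/-! ### Measurement probabilities -/

lemma normSq_proj_add (q : Data) (ψ : QMem) :
    normSq (proj q true ψ) + normSq (proj q false ψ) = normSq ψ := by
  classical
  have key : ∀ b, normSq (proj q b ψ) =
      ∑ s ∈ ψ.support, if decide (q ∈ s) = b then ‖ψ s‖₊ ^ 2 else 0 := by
    intro b
    rw [← Finset.sum_filter]
    unfold normSq proj
    rw [Finsupp.support_filter]
    refine Finset.sum_congr rfl fun s hs => ?_
    rw [Finsupp.filter_apply_pos (fun s => decide (q ∈ s) = b) ψ (Finset.mem_filter.mp hs).2]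
  rw [key, key, ← Finset.sum_add_distrib]
  refine Finset.sum_congr rfl fun s _ => ?_
  by_cases h : q ∈ s <;> simp [h]

/-- A measurement outcome is possible if and only if the projected state does not vanish. -/
lemma mem_support_coin_prob {q : Data} {ψ : QMem} (hψ : ψ ≠ 0) (b : Bool) :
    b ∈ (coin (prob q ψ) (prob_le_one q ψ)).support ↔ proj q b ψ ≠ 0 := by
  have hN : normSq ψ ≠ 0 := fun h => hψ (normSq_eq_zero.1 h)
  have h1 : 1 - prob q ψ = normSq (proj q false ψ) / normSq ψ := by
    rw [prob, ← normSq_proj_add q ψ] at *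
    rw [tsub_eq_iff_eq_add_of_le]
    · rw [← add_div, add_comm, div_self hN]
    · exact div_le_one_of_le₀ le_self_add bot_le
  rw [PMF.mem_support_iff, coin, PMF.ofFintype_apply]
  cases b
  · simp only [Bool.false_eq_true, if_false, h1, ne_eq, ENNReal.coe_eq_zero, div_eq_zero_iff, hN,
      or_false, normSq_eq_zero]
  · simp only [if_true, prob, ne_eq, ENNReal.coe_eq_zero, div_eq_zero_iff, hN,
      or_false, normSq_eq_zero]

lemma blank_ne_zero : blank ≠ 0 := by
  simp [blank]

end QMem

/-! ## Invariants of runs -/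

lemma Data.one_le_size (d : Data) : 1 ≤ d.size := by cases d <;> simp [Data.size, Nat.add_assoc]

lemma Data.size_bit (b : Bool) : (Data.bit b).size ≤ 3 := by cases b <;> simp [Data.bit, Data.size]

/-- What every run from `c` to `d` respects. -/
structure Conf.Evolves (c d : Conf) : Prop where
  time : c.time ≤ d.time
  mem : c.mem ≠ 0 → d.mem ≠ 0
  mem_zero : c.mem = 0 → d.mem = 0
  store : ∀ B, (∀ i, (c.store i).size ≤ B + c.time) → ∀ i, (d.store i).size ≤ B + d.time

lemma Conf.Evolves.trans {c d e : Conf} (h : c.Evolves d) (h' : d.Evolves e) : c.Evolves e :=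
  ⟨h.time.trans h'.time, fun hc => h'.mem (h.mem hc), fun hc => h'.mem_zero (h.mem_zero hc),
    fun B hB => h'.store B (h.store B hB)⟩

lemma Conf.evolves_of_store {c : Conf} {m : QMem} {t : ℕ} (hm : c.mem ≠ 0 → m ≠ 0)
    (hm0 : c.mem = 0 → m = 0) : c.Evolves ⟨c.store, m, c.time + t⟩ :=
  ⟨Nat.le_add_right _ _, hm, hm0, fun B hB i => by have := hB i; simp only; omega⟩

lemma Conf.evolves_write (c : Conf) (x : ℕ) (d : Data) : c.Evolves (c.write x d) := by
  refine ⟨by simp only [Conf.write]; omega, id, id, fun B hB i => ?_⟩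
  simp only [Conf.write, Function.update_apply]
  split_ifs
  · omega
  · have := hB i; omega

lemma iterate_evolves {x : ℕ} {F : Conf → PMF (Option Conf)}
    (hF : ∀ c d, some d ∈ (F c).support → c.Evolves d) (j : ℕ) :
    ∀ c d, some d ∈ (iterate x F j c).support → c.Evolves d := by
  induction j with
  | zero => intro c d h; simp [iterate] at h
  | succ j ih =>
    intro c d h
    simp only [iterate] at h
    cases hx : c.store x with
    | nil =>
      simp only [hx, PMF.support_pure, Set.mem_singleton_iff, Option.some.injEq] at h
      subst h
      exact Conf.evolves_of_store id id
    | cons u v =>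
      simp only [hx, mem_support_andThen, reduceCtorEq, false_and, false_or] at h
      obtain ⟨e, he, hd⟩ := h
      exact (Conf.evolves_of_store (c := c) (t := 1) id id).trans ((hF _ _ he).trans (ih _ _ hd))

/-- Writing is charged by size, so no variable can outgrow its initial bound by more than the
elapsed time; this bounds outputs by running times. A nonzero memory stays nonzero because outcomes
with zero projection have probability zero. The zero memory staying zero is used in contrapositive
form, to carry nonvanishing of slices backwards along a run. -/
theorem exec_evolves {k : ℕ} (P : Prog) :
    ∀ (f : Data → Data) (c d : Conf), some d ∈ (exec k P f c).support → c.Evolves d := by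
  induction P with
  | skip =>
    intro f c d h
    simp only [exec, PMF.support_pure, Set.mem_singleton_iff, Option.some.injEq] at h
    subst h
    exact Conf.evolves_of_store id id
  | assign x e =>
    intro f c d h
    simp only [exec, PMF.support_pure, Set.mem_singleton_iff, Option.some.injEq] at h
    subst h
    exact Conf.evolves_write _ _ _
  | seq P Q ihP ihQ =>
    intro f c d h
    simp only [exec, mem_support_andThen, reduceCtorEq, false_and, false_or] at h
    obtain ⟨e, he, hd⟩ := h
    exact (ihP _ _ _ he).trans (ihQ _ _ _ hd)
  | cond x P Q ihP ihQ =>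
    intro f c d h
    have h0 := Conf.evolves_of_store (c := c) (t := 1) id id
    simp only [exec] at h
    cases hx : c.store x with
    | nil => simp only [hx] at h; exact h0.trans (ihQ _ _ _ h)
    | cons a b => simp only [hx] at h; exact h0.trans (ihP _ _ _ h)
  | loop x P ih =>
    intro f c d h
    exact iterate_evolves (fun c d => ih f c d) k c d h
  | flip x =>
    intro f c d h
    simp only [exec, PMF.support_map, Set.mem_image, Option.some.injEq] at h
    obtain ⟨b, _, rfl⟩ := h
    exact Conf.evolves_write _ _ _
  | gateH e =>
    intro f c d h
    simp only [exec, PMF.support_pure, Set.mem_singleton_iff, Option.some.injEq] at h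
    subst h
    exact Conf.evolves_of_store QMem.hadamard_ne_zero (fun h => by rw [h, map_zero])
  | gateT e =>
    intro f c d h
    simp only [exec, PMF.support_pure, Set.mem_singleton_iff, Option.some.injEq] at h
    subst h
    exact Conf.evolves_of_store QMem.tGate_ne_zero (fun h => by rw [h, map_zero])
  | gateCNOT e e' =>
    intro f c d h
    simp only [exec, PMF.support_pure, Set.mem_singleton_iff, Option.some.injEq] at h
    subst h
    exact Conf.evolves_of_store QMem.cnot_ne_zero (fun h => by rw [h, map_zero])
  | measure x e =>
    intro f c d h
    simp only [exec, PMF.support_map, Set.mem_image, Option.some.injEq] at h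
    obtain ⟨b, hb, rfl⟩ := h
    refine Conf.Evolves.trans ?_ (Conf.evolves_write _ _ _)
    exact Conf.evolves_of_store (fun hc => (QMem.mem_support_coin_prob hc b).1 hb)
      (fun h => by rw [h, QMem.proj_zero])
  | call x P e ih =>
    intro f c d h
    simp only [exec, mem_support_andThen, reduceCtorEq, false_and, false_or] at h
    obtain ⟨e', he, hd⟩ := h
    simp only [PMF.support_pure, Set.mem_singleton_iff, Option.some.injEq] at hd
    subst hd
    refine Conf.Evolves.trans ?_ (Conf.evolves_write _ _ _)
    have := (ih _ _ _ he).time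
    simp only [Conf.init] at this
    obtain ⟨t, ht⟩ := Nat.exists_eq_add_of_le (show c.time ≤ e'.time by omega)
    rw [ht]
    exact Conf.evolves_of_store id id
  | callOn x r P e ih =>
    intro f c d h
    simp only [exec, mem_support_andThen, reduceCtorEq, false_and, false_or] at h
    obtain ⟨e', he, hd⟩ := h
    simp only [PMF.support_pure, Set.mem_singleton_iff, Option.some.injEq] at hd
    subst hd
    refine Conf.Evolves.trans ?_ (Conf.evolves_write _ _ _)
    have h' := ih _ _ _ he
    have := h'.time
    simp only [Conf.init] at this
    obtain ⟨t, ht⟩ := Nat.exists_eq_add_of_le (show c.time ≤ e'.time by omega)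
    rw [ht]
    exact Conf.evolves_of_store h'.mem h'.mem_zero

/-- Deterministic programs have a single outcome. -/
theorem Prog.IsDeterministic.exec_eq_pure {k : ℕ} {P : Prog} (hP : P.IsDeterministic) :
    ∀ (f : Data → Data) (c : Conf), ∃ r, exec k P f c = PMF.pure r := by
  have hthen : ∀ {α β : Type} {m : PMF (Option α)} {g : α → PMF (Option β)},
      (∃ r, m = PMF.pure r) → (∀ a, ∃ r, g a = PMF.pure r) →
        ∃ r, andThen m g = PMF.pure r := by
    rintro α β m g ⟨r, rfl⟩ hg
    cases r with
    | none => exact ⟨none, andThen_pure_none _⟩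
    | some a => rw [andThen_pure_some]; exact hg a
  induction P with
  | skip => intros; exact ⟨_, rfl⟩
  | assign x e => intros; exact ⟨_, rfl⟩
  | seq P Q ihP ihQ => intro f c; exact hthen (ihP hP.1 f c) (fun a => ihQ hP.2 f a)
  | cond x P Q ihP ihQ =>
    intro f c
    simp only [exec]
    cases hx : c.store x with
    | nil => exact ihQ hP.2 _ _
    | cons a b => exact ihP hP.1 _ _
  | loop x P ih =>
    intro f c
    simp only [exec]
    suffices ∀ j c, ∃ r, iterate x (exec k P f) j c = PMF.pure r from this k c
    intro j
    induction j with
    | zero => intro c; exact ⟨_, rfl⟩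
    | succ j ihj =>
      intro c
      simp only [iterate]
      cases hx : c.store x with
      | nil => exact ⟨_, rfl⟩
      | cons a b => exact hthen (ih hP f _) ihj
  | flip x => exact absurd hP id
  | gateH e => exact absurd hP id
  | gateT e => exact absurd hP id
  | gateCNOT e e' => exact absurd hP id
  | measure x e => exact absurd hP id
  | call x P e ih => intro f c; exact hthen (ih hP _ _) (fun a => ⟨_, rfl⟩)
  | callOn x r P e ih => intro f c; exact hthen (ih hP _ _) (fun a => ⟨_, rfl⟩)

/-! ## Slices of entangled states -/

/-- `π` extracts from a memory the component for fixed values of the qubits whose address is not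
in the range of `f`. -/
structure IsSlice (f : Data → Data) (π : QMem → QMem) : Prop where
  hadamard : ∀ q ψ, QMem.hadamard q (π ψ) = π (QMem.hadamard (f q) ψ)
  tGate : ∀ q ψ, QMem.tGate q (π ψ) = π (QMem.tGate (f q) ψ)
  cnot : ∀ q t ψ, QMem.cnot q t (π ψ) = π (QMem.cnot (f q) (f t) ψ)
  proj : ∀ q b ψ, QMem.proj q b (π ψ) = π (QMem.proj (f q) b ψ)

/-- Apply `π` to the memory. -/
def Conf.slice (π : QMem → QMem) (c : Conf) : Conf := ⟨c.store, π c.mem, c.time⟩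

lemma iterate_slice {x : ℕ} {F F' : Conf → PMF (Option Conf)} {π : QMem → QMem}
    (hF : ∀ c d, some d ∈ (F' c).support → π d.mem ≠ 0 →
      some (d.slice π) ∈ (F (c.slice π)).support)
    (hF0 : ∀ c d, some d ∈ (F c).support → c.mem = 0 → d.mem = 0) (j : ℕ) :
    ∀ c d, some d ∈ (iterate x F' j c).support → π d.mem ≠ 0 → π c.mem ≠ 0 ∧
      some (d.slice π) ∈ (iterate x F j (c.slice π)).support := by
  induction j with
  | zero => intro c d h; simp [iterate] at h
  | succ j ih =>
    intro c d h hd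
    have hs : (c.slice π).store x = c.store x := rfl
    simp only [iterate] at h
    simp only [iterate, hs]
    cases hx : c.store x with
    | nil =>
      simp only [hx, PMF.support_pure, Set.mem_singleton_iff, Option.some.injEq] at h
      subst h
      simp only [PMF.support_pure, Set.mem_singleton_iff, Option.some.injEq]
      exact ⟨hd, rfl⟩
    | cons u v =>
      simp only [hx, mem_support_andThen, reduceCtorEq, false_and, false_or] at h
      obtain ⟨e, he, hd'⟩ := h
      obtain ⟨h1, h2⟩ := ih _ _ hd' hd
      have h3 := hF _ _ he h1
      refine ⟨fun h0 => h1 (hF0 _ _ h3 h0), ?_⟩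
      simp only [mem_support_andThen, reduceCtorEq, false_and, false_or]
      exact ⟨_, h3, h2⟩

/-- Slices commute with gates and projections, but not with outcome probabilities, so only possible
runs are compared. Nonvanishing is required of the final slice: by linearity it then holds at all
earlier moments, so that each observed outcome is also possible for the slice. -/
theorem exec_slice {k : ℕ} (P : Prog) :
    ∀ {f : Data → Data} {π : QMem → QMem}, IsSlice f π → ∀ (g : Data → Data) (c d : Conf),
      some d ∈ (exec k P (fun q => f (g q)) c).support → π d.mem ≠ 0 →
        some (d.slice π) ∈ (exec k P g (c.slice π)).support := by
  induction P with
  | skip =>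
    intro f π _ g c d h hd
    simp only [exec, PMF.support_pure, Set.mem_singleton_iff, Option.some.injEq] at h ⊢
    subst h
    rfl
  | assign x e =>
    intro f π _ g c d h hd
    simp only [exec, PMF.support_pure, Set.mem_singleton_iff, Option.some.injEq] at h ⊢
    subst h
    rfl
  | seq P Q ihP ihQ =>
    intro f π hπ g c d h hd
    simp only [exec, mem_support_andThen, reduceCtorEq, false_and, false_or] at h ⊢
    obtain ⟨e, he, hd'⟩ := h
    have h2 := ihQ hπ _ _ _ hd' hd
    refine ⟨_, ihP hπ _ _ _ he fun h0 => hd ((exec_evolves Q _ _ _ h2).mem_zero h0), h2⟩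
  | cond x P Q ihP ihQ =>
    intro f π hπ g c d h hd
    have hs : (c.slice π).store x = c.store x := rfl
    simp only [exec] at h
    simp only [exec, hs]
    cases hx : c.store x with
    | nil => simp only [hx] at h; exact ihQ hπ _ _ _ h hd
    | cons a b => simp only [hx] at h; exact ihP hπ _ _ _ h hd
  | loop x P ih =>
    intro f π hπ g c d h hd
    exact (iterate_slice (fun c d h hd => ih hπ g c d h hd)
      (fun c d h h0 => (exec_evolves P _ _ _ h).mem_zero h0) k c d h hd).2
  | flip x =>
    intro f π _ g c d h hd
    simp only [exec, PMF.support_map, Set.mem_image, Option.some.injEq] at h ⊢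
    obtain ⟨b, hb, rfl⟩ := h
    exact ⟨b, hb, rfl⟩
  | gateH e =>
    intro f π hπ g c d h hd
    have hm : (c.slice π).mem = π c.mem := rfl
    simp only [exec, PMF.support_pure, Set.mem_singleton_iff, Option.some.injEq, hm,
      hπ.hadamard] at h ⊢
    subst h
    rfl
  | gateT e =>
    intro f π hπ g c d h hd
    have hm : (c.slice π).mem = π c.mem := rfl
    simp only [exec, PMF.support_pure, Set.mem_singleton_iff, Option.some.injEq, hm,
      hπ.tGate] at h ⊢
    subst h
    rfl
  | gateCNOT e e' =>
    intro f π hπ g c d h hd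
    have hm : (c.slice π).mem = π c.mem := rfl
    simp only [exec, PMF.support_pure, Set.mem_singleton_iff, Option.some.injEq, hm,
      hπ.cnot] at h ⊢
    subst h
    rfl
  | measure x e =>
    intro f π hπ g c d h hd
    have hm : (c.slice π).mem = π c.mem := rfl
    have hs : (c.slice π).store = c.store := rfl
    simp only [exec, PMF.support_map, Set.mem_image, Option.some.injEq] at h ⊢
    obtain ⟨b, hb, rfl⟩ := h
    have hd' : QMem.proj (g (e.eval c.store)) b (π c.mem) ≠ 0 := by
      rw [hπ.proj]; exact hd
    refine ⟨b, ?_, ?_⟩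
    · refine (QMem.mem_support_coin_prob ?_ b).2 hd'
      intro h0
      rw [hm] at h0
      rw [h0, QMem.proj_zero] at hd'
      exact hd' rfl
    · simp only [hm, hs, hπ.proj]; rfl
  | call x P e ih =>
    intro f π hπ g c d h hd
    simp only [exec, mem_support_andThen, reduceCtorEq, false_and, false_or] at h ⊢
    obtain ⟨e', he, hd'⟩ := h
    refine ⟨e', he, ?_⟩
    simp only [PMF.support_pure, Set.mem_singleton_iff, Option.some.injEq] at hd' ⊢
    subst hd'
    rfl
  | callOn x r P e ih =>
    intro f π hπ g c d h hd
    simp only [exec, mem_support_andThen, reduceCtorEq, false_and, false_or] at h ⊢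
    obtain ⟨e', he, hd'⟩ := h
    simp only [PMF.support_pure, Set.mem_singleton_iff, Option.some.injEq] at hd'
    subst hd'
    refine ⟨_, ih hπ (fun q => g (.cons (r.eval c.store) q)) _ _ he hd, ?_⟩
    simp only [PMF.support_pure, Set.mem_singleton_iff, Option.some.injEq]
    rfl

/-- A run that is cut off has no final memory to slice. The slice is therefore chosen at the moment
of failure, where some member of `S` does not vanish, and is carried back to the start. -/
lemma iterate_slice_none {x : ℕ} {F F' : Conf → PMF (Option Conf)} {S : Set (QMem → QMem)}
    (hS : ∀ ψ, ψ ≠ 0 → ∃ π ∈ S, π ψ ≠ 0)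
    (hF : ∀ π ∈ S, ∀ c d, some d ∈ (F' c).support → π d.mem ≠ 0 →
      some (d.slice π) ∈ (F (c.slice π)).support)
    (hF0 : ∀ c d, some d ∈ (F c).support → c.mem = 0 → d.mem = 0)
    (hF' : ∀ c d, some d ∈ (F' c).support → c.mem ≠ 0 → d.mem ≠ 0)
    (hN : ∀ c, c.mem ≠ 0 → none ∈ (F' c).support →
      ∃ π ∈ S, π c.mem ≠ 0 ∧ none ∈ (F (c.slice π)).support) (j : ℕ) :
    ∀ c, c.mem ≠ 0 → none ∈ (iterate x F' j c).support →
      ∃ π ∈ S, π c.mem ≠ 0 ∧ none ∈ (iterate x F j (c.slice π)).support := by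
  induction j with
  | zero =>
    intro c hc _
    obtain ⟨π, hπ, h⟩ := hS _ hc
    exact ⟨π, hπ, h, by simp [iterate]⟩
  | succ j ih =>
    intro c hc h
    have hs : ∀ π, (c.slice π).store x = c.store x := fun _ => rfl
    simp only [iterate] at h
    simp only [iterate, hs]
    cases hx : c.store x with
    | nil => simp [hx] at h
    | cons u v =>
      simp only [hx, mem_support_andThen, true_and] at h ⊢
      rcases h with h | ⟨d, hd, h⟩
      · obtain ⟨π, hπ, h1, h2⟩ := hN (c.tick 1) hc h
        exact ⟨π, hπ, h1, Or.inl h2⟩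
      · obtain ⟨π, hπ, h1, h2⟩ := ih _ (hF' _ _ hd hc) h
        have h3 := hF π hπ _ _ hd h1
        exact ⟨π, hπ, fun h0 => h1 (hF0 _ _ h3 h0), Or.inr ⟨_, h3, h2⟩⟩

/-- A run on an entangled state can be cut off only if a run on one of its slices can. -/
theorem exec_slice_none {k : ℕ} {f : Data → Data} {S : Set (QMem → QMem)}
    (hS : ∀ ψ, ψ ≠ 0 → ∃ π ∈ S, π ψ ≠ 0) (hf : ∀ π ∈ S, IsSlice f π) (P : Prog) :
    ∀ (g : Data → Data) (c : Conf), c.mem ≠ 0 →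
      none ∈ (exec k P (fun q => f (g q)) c).support →
        ∃ π ∈ S, π c.mem ≠ 0 ∧ none ∈ (exec k P g (c.slice π)).support := by
  induction P with
  | skip => intro g c _ h; simp [exec] at h
  | assign x e => intro g c _ h; simp [exec] at h
  | seq P Q ihP ihQ =>
    intro g c hc h
    simp only [exec, mem_support_andThen, true_and] at h ⊢
    rcases h with h | ⟨d, hd, h⟩
    · obtain ⟨π, hπ, h1, h2⟩ := ihP g c hc h
      exact ⟨π, hπ, h1, Or.inl h2⟩
    · obtain ⟨π, hπ, h1, h2⟩ := ihQ g d ((exec_evolves P _ _ _ hd).mem hc) h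
      have h3 := exec_slice P (hf π hπ) g _ _ hd h1
      exact ⟨π, hπ, fun h0 => h1 ((exec_evolves P _ _ _ h3).mem_zero h0), Or.inr ⟨_, h3, h2⟩⟩
  | cond x P Q ihP ihQ =>
    intro g c hc h
    have hs : ∀ π, (c.slice π).store x = c.store x := fun _ => rfl
    simp only [exec] at h
    simp only [exec, hs]
    cases hx : c.store x with
    | nil => simp only [hx] at h; exact ihQ g (c.tick 1) hc h
    | cons a b => simp only [hx] at h; exact ihP g (c.tick 1) hc h
  | loop x P ih =>
    intro g c hc h
    exact iterate_slice_none hS (fun π hπ c d h hd => exec_slice P (hf π hπ) g c d h hd)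
      (fun c d h h0 => (exec_evolves P _ _ _ h).mem_zero h0)
      (fun c d h h0 => (exec_evolves P _ _ _ h).mem h0) (fun c hc h => ih g c hc h) k c hc h
  | flip x => intro g c _ h; simp [exec, PMF.support_map] at h
  | gateH e => intro g c _ h; simp [exec] at h
  | gateT e => intro g c _ h; simp [exec] at h
  | gateCNOT e e' => intro g c _ h; simp [exec] at h
  | measure x e => intro g c _ h; simp [exec, PMF.support_map] at h
  | call x P e ih =>
    intro g c hc h
    simp only [exec, mem_support_andThen, true_and, PMF.support_pure, Set.mem_singleton_iff,
      reduceCtorEq, and_false, exists_false, or_false] at h ⊢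
    obtain ⟨π, hπ, h1⟩ := hS _ hc
    exact ⟨π, hπ, h1, h⟩
  | callOn x r P e ih =>
    intro g c hc h
    simp only [exec, mem_support_andThen, true_and, PMF.support_pure, Set.mem_singleton_iff,
      reduceCtorEq, and_false, exists_false, or_false] at h ⊢
    exact ih (fun q => g (.cons (r.eval c.store) q)) (Conf.init (e.eval c.store) c.mem _) hc h

/-! ## Segments of the quantum memory -/

open Classical in
/-- The part of a basis state that lies in segment `r`. -/
def inSeg (r : Data) (S : Finset Data) : Finset Data :=
  S.preimage (Data.cons r) fun _ _ _ _ h => (Data.cons.inj h).2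

open Classical in
/-- The part of a basis state that lies outside of segment `r`. -/
def offSeg (r : Data) (S : Finset Data) : Finset Data := S.filter fun d => ∀ a, d ≠ .cons r a

open Classical in
/-- The basis state with given parts inside and outside of segment `r`. -/
def joinSeg (r : Data) (s R : Finset Data) : Finset Data := s.image (Data.cons r) ∪ R

@[simp] lemma mem_inSeg {r a : Data} {S : Finset Data} : a ∈ inSeg r S ↔ .cons r a ∈ S := by
  exact Finset.mem_preimage

@[simp] lemma mem_offSeg {r d : Data} {S : Finset Data} :
    d ∈ offSeg r S ↔ d ∈ S ∧ ∀ a, d ≠ .cons r a := by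
  simp [offSeg]

@[simp] lemma mem_joinSeg {r d : Data} {s R : Finset Data} :
    d ∈ joinSeg r s R ↔ (∃ a ∈ s, .cons r a = d) ∨ d ∈ R := by
  simp [joinSeg]

lemma joinSeg_inSeg_offSeg (r : Data) (S : Finset Data) :
    joinSeg r (inSeg r S) (offSeg r S) = S := by
  ext d
  simp only [mem_joinSeg, mem_inSeg, mem_offSeg]
  constructor
  · rintro (⟨a, ha, rfl⟩ | h)
    · exact ha
    · exact h.1
  · intro hd
    by_cases h : ∃ a, d = .cons r a
    · obtain ⟨a, rfl⟩ := h
      exact Or.inl ⟨a, hd, rfl⟩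
    · exact Or.inr ⟨hd, fun a ha => h ⟨a, ha⟩⟩

lemma cons_notMem_of_inSeg_eq_empty {r : Data} {R : Finset Data} (h : inSeg r R = ∅) (a : Data) :
    Data.cons r a ∉ R := fun ha => by
  have : a ∈ inSeg r R := mem_inSeg.2 ha
  simp [h] at this

lemma inSeg_joinSeg {r : Data} {s R : Finset Data} (h : inSeg r R = ∅) :
    inSeg r (joinSeg r s R) = s := by
  ext a
  simp [cons_notMem_of_inSeg_eq_empty h]

lemma offSeg_eq_self {r : Data} {R : Finset Data} (h : inSeg r R = ∅) : offSeg r R = R := by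
  ext d
  simp only [mem_offSeg, and_iff_left_iff_imp]
  rintro hd a rfl
  exact cons_notMem_of_inSeg_eq_empty h a hd

lemma offSeg_joinSeg {r : Data} {s R : Finset Data} (h : inSeg r R = ∅) :
    offSeg r (joinSeg r s R) = R := by
  ext d
  simp only [mem_offSeg, mem_joinSeg]
  constructor
  · rintro ⟨⟨a, _, rfl⟩ | h, h'⟩
    · exact absurd rfl (h' a)
    · exact h
  · intro hd
    exact ⟨Or.inr hd, fun a ha => cons_notMem_of_inSeg_eq_empty h a (ha ▸ hd)⟩

@[simp] lemma inSeg_offSeg (r : Data) (S : Finset Data) : inSeg r (offSeg r S) = ∅ := by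
  ext a
  simp

lemma inSeg_offSeg_of_ne {r r' : Data} (h : r ≠ r') (S : Finset Data) :
    inSeg r (offSeg r' S) = inSeg r S := by
  ext a
  simp [h]

lemma offSeg_comm (r r' : Data) (S : Finset Data) :
    offSeg r (offSeg r' S) = offSeg r' (offSeg r S) := by
  ext d
  simp only [mem_offSeg]
  tauto

open Classical in
lemma inSeg_erase (r q : Data) (S : Finset Data) :
    inSeg r (S.erase (.cons r q)) = (inSeg r S).erase q := by
  ext a
  simp

open Classical in
lemma offSeg_erase (r q : Data) (S : Finset Data) :
    offSeg r (S.erase (.cons r q)) = offSeg r S := by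
  ext d
  simp only [mem_offSeg, Finset.mem_erase]
  exact ⟨fun h => ⟨h.1.2, h.2⟩, fun h => ⟨⟨h.2 q, h.1⟩, h.2⟩⟩

open Classical in
lemma inSeg_insert (r q : Data) (S : Finset Data) :
    inSeg r (insert (.cons r q) S) = insert q (inSeg r S) := by
  ext a
  simp

open Classical in
lemma offSeg_insert (r q : Data) (S : Finset Data) :
    offSeg r (insert (.cons r q) S) = offSeg r S := by
  ext d
  simp only [mem_offSeg, Finset.mem_insert]
  exact ⟨fun h => ⟨h.1.resolve_left (h.2 q), h.2⟩, fun h => ⟨Or.inr h.1, h.2⟩⟩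

open Classical in
lemma inSeg_symmDiff (r q : Data) (S : Finset Data) :
    inSeg r (symmDiff S {.cons r q}) = symmDiff (inSeg r S) {q} := by
  ext a
  simp [Finset.mem_symmDiff]

open Classical in
lemma offSeg_symmDiff (r q : Data) (S : Finset Data) :
    offSeg r (symmDiff S {.cons r q}) = offSeg r S := by
  ext d
  simp only [mem_offSeg, Finset.mem_symmDiff, Finset.mem_singleton]
  constructor
  · rintro ⟨h | h, h'⟩
    · exact ⟨h.1, h'⟩
    · exact absurd h.1 (h' q)
  · exact fun h => ⟨Or.inl ⟨h.1, h.2 q⟩, h.2⟩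

/-! ### Embedding and slicing at a segment -/

namespace QMem

lemma blank_apply (s : Finset Data) [Decidable (s = ∅)] : blank s = if s = ∅ then 1 else 0 := by
  classical
  rw [blank, Finsupp.single_apply]
  by_cases h : s = ∅
  · simp [h]
  · simp [h, Ne.symm h]

/-- A basis state is the same as its parts inside and outside the segment, so the sum of squares
factors. The outer factor is expressed as `Φ blank`, since `κ` itself is not assumed to have finite
support. -/
lemma normSq_of_apply {r : Data} {Φ : QMem → QMem} {κ : Finset Data → ℂ}
    (hΦ : ∀ ψ S, Φ ψ S = ψ (inSeg r S) * κ (offSeg r S)) (ψ : QMem) :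
    normSq (Φ ψ) = normSq ψ * normSq (Φ blank) := by
  classical
  have hb : ∀ R, R ∈ (Φ blank).support ↔ inSeg r R = ∅ ∧ κ R ≠ 0 := by
    intro R
    rw [Finsupp.mem_support_iff, hΦ, blank_apply]
    by_cases h : inSeg r R = ∅
    · simp [h, offSeg_eq_self h]
    · simp [h]
  have hk : ∀ R ∈ (Φ blank).support, Φ blank R = κ R := by
    intro R hR
    rw [hΦ, blank_apply, if_pos ((hb R).1 hR).1, offSeg_eq_self ((hb R).1 hR).1, one_mul]
  unfold normSq
  rw [Finset.sum_mul_sum, ← Finset.sum_product']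
  refine Finset.sum_nbij' (fun S => (inSeg r S, offSeg r S)) (fun p => joinSeg r p.1 p.2)
    ?_ ?_ ?_ ?_ ?_
  · intro S hS
    rw [Finsupp.mem_support_iff, hΦ] at hS
    rw [Finset.mem_product, Finsupp.mem_support_iff, hb]
    exact ⟨left_ne_zero_of_mul hS, inSeg_offSeg r S, right_ne_zero_of_mul hS⟩
  · rintro ⟨s, R⟩ h
    rw [Finset.mem_product, Finsupp.mem_support_iff, hb] at h
    rw [Finsupp.mem_support_iff, hΦ, inSeg_joinSeg h.2.1, offSeg_joinSeg h.2.1]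
    exact mul_ne_zero h.1 h.2.2
  · intro S _
    exact joinSeg_inSeg_offSeg r S
  · rintro ⟨s, R⟩ h
    rw [Finset.mem_product, hb] at h
    simp only [inSeg_joinSeg h.2.1, offSeg_joinSeg h.2.1]
  · intro S hS
    rw [Finsupp.mem_support_iff, hΦ] at hS
    rw [hk _ ((hb _).2 ⟨inSeg_offSeg r S, right_ne_zero_of_mul hS⟩), hΦ, nnnorm_mul, mul_pow]

/-- The product with a fixed state of the remaining qubits embeds a memory as segment `r`. -/
theorem intertwines_of_apply {r : Data} {Φ : QMem → QMem} {κ : Finset Data → ℂ}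
    (hΦ : ∀ ψ S, Φ ψ S = ψ (inSeg r S) * κ (offSeg r S)) (h0 : Φ blank ≠ 0) :
    Intertwines (Data.cons r) Φ := by
  classical
  have hproj : ∀ q b ψ, proj (.cons r q) b (Φ ψ) = Φ (proj q b ψ) := by
    intro q b ψ
    ext S
    simp only [proj_apply, hΦ, mem_inSeg]
    split_ifs <;> simp
  refine ⟨?_, ?_, ?_, hproj, ?_⟩
  · intro q ψ
    ext S
    simp only [hadamard_apply, hΦ, inSeg_erase, offSeg_erase, inSeg_insert, offSeg_insert,
      mem_inSeg]
    ring
  · intro q ψ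
    ext S
    simp only [tGate_apply, hΦ, mem_inSeg]
    ring
  · intro q t ψ
    ext S
    simp only [cnot_apply, hΦ, mem_inSeg, ne_eq, Data.cons.injEq, true_and]
    split_ifs
    · rw [inSeg_symmDiff, offSeg_symmDiff]
    · rfl
  · intro q ψ
    have hC : normSq (Φ blank) ≠ 0 := fun h => h0 (normSq_eq_zero.1 h)
    rw [prob, hproj, normSq_of_apply hΦ, normSq_of_apply hΦ ψ, mul_div_mul_right _ _ hC, prob]

/-- The component of a state for the value `R` of the qubits outside of segment `r`. -/
def slice (r : Data) (R : Finset Data) (hR : inSeg r R = ∅) (ψ : QMem) : QMem :=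
  ψ.comapDomain (fun s => joinSeg r s R) fun s _ t _ h => by
    rw [← inSeg_joinSeg (s := s) hR, ← inSeg_joinSeg (s := t) hR]
    exact congrArg _ h

lemma slice_apply {r : Data} {R : Finset Data} (hR : inSeg r R = ∅) (ψ : QMem)
    (s : Finset Data) : slice r R hR ψ s = ψ (joinSeg r s R) := rfl

lemma eq_joinSeg {r : Data} {S s R : Finset Data} (h : inSeg r S = s) (h' : offSeg r S = R) :
    S = joinSeg r s R := by
  rw [← h, ← h', joinSeg_inSeg_offSeg]

theorem isSlice_slice {r : Data} {R : Finset Data} (hR : inSeg r R = ∅) :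
    IsSlice (Data.cons r) (slice r R hR) := by
  classical
  have hmem : ∀ q s, .cons r q ∈ joinSeg r s R ↔ q ∈ s := fun q s => by
    rw [← mem_inSeg, inSeg_joinSeg hR]
  refine ⟨?_, ?_, ?_, ?_⟩
  · intro q ψ
    ext s
    simp only [hadamard_apply, slice_apply, hmem]
    rw [eq_joinSeg (S := (joinSeg r s R).erase (.cons r q)) (s := s.erase q) (R := R)
        (by rw [inSeg_erase, inSeg_joinSeg hR]) (by rw [offSeg_erase, offSeg_joinSeg hR]),
      eq_joinSeg (S := insert (.cons r q) (joinSeg r s R)) (s := insert q s) (R := R)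
        (by rw [inSeg_insert, inSeg_joinSeg hR]) (by rw [offSeg_insert, offSeg_joinSeg hR])]
  · intro q ψ
    ext s
    simp only [tGate_apply, slice_apply, hmem]
  · intro q t ψ
    ext s
    simp only [cnot_apply, slice_apply, hmem, ne_eq, Data.cons.injEq, true_and]
    split_ifs
    · rw [eq_joinSeg (S := symmDiff (joinSeg r s R) {.cons r t}) (s := symmDiff s {t}) (R := R)
        (by rw [inSeg_symmDiff, inSeg_joinSeg hR]) (by rw [offSeg_symmDiff, offSeg_joinSeg hR])]
    · rfl
  · intro q b ψ
    ext s
    simp only [proj_apply, slice_apply, hmem]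

lemma exists_slice_ne_zero (r : Data) {ψ : QMem} (h : ψ ≠ 0) :
    ∃ R, ∃ hR : inSeg r R = ∅, slice r R hR ψ ≠ 0 := by
  obtain ⟨S, hS⟩ := Finsupp.ne_iff.1 h
  refine ⟨offSeg r S, inSeg_offSeg r S, Finsupp.ne_iff.2 ⟨inSeg r S, ?_⟩⟩
  rw [slice_apply, joinSeg_inSeg_offSeg]
  exact hS

/-! ### Product states -/

end QMem

lemma Data.num_injective : Function.Injective Data.num := by
  intro i
  induction i with
  | zero => intro j h; cases j with
    | zero => rfl
    | succ j => simp [Data.num] at h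
  | succ i ih => intro j h; cases j with
    | zero => simp [Data.num] at h
    | succ j => simp only [Data.num, Data.cons.injEq, true_and] at h; rw [ih h]

namespace QMem

/-- As later factors do not occupy segment `i`, exactly one pair of basis states contributes to each
coefficient. The hypothesis `h` is separate because `tensorFrom_support` proves it by induction from
this very formula. -/
lemma tensorFrom_cons_apply_aux {i : ℕ} {l : List QMem} (ψ : QMem)
    (h : ∀ T, tensorFrom (i + 1) l T ≠ 0 → inSeg (.num i) T = ∅) (S : Finset Data) :
    tensorFrom i (ψ :: l) S =
      ψ (inSeg (.num i) S) * tensorFrom (i + 1) l (offSeg (.num i) S) := by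
  classical
  set φ := tensorFrom (i + 1) l with hφ
  have h1 : tensorFrom i (ψ :: l) S = ∑ s ∈ ψ.support, ∑ t ∈ φ.support,
      if s = inSeg (.num i) S then (if t = offSeg (.num i) S then ψ s * φ t else 0) else 0 := by
    rw [tensorFrom, Finsupp.sum, Finsupp.finsetSum_apply]
    refine Finset.sum_congr rfl fun s _ => ?_
    rw [Finsupp.sum, Finsupp.finsetSum_apply]
    refine Finset.sum_congr rfl fun t ht => ?_
    rw [Finsupp.single_apply]
    have h0 : inSeg (.num i) t = ∅ := h t (Finsupp.mem_support_iff.1 ht)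
    have hiff : (s.image (Data.cons (Data.num i)) ∪ t = S) ↔
        s = inSeg (.num i) S ∧ t = offSeg (.num i) S := by
      constructor
      · rintro rfl
        exact ⟨(inSeg_joinSeg h0).symm, (offSeg_joinSeg h0).symm⟩
      · rintro ⟨rfl, rfl⟩
        exact joinSeg_inSeg_offSeg _ _
    simp only [hiff, ite_and, hφ]
  rw [h1]
  have h2 : ∀ s ∈ ψ.support, (∑ t ∈ φ.support,
      if s = inSeg (.num i) S then (if t = offSeg (.num i) S then ψ s * φ t else 0) else 0) =
      if s = inSeg (.num i) S then ψ s * φ (offSeg (.num i) S) else 0 := by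
    intro s _
    split_ifs
    · rw [Finset.sum_ite_eq' φ.support (offSeg (.num i) S) fun t => ψ s * φ t]
      split_ifs with h3
      · rfl
      · rw [Finsupp.notMem_support_iff.1 h3, mul_zero]
    · simp
  rw [Finset.sum_congr rfl h2,
    Finset.sum_ite_eq' ψ.support (inSeg (.num i) S) fun s => ψ s * φ (offSeg (.num i) S)]
  split_ifs with h3
  · rfl
  · rw [Finsupp.notMem_support_iff.1 h3, zero_mul]

lemma tensorFrom_support (l : List QMem) : ∀ (i j : ℕ), j < i → ∀ S,
    tensorFrom i l S ≠ 0 → inSeg (.num j) S = ∅ := by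
  classical
  induction l with
  | nil =>
    intro i j _ S h
    rw [tensorFrom, blank_apply] at h
    split_ifs at h with h0
    · subst h0; ext a; simp
    · exact absurd rfl h
  | cons ψ l ih =>
    intro i j hj S h
    rw [tensorFrom_cons_apply_aux ψ (ih (i + 1) i (Nat.lt_succ_self i))] at h
    have := ih (i + 1) j (by omega) _ (right_ne_zero_of_mul h)
    rwa [inSeg_offSeg_of_ne] at this
    exact fun h => hj.ne (Data.num_injective h)

lemma tensorFrom_cons_apply (i : ℕ) (ψ : QMem) (l : List QMem) (S : Finset Data) :
    tensorFrom i (ψ :: l) S =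
      ψ (inSeg (.num i) S) * tensorFrom (i + 1) l (offSeg (.num i) S) :=
  tensorFrom_cons_apply_aux ψ (tensorFrom_support l (i + 1) i (Nat.lt_succ_self i)) S

lemma tensorFrom_ne_zero (l : List QMem) : ∀ i, (∀ ψ ∈ l, ψ ≠ 0) → tensorFrom i l ≠ 0 := by
  induction l with
  | nil => intro i _; exact blank_ne_zero
  | cons ψ l ih =>
    intro i h
    obtain ⟨s, hs⟩ := Finsupp.ne_iff.1 (h ψ List.mem_cons_self)
    obtain ⟨T, hT⟩ := Finsupp.ne_iff.1 (ih (i + 1) fun φ hφ => h φ (List.mem_cons_of_mem _ hφ))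
    have h0 := tensorFrom_support l (i + 1) i (Nat.lt_succ_self i) T hT
    refine Finsupp.ne_iff.2 ⟨joinSeg (.num i) s T, ?_⟩
    rw [tensorFrom_cons_apply, inSeg_joinSeg h0, offSeg_joinSeg h0]
    exact mul_ne_zero hs hT

lemma tensorFrom_append_blank (l : List QMem) :
    ∀ i, tensorFrom i (l ++ [blank]) = tensorFrom i l := by
  classical
  induction l with
  | nil =>
    intro i
    ext S
    rw [List.nil_append, tensorFrom_cons_apply, tensorFrom, tensorFrom, blank_apply, blank_apply, blank_apply]
    by_cases h : S = ∅
    · subst h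
      have h1 : inSeg (.num i) ∅ = ∅ := by ext; simp
      have h2 : offSeg (.num i) ∅ = ∅ := by ext; simp
      simp [h1, h2]
    · rw [if_neg h]
      by_cases h1 : inSeg (.num i) S = ∅
      · rw [offSeg_eq_self h1, if_neg h, mul_zero]
      · rw [if_neg h1, zero_mul]
  | cons ψ l ih =>
    intro i
    ext S
    rw [List.cons_append, tensorFrom_cons_apply, ih, tensorFrom_cons_apply]

/-- The factors around `ψ` contribute a coefficient that does not depend on `ψ`; this is the form
that `intertwines_of_apply` needs. -/
lemma exists_tensorFrom_apply (pre rest : List QMem) : ∀ i, ∃ κ : Finset Data → ℂ,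
    ∀ ψ S, tensorFrom i (pre ++ ψ :: rest) S =
      ψ (inSeg (.num (i + pre.length)) S) * κ (offSeg (.num (i + pre.length)) S) := by
  induction pre with
  | nil => intro i; exact ⟨_, fun ψ S => tensorFrom_cons_apply i ψ rest S⟩
  | cons φ pre ih =>
    intro i
    obtain ⟨κ, hκ⟩ := ih (i + 1)
    refine ⟨fun R => φ (inSeg (.num i) R) * κ (offSeg (.num i) R), fun ψ S => ?_⟩
    have h1 : i + 1 + pre.length = i + (φ :: pre).length := by simp only [List.length_cons]; omega
    have hne : Data.num (i + (φ :: pre).length) ≠ Data.num i := fun h => by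
      have := Data.num_injective h
      simp only [List.length_cons] at this
      omega
    rw [List.cons_append, tensorFrom_cons_apply, hκ, h1, inSeg_offSeg_of_ne hne]
    simp only []
    rw [inSeg_offSeg_of_ne hne.symm, offSeg_comm]
    ring

/-- A factor of a product state is embedded in it. -/
theorem intertwines_tensor {pre rest : List QMem} (hpre : ∀ ψ ∈ pre, ψ ≠ 0)
    (hrest : ∀ ψ ∈ rest, ψ ≠ 0) :
    Intertwines (Data.cons (.num pre.length)) fun ψ => tensor (pre ++ ψ :: rest) := by
  obtain ⟨κ, hκ⟩ := exists_tensorFrom_apply pre rest 0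
  rw [Nat.zero_add] at hκ
  refine intertwines_of_apply hκ (tensorFrom_ne_zero _ _ fun ψ h => ?_)
  rw [List.mem_append, List.mem_cons] at h
  rcases h with h | rfl | h
  · exact hpre ψ h
  · exact blank_ne_zero
  · exact hrest ψ h

end QMem

/-! ## Total runs with time bounds -/

/-- The store that contains only the input. -/
def initSt (x : Data) : ℕ → Data := Function.update (fun _ => Data.nil) 0 x

/-- From store `s` and memory `m`, the program `P` halts within `t` steps, and `D` is the
distribution of the final store and memory. -/
def Runs (P : Prog) (t : ℕ) (f : Data → Data) (s : ℕ → Data) (m : QMem)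
    (D : PMF ((ℕ → Data) × QMem)) : Prop :=
  ∀ τ, ∃ E : PMF Conf, (∀ k, t ≤ k → exec k P f ⟨s, m, τ⟩ = E.map some) ∧
    (∀ d ∈ E.support, d.time ≤ τ + t) ∧ E.map (fun d => (d.store, d.mem)) = D

/-- The analogue of `Runs` for the remaining iterations of a loop. -/
def LoopRuns (x : ℕ) (P : Prog) (t : ℕ) (f : Data → Data) (s : ℕ → Data) (m : QMem)
    (D : PMF ((ℕ → Data) × QMem)) : Prop :=
  ∀ τ, ∃ E : PMF Conf, (∀ k i, t ≤ k → t ≤ i → iterate x (exec k P f) i ⟨s, m, τ⟩ = E.map some) ∧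
    (∀ d ∈ E.support, d.time ≤ τ + t) ∧ E.map (fun d => (d.store, d.mem)) = D

/-! ### Proof rules for total runs -/

section Rules

variable {P Q : Prog} {t t' t₁ t₂ : ℕ} {f : Data → Data} {s : ℕ → Data} {m : QMem}
  {D : PMF ((ℕ → Data) × QMem)}

lemma Runs.mono (h : Runs P t f s m D) (ht : t ≤ t') : Runs P t' f s m D := by
  intro τ
  obtain ⟨E, h1, h2, h3⟩ := h τ
  exact ⟨E, fun k hk => h1 k (ht.trans hk), fun d hd => (h2 d hd).trans (by omega), h3⟩

lemma LoopRuns.mono {x : ℕ} (h : LoopRuns x P t f s m D) (ht : t ≤ t') :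
    LoopRuns x P t' f s m D := by
  intro τ
  obtain ⟨E, h1, h2, h3⟩ := h τ
  exact ⟨E, fun k i hk hi => h1 k i (ht.trans hk) (ht.trans hi),
    fun d hd => (h2 d hd).trans (by omega), h3⟩

lemma Runs.assign (x : ℕ) (e : Expr) :
    Runs (.assign x e) (1 + (e.eval s).size) f s m
      (PMF.pure (Function.update s x (e.eval s), m)) := by
  intro τ
  refine ⟨PMF.pure (Conf.write ⟨s, m, τ⟩ x (e.eval s)), fun k _ => ?_, ?_, ?_⟩
  · simp [exec, PMF.pure_map]
  · simp [Conf.write]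
  · simp [PMF.pure_map, Conf.write]

lemma Runs.flip (x : ℕ) :
    Runs (.flip x) 4 f s m (fairCoin.map fun b => (Function.update s x (.bit b), m)) := by
  intro τ
  refine ⟨fairCoin.map fun b => Conf.write ⟨s, m, τ⟩ x (.bit b), fun k _ => ?_, ?_, ?_⟩
  · simp [exec, PMF.map_comp, Function.comp_def]
  · intro d hd
    rw [PMF.support_map] at hd
    obtain ⟨b, _, rfl⟩ := hd
    have := Data.size_bit b
    simp only [Conf.write]
    omega
  · simp [PMF.map_comp, Function.comp_def, Conf.write]

/-- The common core of sequencing and of loops: the index `ι` ranges over cut-offs in the first case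
and over pairs of cut-offs in the second, and one law `E` has to serve all of them. -/
lemma exists_bind_conf {ι : Type} {E₁ : PMF Conf} {t : ℕ} {τ : ℕ}
    {X : ι → Conf → PMF (Option Conf)} {p : ι → Prop} {D₂ : (ℕ → Data) × QMem → PMF ((ℕ → Data) × QMem)}
    (hτ : ∀ d ∈ E₁.support, d.time ≤ τ + t₁)
    (h : ∀ d ∈ E₁.support, ∃ E : PMF Conf, (∀ k, p k → X k d = E.map some) ∧
      (∀ d' ∈ E.support, d'.time ≤ d.time + t₂) ∧
      E.map (fun d => (d.store, d.mem)) = D₂ (d.store, d.mem)) (ht : t₁ + t₂ ≤ t) :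
    ∃ E : PMF Conf, (∀ k, p k → E₁.bind (X k) = E.map some) ∧
      (∀ d' ∈ E.support, d'.time ≤ τ + t) ∧
      E.map (fun d => (d.store, d.mem)) = (E₁.map fun d => (d.store, d.mem)).bind D₂ := by
  have h' : ∀ d, ∃ E : PMF Conf, d ∈ E₁.support → (∀ k, p k → X k d = E.map some) ∧
      (∀ d' ∈ E.support, d'.time ≤ d.time + t₂) ∧
      E.map (fun d => (d.store, d.mem)) = D₂ (d.store, d.mem) := by
    intro d
    by_cases hd : d ∈ E₁.support
    · obtain ⟨E, hE⟩ := h d hd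
      exact ⟨E, fun _ => hE⟩
    · exact ⟨PMF.pure d, fun hd' => absurd hd' hd⟩
  choose E hE using h'
  refine ⟨E₁.bind E, fun k hk => ?_, ?_, ?_⟩
  · rw [PMF.map_bind]
    exact bind_congr_support fun d hd => (hE d hd).1 k hk
  · intro d' hd'
    rw [PMF.mem_support_bind_iff] at hd'
    obtain ⟨d, hd, hd'⟩ := hd'
    have h1 := hτ d hd
    have h2 := (hE d hd).2.1 d' hd'
    omega
  · rw [PMF.map_bind, PMF.bind_map]
    exact bind_congr_support fun d hd => (hE d hd).2.2

lemma mem_support_map_conf {E : PMF Conf} (h : E.map (fun d => (d.store, d.mem)) = D) {d : Conf}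
    (hd : d ∈ E.support) : (d.store, d.mem) ∈ D.support := by
  rw [← h, PMF.support_map]
  exact ⟨d, hd, rfl⟩

lemma Runs.seq {D₂ : (ℕ → Data) × QMem → PMF ((ℕ → Data) × QMem)} (h₁ : Runs P t₁ f s m D)
    (h₂ : ∀ p ∈ D.support, Runs Q t₂ f p.1 p.2 (D₂ p)) :
    Runs (.seq P Q) (t₁ + t₂) f s m (D.bind D₂) := by
  intro τ
  obtain ⟨E₁, h1, h2, h3⟩ := h₁ τ
  obtain ⟨E, hE1, hE2, hE3⟩ := exists_bind_conf (X := fun k => exec k Q f) (p := fun k => t₂ ≤ k)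
    (D₂ := D₂) h2 (fun d hd => h₂ _ (mem_support_map_conf h3 hd) d.time) le_rfl
  refine ⟨E, fun k hk => ?_, hE2, by rw [hE3, h3]⟩
  rw [exec, h1 k (by omega), andThen_map_some]
  exact hE1 k (by omega)

lemma Runs.cond_cons {x : ℕ} (hx : s x ≠ .nil) (h : Runs P t f s m D) :
    Runs (.cond x P Q) (1 + t) f s m D := by
  intro τ
  obtain ⟨E, h1, h2, h3⟩ := h (τ + 1)
  refine ⟨E, fun k hk => ?_, fun d hd => (h2 d hd).trans (by omega), h3⟩
  rw [exec]
  cases hs : s x with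
  | nil => exact absurd hs hx
  | cons a b => simp only [hs]; exact h1 k (by omega)

lemma Runs.cond_nil {x : ℕ} (hx : s x = .nil) (h : Runs Q t f s m D) :
    Runs (.cond x P Q) (1 + t) f s m D := by
  intro τ
  obtain ⟨E, h1, h2, h3⟩ := h (τ + 1)
  refine ⟨E, fun k hk => ?_, fun d hd => (h2 d hd).trans (by omega), h3⟩
  rw [exec]
  simp only [hx]
  exact h1 k (by omega)

lemma LoopRuns.runs {x : ℕ} (h : LoopRuns x P t f s m D) : Runs (.loop x P) t f s m D := by
  intro τ
  obtain ⟨E, h1, h2, h3⟩ := h τ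
  exact ⟨E, fun k hk => h1 k k hk hk, h2, h3⟩

lemma LoopRuns.nil {x : ℕ} (hx : s x = .nil) : LoopRuns x P 1 f s m (PMF.pure (s, m)) := by
  intro τ
  refine ⟨PMF.pure ⟨s, m, τ + 1⟩, fun k i _ hi => ?_, by simp, by simp [PMF.pure_map]⟩
  obtain ⟨i, rfl⟩ : ∃ i', i = i' + 1 := ⟨i - 1, by omega⟩
  simp only [iterate, hx, PMF.pure_map]
  rfl

lemma LoopRuns.cons {x : ℕ} {D₂ : (ℕ → Data) × QMem → PMF ((ℕ → Data) × QMem)}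
    (hx : s x ≠ .nil) (h₁ : Runs P t₁ f s m D)
    (h₂ : ∀ p ∈ D.support, LoopRuns x P t₂ f p.1 p.2 (D₂ p)) :
    LoopRuns x P (1 + t₁ + t₂) f s m (D.bind D₂) := by
  intro τ
  obtain ⟨E₁, h1, h2, h3⟩ := h₁ (τ + 1)
  obtain ⟨E, hE1, hE2, hE3⟩ := exists_bind_conf (ι := ℕ × ℕ) (τ := τ) (t₁ := 1 + t₁)
    (X := fun j d => iterate x (exec j.1 P f) j.2 d) (p := fun j => t₂ ≤ j.1 ∧ t₂ ≤ j.2)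
    (D₂ := D₂) (fun d hd => (h2 d hd).trans (by omega)) (fun d hd => by
      obtain ⟨E, hE1, hE2⟩ := h₂ _ (mem_support_map_conf h3 hd) d.time
      exact ⟨E, fun j hj => hE1 j.1 j.2 hj.1 hj.2, hE2⟩) le_rfl
  refine ⟨E, fun k i hk hi => ?_, hE2, by rw [hE3, h3]⟩
  obtain ⟨i, rfl⟩ : ∃ i', i = i' + 1 := ⟨i - 1, by omega⟩
  have h5 := hE1 (k, i) ⟨by simp only; omega, by simp only; omega⟩
  rw [iterate]
  cases hs : s x with
  | nil => exact absurd hs hx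
  | cons a b =>
    simp only [hs]
    rw [← h5, ← andThen_map_some, ← h1 k (by omega)]
    rfl

lemma Runs.call {x : ℕ} {e : Expr} {b : ℕ} (h : Runs P t id (initSt (e.eval s)) QMem.blank D)
    (hb : ∀ d ∈ D.support, (d.1 0).size ≤ b) :
    Runs (.call x P e) (2 + (e.eval s).size + t + b) f s m
      (D.map fun d => (Function.update s x (d.1 0), m)) := by
  intro τ
  obtain ⟨E, h1, h2, h3⟩ := h (τ + (1 + (e.eval s).size))
  refine ⟨E.map fun d => Conf.write ⟨s, m, d.time⟩ x (d.store 0), fun k hk => ?_, ?_, ?_⟩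
  · have := h1 k (by omega)
    simp only [exec]
    rw [show Conf.init (e.eval s) QMem.blank (τ + (1 + (e.eval s).size)) =
      ⟨initSt (e.eval s), QMem.blank, τ + (1 + (e.eval s).size)⟩ from rfl, this, andThen_map_some,
      PMF.map_comp, ← PMF.bind_pure_comp]
    rfl
  · intro d hd
    rw [PMF.support_map] at hd
    obtain ⟨d, hd, rfl⟩ := hd
    have h4 := h2 d hd
    have h5 := hb _ (mem_support_map_conf h3 hd)
    simp only [Conf.write] at *
    omega
  · rw [← h3, PMF.map_comp, PMF.map_comp]
    rfl

lemma Runs.callOn {x : ℕ} {r e : Expr} {b : ℕ}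
    (h : Runs P t (fun a => f (.cons (r.eval s) a)) (initSt (e.eval s)) m D)
    (hb : ∀ d ∈ D.support, (d.1 0).size ≤ b) :
    Runs (.callOn x r P e) (2 + (r.eval s).size + (e.eval s).size + t + b) f s m
      (D.map fun d => (Function.update s x (d.1 0), d.2)) := by
  intro τ
  obtain ⟨E, h1, h2, h3⟩ := h (τ + (1 + (r.eval s).size + (e.eval s).size))
  refine ⟨E.map fun d => Conf.write ⟨s, d.mem, d.time⟩ x (d.store 0), fun k hk => ?_, ?_, ?_⟩
  · have := h1 k (by omega)
    simp only [exec]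
    rw [show Conf.init (e.eval s) m (τ + (1 + (r.eval s).size + (e.eval s).size)) =
      ⟨initSt (e.eval s), m, τ + (1 + (r.eval s).size + (e.eval s).size)⟩ from rfl, this,
      andThen_map_some, PMF.map_comp, ← PMF.bind_pure_comp]
    rfl
  · intro d hd
    rw [PMF.support_map] at hd
    obtain ⟨d, hd, rfl⟩ := hd
    have h4 := h2 d hd
    have h5 := hb _ (mem_support_map_conf h3 hd)
    simp only [Conf.write] at *
    omega
  · rw [← h3, PMF.map_comp, PMF.map_comp]
    rfl

lemma Runs.push {Φ : QMem → QMem} {g : Data → Data} (h : Runs P t g s m D)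
    (hΦ : Intertwines f Φ) :
    Runs P t (fun q => f (g q)) s (Φ m) (D.map fun d => (d.1, Φ d.2)) := by
  intro τ
  obtain ⟨E, h1, h2, h3⟩ := h τ
  refine ⟨E.map (Conf.push Φ 0), fun k hk => ?_, ?_, ?_⟩
  · have := exec_push (k := k) P hΦ 0 g ⟨s, m, τ⟩
    rw [h1 k hk, PMF.map_comp] at this
    rw [PMF.map_comp]
    exact this
  · intro d hd
    rw [PMF.support_map] at hd
    obtain ⟨d, hd, rfl⟩ := hd
    exact h2 d hd
  · rw [← h3, PMF.map_comp, PMF.map_comp]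
    rfl

end Rules

/-- Distribution of the final store and memory of a run that is not cut off. -/
def finalState (t : ℕ) (P : Prog) (f : Data → Data) (s : ℕ → Data) (m : QMem) :
    PMF ((ℕ → Data) × QMem) :=
  (exec t P f ⟨s, m, 0⟩).map fun o => o.elim (s, m) fun c => (c.store, c.mem)

/-- Halting is known for one cut-off and clock 0 only. `exec_mono` passes to larger cut-offs and
`exec_push` with the identity to other starting times. -/
lemma runs_finalState {P : Prog} {t : ℕ} {f : Data → Data} {s : ℕ → Data} {m : QMem}
    (h : ∀ r ∈ (exec t P f ⟨s, m, 0⟩).support, ∃ c : Conf, r = some c ∧ c.time ≤ t) :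
    Runs P t f s m (finalState t P f s m) := by
  obtain ⟨E₀, h0⟩ : ∃ E₀ : PMF Conf, exec t P f ⟨s, m, 0⟩ = E₀.map some := by
    refine ⟨(exec t P f ⟨s, m, 0⟩).map fun o => o.getD ⟨s, m, 0⟩, ?_⟩
    rw [PMF.map_comp]
    conv_lhs => rw [← PMF.map_id (exec t P f ⟨s, m, 0⟩)]
    refine map_congr_support fun r hr => ?_
    obtain ⟨c, rfl, _⟩ := h r hr
    rfl
  have hnone : none ∉ (exec t P f ⟨s, m, 0⟩).support := fun hn => by
    obtain ⟨c, hc, _⟩ := h none hn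
    cases hc
  intro τ
  refine ⟨E₀.map (Conf.push id τ), fun k hk => ?_, ?_, ?_⟩
  · have h1 := exec_push (k := k) P Intertwines.id τ f ⟨s, m, 0⟩
    rw [exec_mono hk P f _ hnone, h0, PMF.map_comp] at h1
    rw [PMF.map_comp, show (⟨s, m, τ⟩ : Conf) = Conf.push id τ ⟨s, m, 0⟩ by simp [Conf.push]]
    exact h1
  · intro d hd
    rw [PMF.support_map] at hd
    obtain ⟨d, hd, rfl⟩ := hd
    have : some d ∈ (exec t P f ⟨s, m, 0⟩).support := by
      rw [h0, PMF.support_map]; exact ⟨d, hd, rfl⟩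
    obtain ⟨c, hc, hct⟩ := h _ this
    cases hc
    simp only [Conf.push]
    omega
  · rw [finalState, h0, PMF.map_comp, PMF.map_comp]
    rfl

lemma mem_support_finalState {P : Prog} {t : ℕ} {f : Data → Data} {s : ℕ → Data} {m : QMem}
    (h : ∀ r ∈ (exec t P f ⟨s, m, 0⟩).support, ∃ c : Conf, r = some c ∧ c.time ≤ t)
    {d : (ℕ → Data) × QMem} (hd : d ∈ (finalState t P f s m).support) :
    (m ≠ 0 → d.2 ≠ 0) ∧ ∀ B, (∀ i, (s i).size ≤ B) → ∀ i, (d.1 i).size ≤ B + t := by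
  rw [finalState, PMF.support_map] at hd
  obtain ⟨r, hr, rfl⟩ := hd
  obtain ⟨c, rfl, hc⟩ := h r hr
  have he := exec_evolves P _ _ _ hr
  refine ⟨he.mem, fun B hB i => ?_⟩
  have := he.store B hB i
  simp only [Option.elim_some]
  omega

lemma size_initSt (x : Data) (i : ℕ) : (initSt x i).size ≤ x.size := by
  rw [initSt, Function.update_apply]
  split_ifs
  · exact le_rfl
  · exact x.one_le_size

section Algorithms

variable {A : Set QMem} (M : Alg A) (x : Data) {ψ : QMem}

lemma Alg.runs (hψ : ψ ∈ A) : Runs M.prog (M.bound.eval x.size) id (initSt x) ψ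
    (finalState (M.bound.eval x.size) M.prog id (initSt x) ψ) :=
  runs_finalState (M.halts x ψ hψ)

lemma Alg.run_eq (hψ : ψ ∈ A) : M.run x ψ =
    (finalState (M.bound.eval x.size) M.prog id (initSt x) ψ).map fun d => (d.1 0, d.2) := by
  rw [Alg.run, finalState, PMF.map_comp]
  refine map_congr_support fun r hr => ?_
  obtain ⟨c, rfl, _⟩ := M.halts x ψ hψ r hr
  rfl

lemma Alg.size_le_of_mem_support (hψ : ψ ∈ A) {d : (ℕ → Data) × QMem}
    (hd : d ∈ (finalState (M.bound.eval x.size) M.prog id (initSt x) ψ).support) :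
    (d.1 0).size ≤ x.size + M.bound.eval x.size :=
  (mem_support_finalState (M.halts x ψ hψ) hd).2 _ (size_initSt x) 0

/-- The bound `t` need not be that of the algorithm; both runs are compared under the larger
cut-off, where they have the same law. -/
lemma Alg.run_eq_of_runs (hψ : ψ ∈ A) {t : ℕ} {D : PMF ((ℕ → Data) × QMem)}
    (h : Runs M.prog t id (initSt x) ψ D) : M.run x ψ = D.map fun d => (d.1 0, d.2) := by
  obtain ⟨E, h1, _, h3⟩ := h 0
  obtain ⟨E', h1', _, h3'⟩ := M.runs x hψ 0
  have hE : E'.map some = E.map some := by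
    rw [← h1 _ (le_max_left t (M.bound.eval x.size)), h1' _ (le_max_right t _)]
  have hE' : E' = E := by
    have := congrArg (PMF.map fun o : Option Conf => o.getD ⟨initSt x, ψ, 0⟩) hE
    rw [PMF.map_comp, PMF.map_comp] at this
    exact (PMF.map_id E').symm.trans (this.trans (PMF.map_id E))
  rw [M.run_eq x hψ, ← h3', hE', h3]

lemma Alg.mem_ne_zero (hψ : ψ ∈ A) (h0 : ψ ≠ 0) {y : Data × QMem}
    (hy : y ∈ (M.run x ψ).support) : y.2 ≠ 0 := by
  rw [M.run_eq x hψ, PMF.support_map] at hy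
  obtain ⟨d, hd, rfl⟩ := hy
  exact (mem_support_finalState (M.halts x ψ hψ) hd).1 h0

/-- A program all of whose runs are bounded polynomially is an algorithm. -/
lemma exists_alg {P : Prog} {A : Set QMem} {p : Polynomial ℕ}
    (h : ∀ x, ∀ ψ ∈ A, ∃ D, Runs P (p.eval x.size) id (initSt x) ψ D) :
    ∃ M : Alg A, M.prog = P := by
  refine ⟨⟨P, p, fun x ψ hψ r hr => ?_⟩, rfl⟩
  obtain ⟨D, hD⟩ := h x ψ hψ
  obtain ⟨E, h1, h2, _⟩ := hD 0
  rw [show Conf.init x ψ 0 = ⟨initSt x, ψ, 0⟩ from rfl, h1 _ le_rfl, PMF.support_map] at hr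
  obtain ⟨c, hc, rfl⟩ := hr
  exact ⟨c, rfl, by simpa using h2 c hc⟩

end Algorithms

@[simp] lemma pmf_map_id {α : Type} (m : PMF α) : m.map (fun x => x) = m := PMF.map_id m

lemma polynomial_eval_mono (p : Polynomial ℕ) : Monotone fun n => p.eval n := by
  intro a b hab
  simp only [Polynomial.eval_eq_sum_range]
  exact Finset.sum_le_sum fun i _ => Nat.mul_le_mul_left _ (Nat.pow_le_pow_left hab i)

/-! ## Efficiently computable random functions -/

/-- `P` computes the random function `F` in polynomial time. -/
def Computes (P : Prog) (F : Data → PMF Data) : Prop :=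
  ∃ p : Polynomial ℕ, ∀ x, (∀ y ∈ (F x).support, y.size ≤ p.eval x.size) ∧
    ∃ D, Runs P (p.eval x.size) id (initSt x) QMem.blank D ∧ D.map (fun d => d.1 0) = F x

/-- Classes of programs that are closed under the classical control structures. -/
class ProgClass (C : Prog → Prop) : Prop where
  assign : ∀ x e, C (.assign x e)
  seq : ∀ {P Q}, C P → C Q → C (.seq P Q)
  cond : ∀ {x P Q}, C P → C Q → C (.cond x P Q)
  loop : ∀ {x P}, C P → C (.loop x P)
  call : ∀ {x P e}, C P → C (.call x P e)

/-- All programs. -/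
def AnyProg (_ : Prog) : Prop := True

instance : ProgClass AnyProg := by constructor <;> intros <;> trivial

instance : ProgClass Prog.IsClassical where
  assign _ _ := trivial
  seq h h' := ⟨h, h'⟩
  cond h h' := ⟨h, h'⟩
  loop h := h
  call h := h

instance : ProgClass Prog.IsDeterministic where
  assign _ _ := trivial
  seq h h' := ⟨h, h'⟩
  cond h h' := ⟨h, h'⟩
  loop h := h
  call h := h

/-- `F` is computed in polynomial time by a program from `C`. -/
def Comp (C : Prog → Prop) (F : Data → PMF Data) : Prop := ∃ P, C P ∧ Computes P F

/-- The function `f` is computed in polynomial time by a program from `C`. -/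
def DComp (C : Prog → Prop) (f : Data → Data) : Prop := Comp C fun x => PMF.pure (f x)

lemma Comp.mono {C C' : Prog → Prop} (hC : ∀ P, C P → C' P) {F : Data → PMF Data}
    (h : Comp C F) : Comp C' F :=
  let ⟨P, hP, hF⟩ := h
  ⟨P, hC P hP, hF⟩

lemma Comp.size_le {C : Prog → Prop} {F : Data → PMF Data} (h : Comp C F) :
    ∃ p : Polynomial ℕ, ∀ x, ∀ y ∈ (F x).support, y.size ≤ p.eval x.size :=
  let ⟨_, _, p, hp⟩ := h
  ⟨p, fun x => (hp x).1⟩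

lemma DComp.size_le {C : Prog → Prop} {f : Data → Data} (h : DComp C f) :
    ∃ p : Polynomial ℕ, ∀ x, (f x).size ≤ p.eval x.size := by
  obtain ⟨p, hp⟩ := Comp.size_le h
  exact ⟨p, fun x => hp x _ (by simp)⟩

/-- Algorithms compute their output distributions. -/
lemma Comp.of_alg {C : Prog → Prop} (M : QPT) (hM : C M.prog) :
    Comp C fun x => M.out x QMem.blank := by
  refine ⟨M.prog, hM, Polynomial.X + M.bound, fun x => ⟨fun y hy => ?_, _,
    (M.runs x rfl).mono (by simp), ?_⟩⟩
  · simp only [Alg.out] at hy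
    rw [M.run_eq x rfl, PMF.map_comp, PMF.support_map] at hy
    obtain ⟨d, hd, rfl⟩ := hy
    simpa using M.size_le_of_mem_support x rfl hd
  · simp only [Alg.out]
    rw [M.run_eq x rfl, PMF.map_comp]
    rfl

lemma Comp.exists_alg {C : Prog → Prop} {F : Data → PMF Data} (h : Comp C F) :
    ∃ M : QPT, C M.prog ∧ ∀ x, M.out x QMem.blank = F x := by
  obtain ⟨P, hP, p, hp⟩ := h
  obtain ⟨M, rfl⟩ := QPuzzle.exists_alg (P := P) (A := {QMem.blank}) (p := p) (by
    rintro x ψ rfl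
    obtain ⟨_, D, hD, _⟩ := hp x
    exact ⟨D, hD⟩)
  refine ⟨M, hP, fun x => ?_⟩
  obtain ⟨_, D, hD, hF⟩ := hp x
  rw [Alg.out, M.run_eq_of_runs x rfl hD, PMF.map_comp, ← hF]
  rfl

/-- A subroutine works on its own variables and memory, so the caller only sees variable `i` change.
This is what lets computable functions be composed without bookkeeping of variables. -/
lemma Computes.call {P : Prog} {F : Data → PMF Data} (h : Computes P F) :
    ∃ q : Polynomial ℕ, ∀ (i : ℕ) (e : Expr) (f : Data → Data) (s : ℕ → Data) (m : QMem),
      Runs (.call i P e) (q.eval (e.eval s).size) f s m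
        ((F (e.eval s)).map fun y => (Function.update s i y, m)) := by
  obtain ⟨p, hp⟩ := h
  refine ⟨2 + Polynomial.X + p + p, fun i e f s m => ?_⟩
  obtain ⟨h1, D, h2, h3⟩ := hp (e.eval s)
  have := Runs.call (x := i) (e := e) (f := f) (m := m) h2 (b := p.eval (e.eval s).size)
    fun d hd => h1 _ (by rw [← h3, PMF.support_map]; exact ⟨d, hd, rfl⟩)
  rw [← h3, PMF.map_comp]
  refine this.mono (by simp)

/-- Subroutine calls, with a bound on the size of the argument. -/
lemma Runs.of_call {P : Prog} {F : Data → PMF Data} {q : Polynomial ℕ}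
    (hq : ∀ (i : ℕ) (e : Expr) (f : Data → Data) (s : ℕ → Data) (m : QMem),
      Runs (.call i P e) (q.eval (e.eval s).size) f s m
        ((F (e.eval s)).map fun y => (Function.update s i y, m)))
    {f : Data → Data} {s : ℕ → Data} {m : QMem} (i : ℕ) (e : Expr) {n : ℕ}
    (hn : (e.eval s).size ≤ n) {D : PMF ((ℕ → Data) × QMem)}
    (hD : (F (e.eval s)).map (fun y => (Function.update s i y, m)) = D) :
    Runs (.call i P e) (q.eval n) f s m D :=
  hD ▸ (hq i e f s m).mono (polynomial_eval_mono q hn)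

lemma update_initSt (x y : Data) : Function.update (initSt x) 0 y = initSt y := by
  simp [initSt]

lemma initSt_zero (x : Data) : initSt x 0 = x := by simp [initSt]

lemma Expr.exists_size_le (e : Expr) :
    ∃ p : Polynomial ℕ, ∀ x, (e.eval (initSt x)).size ≤ p.eval x.size := by
  have htd : ∀ d : Data, d.hd.size ≤ d.size ∧ d.tl.size ≤ d.size := by
    intro d
    cases d <;> (simp [Data.hd, Data.tl, Data.size]; try omega)
  induction e with
  | var i => exact ⟨Polynomial.X, fun x => by simpa [Expr.eval] using size_initSt x i⟩
  | nil => exact ⟨1, fun x => by simp [Expr.eval, Data.size]⟩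
  | cons a b iha ihb =>
    obtain ⟨p, hp⟩ := iha
    obtain ⟨q, hq⟩ := ihb
    refine ⟨1 + p + q, fun x => ?_⟩
    have := hp x
    have := hq x
    simp only [Expr.eval, Data.size, Polynomial.eval_add, Polynomial.eval_one]
    omega
  | hd a ih => obtain ⟨p, hp⟩ := ih; exact ⟨p, fun x => (htd _).1.trans (hp x)⟩
  | tl a ih => obtain ⟨p, hp⟩ := ih; exact ⟨p, fun x => (htd _).2.trans (hp x)⟩

section

variable {C : Prog → Prop} [ProgClass C] {F G : Data → PMF Data} {f g h : Data → Data}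

/-- The output size bound is part of `Computes` precisely for this: the second time bound is
evaluated at a polynomial bound for the intermediate value. -/
theorem Comp.comp (hF : Comp C F) (hG : Comp C G) : Comp C fun x => (F x).bind G := by
  obtain ⟨P, hPC, hP⟩ := hF
  obtain ⟨Q, hQC, hQ⟩ := hG
  obtain ⟨q₁, hq₁⟩ := hP.call
  obtain ⟨q₂, hq₂⟩ := hQ.call
  obtain ⟨p₁, hp₁⟩ := hP
  obtain ⟨p₂, hp₂⟩ := hQ
  refine ⟨.seq (.call 0 P (.var 0)) (.call 0 Q (.var 0)),
    ProgClass.seq (ProgClass.call hPC) (ProgClass.call hQC),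
    q₁ + q₂.comp p₁ + p₂.comp p₁, fun x => ⟨fun z hz => ?_, ?_⟩⟩
  · rw [PMF.mem_support_bind_iff] at hz
    obtain ⟨y, hy, hz⟩ := hz
    have h1 := (hp₂ y).1 z hz
    have h2 := polynomial_eval_mono p₂ ((hp₁ x).1 y hy)
    simp only [Polynomial.eval_add, Polynomial.eval_comp]
    simp only at h2
    omega
  · have key := Runs.seq (f := id)
      (Runs.of_call hq₁ (f := id) (s := initSt x) (m := QMem.blank) 0 (.var 0)
        (n := x.size) (by simp [Expr.eval, initSt_zero]) rfl)
      (Q := .call 0 Q (.var 0)) (t₂ := q₂.eval (p₁.eval x.size))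
      (D₂ := fun p => (G (p.1 0)).map fun y => (initSt y, QMem.blank)) (by
        intro p hp
        rw [PMF.support_map] at hp
        obtain ⟨y, hy, rfl⟩ := hp
        simp only [Expr.eval, initSt_zero] at hy
        simp only [update_initSt, initSt_zero]
        exact Runs.of_call hq₂ 0 (.var 0) (by simpa [Expr.eval, initSt_zero] using (hp₁ x).1 y hy)
          (by simp [Expr.eval, update_initSt, initSt_zero]))
    refine ⟨_, key.mono (by simp), ?_⟩
    simp [PMF.bind_map, PMF.map_bind, PMF.map_comp, Function.comp_def, Expr.eval, initSt_zero,
      pmf_map_id]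

theorem Comp.pairing (hF : Comp C F) : Comp C fun x => (F x).map (Data.cons x) := by
  obtain ⟨P, hPC, hP⟩ := hF
  obtain ⟨q₁, hq₁⟩ := hP.call
  obtain ⟨p₁, hp₁⟩ := hP
  refine ⟨.seq (.call 1 P (.var 0)) (.assign 0 (.cons (.var 0) (.var 1))),
    ProgClass.seq (ProgClass.call hPC) (ProgClass.assign _ _),
    q₁ + (1 + (1 + Polynomial.X + p₁)), fun x => ⟨fun z hz => ?_, ?_⟩⟩
  · rw [PMF.support_map] at hz
    obtain ⟨y, hy, rfl⟩ := hz
    have h1 := (hp₁ x).1 y hy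
    simp [Data.size]
    omega
  · have key := Runs.seq (f := id)
      (Runs.of_call hq₁ (f := id) (s := initSt x) (m := QMem.blank) 1 (.var 0)
        (n := x.size) (by simp [Expr.eval, initSt_zero]) rfl)
      (Q := .assign 0 (.cons (.var 0) (.var 1))) (t₂ := 1 + (1 + x.size + p₁.eval x.size))
      (D₂ := fun p => PMF.pure (Function.update p.1 0 (.cons (p.1 0) (p.1 1)), p.2)) (by
        intro p hp
        rw [PMF.support_map] at hp
        obtain ⟨y, hy, rfl⟩ := hp
        simp only [Expr.eval, initSt_zero] at hy
        have h1 := (hp₁ x).1 y hy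
        refine (Runs.assign 0 _).mono ?_
        simp [Expr.eval, initSt_zero, Data.size]
        omega)
    refine ⟨_, key.mono (by simp), ?_⟩
    change _ = PMF.map x.cons (F x)
    rw [← PMF.bind_pure_comp x.cons]
    simp [PMF.bind_map, PMF.map_bind, PMF.pure_map, Function.comp_def, Expr.eval, initSt_zero]

lemma DComp.expr (e : Expr) : DComp C fun x => e.eval (initSt x) := by
  obtain ⟨p, hp⟩ := e.exists_size_le
  refine ⟨.assign 0 e, ProgClass.assign _ _, 1 + p, fun x => ⟨?_, _,
    (Runs.assign 0 e).mono ?_, by simp [PMF.pure_map]⟩⟩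
  · have := hp x
    simp
    omega
  · have := hp x
    simp
    omega

theorem Comp.sel (hf : DComp C f) (hF : Comp C F) (hG : Comp C G) :
    Comp C fun x => match f x with
      | .nil => G x
      | .cons _ _ => F x := by
  obtain ⟨R, hRC, hR⟩ := hf
  obtain ⟨P, hPC, hP⟩ := hF
  obtain ⟨Q, hQC, hQ⟩ := hG
  obtain ⟨q₀, hq₀⟩ := hR.call
  obtain ⟨q₁, hq₁⟩ := hP.call
  obtain ⟨q₂, hq₂⟩ := hQ.call
  obtain ⟨p₁, hp₁⟩ := hP
  obtain ⟨p₂, hp₂⟩ := hQ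
  refine ⟨.seq (.call 1 R (.var 0)) (.cond 1 (.call 0 P (.var 0)) (.call 0 Q (.var 0))),
    ProgClass.seq (ProgClass.call hRC) (ProgClass.cond (ProgClass.call hPC) (ProgClass.call hQC)),
    q₀ + (1 + (q₁ + q₂)) + p₁ + p₂, fun x => ⟨fun z hz => ?_, ?_⟩⟩
  · have h1 := (hp₁ x).1 z
    have h2 := (hp₂ x).1 z
    simp only [Polynomial.eval_add]
    cases hx : f x with
    | nil => simp only [hx] at hz; have := h2 hz; omega
    | cons a b => simp only [hx] at hz; have := h1 hz; omega
  · have hu : ∀ y, Function.update (initSt x) 1 y 0 = x := fun y => by simp [initSt_zero]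
    have h0 := Runs.of_call (F := fun x => PMF.pure (f x)) hq₀ (f := id) (s := initSt x) (m := QMem.blank) 1 (.var 0)
        (n := x.size) (by simp [Expr.eval, initSt_zero]) rfl
    simp only [Expr.eval, initSt_zero, PMF.pure_map] at h0
    have key := Runs.seq h0
      (Q := .cond 1 (.call 0 P (.var 0)) (.call 0 Q (.var 0)))
      (t₂ := 1 + (q₁.eval x.size + q₂.eval x.size))
      (D₂ := fun p => (match f x with
        | .nil => G x
        | .cons _ _ => F x).map fun y => (Function.update p.1 0 y, p.2)) (by
        intro p hp
        simp only [PMF.support_pure, Set.mem_singleton_iff] at hp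
        subst hp
        cases hx : f x with
        | nil =>
          refine (Runs.cond_nil (by simp) (Runs.of_call hq₂ 0 (.var 0) (n := x.size)
            (by simp [Expr.eval, initSt_zero]) ?_)).mono (t := 1 + q₂.eval x.size) (by omega)
          simp [Expr.eval, initSt_zero]
        | cons a b =>
          refine (Runs.cond_cons (by simp) (Runs.of_call hq₁ 0 (.var 0) (n := x.size)
            (by simp [Expr.eval, initSt_zero]) ?_)).mono (t := 1 + q₁.eval x.size) (by omega)
          simp [Expr.eval, initSt_zero])
    refine ⟨_, key.mono (by simp; omega), ?_⟩
    simp [PMF.map_comp, Function.comp_def]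

lemma Comp.flip : Comp AnyProg fun _ => fairCoin.map Data.bit := by
  refine ⟨.flip 0, trivial, 4, fun x => ⟨fun y hy => ?_, _, (Runs.flip 0).mono (by simp), ?_⟩⟩
  · rw [PMF.support_map] at hy
    obtain ⟨b, _, rfl⟩ := hy
    have := Data.size_bit b
    simp
    omega
  · simp [PMF.map_comp, Function.comp_def]

end

/-! ### Loops -/

/-- Iterate the random function `F` along the spine of `c`, with environment `env` and
accumulator `acc`. -/
def foldD (F : Data → PMF Data) (env : Data) : Data → Data → PMF Data
  | .nil, acc => PMF.pure acc
  | .cons a c, acc => (F (.cons env (.cons a acc))).bind (foldD F env c)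

/-- The store with the given values of variables `0`, `1`, `2`. -/
def st3 (a b c : Data) : ℕ → Data
  | 0 => a
  | 1 => b
  | 2 => c
  | _ + 3 => .nil

lemma update_st3_zero (a b c y : Data) : Function.update (st3 a b c) 0 y = st3 y b c := by
  funext i
  rcases i with _ | _ | _ | i <;> simp [st3]

lemma update_st3_one (a b c y : Data) : Function.update (st3 a b c) 1 y = st3 a y c := by
  funext i
  rcases i with _ | _ | _ | i <;> simp [st3]

lemma update_st3_two (a b c y : Data) : Function.update (st3 a b c) 2 y = st3 a b y := by
  funext i
  rcases i with _ | _ | _ | i <;> simp [st3]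

lemma initSt_eq_st3 (x : Data) : initSt x = st3 x .nil .nil := by
  funext i
  rcases i with _ | _ | _ | i <;> simp [initSt, st3]

/-- The body of a loop along variable `2` with environment `1` and accumulator `0`. -/
def foldBody (B : Prog) : Prog :=
  .seq (.call 0 B (.cons (.var 1) (.cons (.hd (.var 2)) (.var 0)))) (.assign 2 (.tl (.var 2)))

/-- The invariant `J` caps the accumulator at `A`, so every call has an argument of size at most 2 +
|env| + N + A, and there are at most as many iterations as nodes in `c`. Without a cap, iterating a
polynomial-time map could make sizes explode. -/
lemma loopRuns_foldBody {B : Prog} {F : Data → PMF Data} {q : Polynomial ℕ}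
    (hq : ∀ (i : ℕ) (e : Expr) (f : Data → Data) (s : ℕ → Data) (m : QMem),
      Runs (.call i B e) (q.eval (e.eval s).size) f s m
        ((F (e.eval s)).map fun y => (Function.update s i y, m)))
    {J : Data → Data → Prop} {env : Data} {A N : ℕ}
    (hstep : ∀ a c acc, J (.cons a c) acc → ∀ y ∈ (F (.cons env (.cons a acc))).support, J c y)
    (hsize : ∀ c acc, J c acc → acc.size ≤ A) (c : Data) :
    ∀ acc, J c acc → c.size ≤ N →
      LoopRuns 2 (foldBody B) (c.size * (2 + (q.eval (2 + env.size + N + A) + (1 + N)))) id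
        (st3 acc env c) QMem.blank ((foldD F env c acc).map fun y => (st3 y env .nil, QMem.blank)) := by
  induction c with
  | nil =>
    intro acc _ _
    simp only [foldD, PMF.pure_map]
    refine (LoopRuns.nil (by simp [st3])).mono ?_
    simp only [Data.size]
    omega
  | cons a c _ ih =>
    intro acc hacc hN
    have hA := hsize _ _ hacc
    have hN' := hN
    simp only [Data.size] at hN'
    have h1 := Runs.of_call hq (f := id) (s := st3 acc env (.cons a c)) (m := QMem.blank) 0
      (.cons (.var 1) (.cons (.hd (.var 2)) (.var 0))) (n := 2 + env.size + N + A)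
      (by simp only [Expr.eval, st3, Data.hd, Data.size]; omega) rfl
    have h2 := Runs.seq h1 (Q := .assign 2 (.tl (.var 2))) (t₂ := 1 + N)
      (D₂ := fun p => PMF.pure (Function.update p.1 2 c, p.2)) (by
        intro p hp
        rw [PMF.support_map] at hp
        obtain ⟨y, _, rfl⟩ := hp
        simp only [update_st3_zero]
        refine (Runs.assign 2 (.tl (.var 2))).mono ?_
        simp only [Expr.eval, st3, Data.tl]
        omega)
    have h3 := LoopRuns.cons (x := 2) (by simp [st3]) h2
      (t₂ := c.size * (2 + (q.eval (2 + env.size + N + A) + (1 + N))))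
      (D₂ := fun p => (foldD F env c (p.1 0)).map fun y => (st3 y env .nil, QMem.blank)) (by
        intro p hp
        rw [PMF.bind_map, PMF.mem_support_bind_iff] at hp
        obtain ⟨y, hy, hp⟩ := hp
        simp only [Function.comp_def, PMF.support_pure, Set.mem_singleton_iff, update_st3_zero,
          update_st3_two] at hp
        subst hp
        exact ih y (hstep _ _ _ hacc _ hy) (by omega))
    convert h3.mono (t' := (Data.cons a c).size *
      (2 + (q.eval (2 + env.size + N + A) + (1 + N)))) ?_ using 1
    · rfl
    · simp only [foldD, PMF.map_bind, PMF.bind_map, PMF.bind_bind, PMF.pure_bind,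
        Function.comp_def, Expr.eval, st3, Data.hd, update_st3_zero, update_st3_two]
    · simp only [Data.size]
      nlinarith

lemma mem_support_foldD {F : Data → PMF Data} {J : Data → Data → Prop} {env : Data}
    (hstep : ∀ a c acc, J (.cons a c) acc → ∀ y ∈ (F (.cons env (.cons a acc))).support, J c y)
    (c : Data) : ∀ acc, J c acc → ∀ y ∈ (foldD F env c acc).support, J .nil y := by
  induction c with
  | nil =>
    intro acc h y hy
    simp only [foldD, PMF.support_pure, Set.mem_singleton_iff] at hy
    exact hy ▸ h
  | cons a c _ ih =>
    intro acc h y hy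
    rw [foldD, PMF.mem_support_bind_iff] at hy
    obtain ⟨z, hz, hy⟩ := hy
    exact ih z (hstep _ _ _ h _ hz) y hy

section

variable {C : Prog → Prop} [ProgClass C] {F : Data → PMF Data} {e c a : Data → Data}

/-- Loops whose accumulator satisfies an invariant `J` that bounds its size. -/
theorem Comp.fold (he : DComp C e) (hc : DComp C c) (ha : DComp C a) (hF : Comp C F)
    {J : Data → Data → Data → Prop} (h0 : ∀ x, J x (c x) (a x))
    (hstep : ∀ x b d acc, J x (.cons b d) acc →
      ∀ y ∈ (F (.cons (e x) (.cons b acc))).support, J x d y)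
    {r : Polynomial ℕ} (hsize : ∀ x d acc, J x d acc → acc.size ≤ r.eval x.size) :
    Comp C fun x => foldD F (e x) (c x) (a x) := by
  obtain ⟨pe, hpe⟩ := he.size_le
  obtain ⟨pc, hpc⟩ := hc.size_le
  obtain ⟨B, hBC, hB⟩ := hF
  obtain ⟨Pe, hPeC, hPe⟩ := he
  obtain ⟨Pc, hPcC, hPc⟩ := hc
  obtain ⟨Pa, hPaC, hPa⟩ := ha
  obtain ⟨q, hq⟩ := hB.call
  obtain ⟨qe, hqe⟩ := hPe.call
  obtain ⟨qc, hqc⟩ := hPc.call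
  obtain ⟨qa, hqa⟩ := hPa.call
  refine ⟨.seq (.call 1 Pe (.var 0)) (.seq (.call 2 Pc (.var 0)) (.seq (.call 0 Pa (.var 0))
    (.loop 2 (foldBody B)))), ProgClass.seq (ProgClass.call hPeC) (ProgClass.seq
      (ProgClass.call hPcC) (ProgClass.seq (ProgClass.call hPaC) (ProgClass.loop
      (ProgClass.seq (ProgClass.call hBC) (ProgClass.assign _ _))))),
    r + (qe + (qc + (qa + pc * (2 + (q.comp (2 + pe + pc + r) + (1 + pc)))))),
    fun x => ⟨fun z hz => ?_, ?_⟩⟩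
  · have := hsize x _ _ (mem_support_foldD (J := J x) (hstep x) (c x) (a x) (h0 x) z hz)
    rw [Polynomial.eval_add]
    omega
  · have h1 := Runs.of_call (F := fun x => PMF.pure (e x)) hqe (f := id) (s := st3 x .nil .nil)
      (m := QMem.blank) 1 (.var 0) (n := x.size) (by simp [Expr.eval, st3]) rfl
    have h2 := Runs.of_call (F := fun x => PMF.pure (c x)) hqc (f := id) (s := st3 x (e x) .nil)
      (m := QMem.blank) 2 (.var 0) (n := x.size) (by simp [Expr.eval, st3]) rfl
    have h3 := Runs.of_call (F := fun x => PMF.pure (a x)) hqa (f := id)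
      (s := st3 x (e x) (c x))
      (m := QMem.blank) 0 (.var 0) (n := x.size) (by simp [Expr.eval, st3]) rfl
    have h4 := (loopRuns_foldBody hq (J := J x) (env := e x) (hstep x) (hsize x) (c x) (a x) (h0 x)
      (hpc x)).runs
    simp only [PMF.pure_map, update_st3_zero, update_st3_one, update_st3_two, Expr.eval,
      st3] at h1 h2 h3
    have h5 := Runs.seq h1 (D₂ := fun _ => _) (by
      intro p hp
      rw [PMF.support_pure, Set.mem_singleton_iff] at hp
      subst hp
      exact Runs.seq h2 (D₂ := fun _ => _) (by
        intro p hp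
        rw [PMF.support_pure, Set.mem_singleton_iff] at hp
        subst hp
        exact Runs.seq h3 (D₂ := fun _ => _) (by
          intro p hp
          rw [PMF.support_pure, Set.mem_singleton_iff] at hp
          subst hp
          exact h4)))
    rw [initSt_eq_st3]
    refine ⟨_, h5.mono ?_, ?_⟩
    · simp only [Polynomial.eval_add, Polynomial.eval_mul, Polynomial.eval_comp,
        Polynomial.eval_one, Polynomial.eval_ofNat]
      have hm := polynomial_eval_mono q (show 2 + (e x).size + pc.eval x.size + r.eval x.size ≤
        2 + pe.eval x.size + pc.eval x.size + r.eval x.size by have := hpe x; omega)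
      have := Nat.mul_le_mul (hpc x) (show 2 + (q.eval (2 + (e x).size + pc.eval x.size +
        r.eval x.size) + (1 + pc.eval x.size)) ≤ 2 + (q.eval (2 + pe.eval x.size +
        pc.eval x.size + r.eval x.size) + (1 + pc.eval x.size)) by simp only at hm; omega)
      omega
    · simp [PMF.map_comp, Function.comp_def, st3]

/-- Loops in which each iteration adds a bounded amount to the size of the accumulator. -/
theorem Comp.fold_add (he : DComp C e) (hc : DComp C c) (ha : DComp C a) (hF : Comp C F)
    {g : Polynomial ℕ} (hg : ∀ env b acc, ∀ y ∈ (F (.cons env (.cons b acc))).support,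
      y.size ≤ acc.size + g.eval (env.size + b.size)) :
    Comp C fun x => foldD F (e x) (c x) (a x) := by
  obtain ⟨pe, hpe⟩ := he.size_le
  obtain ⟨pc, hpc⟩ := hc.size_le
  obtain ⟨pa, hpa⟩ := ha.size_le
  -- The invariant reserves one increment of `g` for each node of the list still to be processed;
  -- accumulator plus reserve never exceed the initial total.
  refine Comp.fold he hc ha hF (J := fun x d acc => d.size ≤ (c x).size ∧
    acc.size + d.size * g.eval ((e x).size + (c x).size) ≤
      (a x).size + (c x).size * g.eval ((e x).size + (c x).size))
    (fun x => ⟨le_rfl, le_rfl⟩) ?_ (r := pa + pc * g.comp (pe + pc)) ?_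
  · rintro x b d acc ⟨h1, h2⟩ y hy
    simp only [Data.size] at h1 h2
    have h3 := hg _ _ _ y hy
    have h4 := polynomial_eval_mono g (show (e x).size + b.size ≤ (e x).size + (c x).size by omega)
    simp only at h4
    refine ⟨by omega, ?_⟩
    nlinarith
  · rintro x d acc ⟨h1, h2⟩
    have h4 := polynomial_eval_mono g (Nat.add_le_add (hpe x) (hpc x))
    have h5 := Nat.mul_le_mul (hpc x) h4
    have h6 := hpa x
    simp only [Polynomial.eval_add, Polynomial.eval_mul, Polynomial.eval_comp] at *
    have h7 : 0 ≤ d.size * g.eval ((e x).size + (c x).size) := Nat.zero_le _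
    omega

end

/-! ### Combinators for efficiently computable functions -/

namespace Data

@[simp] lemma hd_cons (a b : Data) : (cons a b).hd = a := rfl

@[simp] lemma tl_cons (a b : Data) : (cons a b).tl = b := rfl

@[simp] lemma hd_nil : nil.hd = nil := rfl

@[simp] lemma tl_nil : nil.tl = nil := rfl

/-- `a` if `c` is not `nil`, and `b` otherwise. -/
def sel : Data → Data → Data → Data
  | nil, _, b => b
  | cons _ _, a, _ => a

@[simp] lemma sel_nil (a b : Data) : sel nil a b = b := rfl

@[simp] lemma sel_cons (c d a b : Data) : sel (cons c d) a b = a := rfl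

lemma size_hd_add_size_tl (d : Data) : d.hd.size + d.tl.size ≤ d.size + 1 := by
  cases d <;> (simp [size]; try omega)

lemma size_hd_le (d : Data) : d.hd.size ≤ d.size := by
  have := d.size_hd_add_size_tl
  have := d.tl.one_le_size
  omega

lemma size_tl_le (d : Data) : d.tl.size ≤ d.size := by
  have := d.size_hd_add_size_tl
  have := d.hd.one_le_size
  omega

lemma size_num (k : ℕ) : (num k).size = 2 * k + 1 := by
  induction k with
  | zero => rfl
  | succ k ih => simp only [num, size, ih]; omega

end Data

section

variable {C : Prog → Prop} [ProgClass C] {F G : Data → PMF Data} {f g h c e a : Data → Data}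

lemma DComp.id : DComp C fun x => x := by
  simpa [Expr.eval, initSt_zero] using DComp.expr (C := C) (.var 0)

lemma DComp.nil : DComp C fun _ => Data.nil := by
  simpa [Expr.eval] using DComp.expr (C := C) .nil

lemma Comp.comp_left (hF : Comp C F) (hf : DComp C f) : Comp C fun x => F (f x) := by
  simpa using Comp.comp hf hF

lemma DComp.comp (hg : DComp C g) (hf : DComp C f) : DComp C fun x => g (f x) :=
  Comp.comp_left (F := fun x => PMF.pure (g x)) hg hf

lemma Comp.map (hF : Comp C F) (hf : DComp C f) : Comp C fun x => (F x).map f := by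
  simpa [← PMF.bind_pure_comp, Function.comp_def] using Comp.comp hF hf

lemma DComp.hd (hf : DComp C f) : DComp C fun x => (f x).hd :=
  DComp.comp (g := Data.hd)
    (by simpa [Expr.eval, initSt_zero] using DComp.expr (C := C) (.hd (.var 0))) hf

lemma DComp.tl (hf : DComp C f) : DComp C fun x => (f x).tl :=
  DComp.comp (g := Data.tl)
    (by simpa [Expr.eval, initSt_zero] using DComp.expr (C := C) (.tl (.var 0))) hf

/-- `Comp.pairing` keeps the input available to the second stage. -/
lemma Comp.bind {H : Data → Data → PMF Data} (hF : Comp C F)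
    (hH : Comp C fun w => H w.hd w.tl) : Comp C fun x => (F x).bind (H x) := by
  simpa [PMF.bind_map, Function.comp_def, Data.hd_cons, Data.tl_cons] using Comp.comp (Comp.pairing hF) hH

lemma DComp.comp₂ {H : Data → Data → Data} (hH : DComp C fun w => H w.hd w.tl)
    (hf : DComp C f) (hg : DComp C g) : DComp C fun x => H (f x) (g x) := by
  have h1 : Comp C fun x => (PMF.pure (g x)).map (Data.cons x) := Comp.pairing hg
  have h2 : Comp C fun w => (PMF.pure (f w.hd)).map (Data.cons w) :=
    Comp.pairing (DComp.comp hf (DComp.hd DComp.id))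
  have h3 : Comp C fun w => PMF.pure (H w.tl w.hd.tl) := by
    have h4 := DComp.expr (C := C) (.cons (.tl (.var 0)) (.tl (.hd (.var 0))))
    simp only [Expr.eval, initSt_zero] at h4
    simpa using Comp.comp_left hH h4
  simpa [PMF.pure_map, Data.hd_cons, Data.tl_cons, DComp] using Comp.comp (Comp.comp h1 h2) h3

lemma DComp.cons (hf : DComp C f) (hg : DComp C g) : DComp C fun x => .cons (f x) (g x) :=
  DComp.comp₂ (H := Data.cons) (by
    simpa [Expr.eval, initSt_zero] using
      DComp.expr (C := C) (.cons (.hd (.var 0)) (.tl (.var 0)))) hf hg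

lemma DComp.sel (hc : DComp C c) (hf : DComp C f) (hg : DComp C g) :
    DComp C fun x => Data.sel (c x) (f x) (g x) := by
  have h := Comp.sel hc hf hg
  refine (congrArg (Comp C) (funext fun x => ?_)).mp h
  cases hx : c x <;> simp [hx]

lemma DComp.bit (b : Bool) : DComp C fun _ => Data.bit b := by
  cases b
  · exact DComp.nil
  · exact DComp.cons DComp.nil DComp.nil

/-- Deterministic loops along the spine of `c`, with environment `env`. -/
def ffold (H : Data → Data → Data → Data) (env : Data) : Data → Data → Data
  | .nil, acc => acc
  | .cons a c, acc => ffold H env c (H env a acc)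

lemma foldD_pure (H : Data → Data → Data → Data) (env c : Data) : ∀ acc,
    foldD (fun w => PMF.pure (H w.hd w.tl.hd w.tl.tl)) env c acc =
      PMF.pure (ffold H env c acc) := by
  induction c with
  | nil => intro acc; rfl
  | cons a c _ ih => intro acc; simp only [foldD, PMF.pure_bind, ih, ffold, Data.hd_cons, Data.tl_cons]

lemma DComp.ffold {H : Data → Data → Data → Data} (hH : DComp C fun w => H w.hd w.tl.hd w.tl.tl)
    (p : Polynomial ℕ)
    (hp : ∀ env b acc, (H env b acc).size ≤ acc.size + p.eval (env.size + b.size))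
    (he : DComp C e) (hc : DComp C c) (ha : DComp C a) :
    DComp C fun x => ffold H (e x) (c x) (a x) := by
  have h := Comp.fold_add he hc ha hH (g := p) (by
    intro env b acc y hy
    simp only [PMF.support_pure, Set.mem_singleton_iff, Data.hd_cons, Data.tl_cons] at hy
    exact hy ▸ hp env b acc)
  simp only [foldD_pure] at h
  exact h

end

/-! ### Operations on lists -/

namespace Data

/-- Reverse of the first list followed by the second list. -/
def revApp : Data → Data → Data
  | nil, y => y
  | cons a x, y => revApp x (cons a y)

/-- Drop from `y` as many entries as the first list has. -/
def drop : Data → Data → Data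
  | nil, y => y
  | cons _ x, y => drop x y.tl

/-- Pair the entries of the first list with those of the second list. -/
def zip : Data → Data → Data
  | nil, _ => nil
  | cons a x, y => cons (cons a y.hd) (zip x y.tl)

/-- Not `nil` if and only if no entry of the list is `nil`. -/
def all : Data → Data
  | nil => cons nil nil
  | cons a x => sel a (all x) nil

/-- Concatenation. -/
def app : Data → Data → Data
  | nil, y => y
  | cons a x, y => cons a (app x y)

lemma revApp_revApp (x : Data) : ∀ r y, revApp (revApp x r) y = revApp r (app x y) := by
  induction x with
  | nil => intro r y; rfl
  | cons a x _ ih => intro r y; simp only [revApp, ih, app]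

lemma app_nil (x : Data) : app x nil = x := by
  induction x with
  | nil => rfl
  | cons a x _ ih => simp only [app, ih]

lemma revApp_revApp_nil (x : Data) : revApp (revApp x nil) nil = x := by
  rw [revApp_revApp, app_nil, revApp]

/-- Apply `f env` to the entries of a list. -/
def map (f : Data → Data → Data) : Data → Data → Data
  | nil, _ => nil
  | cons a x, env => cons (f env a) (map f x env)

end Data

/-- Apply the random function `F`, with environment `env`, independently to the entries of a
list. -/
def mapD (F : Data → PMF Data) (env : Data) : Data → PMF Data
  | .nil => PMF.pure .nil
  | .cons a x => (F (.cons env a)).bind fun y => (mapD F env x).map (Data.cons y)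

section

variable {C : Prog → Prop} [ProgClass C] {F G : Data → PMF Data} {f g h c e a : Data → Data}

lemma DComp.revApp (hf : DComp C f) (hg : DComp C g) : DComp C fun x => (f x).revApp (g x) := by
  have h := DComp.ffold (C := C) (H := fun _ a acc => .cons a acc) (DComp.cons
    (DComp.hd (DComp.tl DComp.id)) (DComp.tl (DComp.tl DComp.id))) (1 + Polynomial.X)
    (fun env b acc => by simp [Data.size]; omega) DComp.nil hf hg
  refine (congrArg (DComp C) (funext fun x => ?_)).mp h
  generalize g x = y
  induction f x generalizing y with
  | nil => rfl
  | cons a x _ ih => rw [QPuzzle.ffold, ih, Data.revApp]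

lemma DComp.drop (hf : DComp C f) (hg : DComp C g) : DComp C fun x => (f x).drop (g x) := by
  have h := DComp.ffold (C := C) (H := fun _ _ acc => acc.tl)
    (DComp.tl (DComp.tl (DComp.tl DComp.id))) 0
    (fun env b acc => by simpa using acc.size_tl_le) DComp.nil hf hg
  refine (congrArg (DComp C) (funext fun x => ?_)).mp h
  generalize g x = y
  induction f x generalizing y with
  | nil => rfl
  | cons a x _ ih => rw [QPuzzle.ffold, ih, Data.drop]

/-- The accumulator is a pair: the unread part of the second list, and the result so far in reverse
order. -/
lemma DComp.zip (hf : DComp C f) (hg : DComp C g) : DComp C fun x => (f x).zip (g x) := by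
  have h := DComp.revApp (DComp.tl (DComp.ffold (C := C)
    (H := fun _ b acc => .cons acc.hd.tl (.cons (.cons b acc.hd.hd) acc.tl))
    (DComp.cons (DComp.tl (DComp.hd (DComp.tl (DComp.tl DComp.id)))) (DComp.cons (DComp.cons
      (DComp.hd (DComp.tl DComp.id)) (DComp.hd (DComp.hd (DComp.tl (DComp.tl DComp.id)))))
      (DComp.tl (DComp.tl (DComp.tl DComp.id))))) (5 + Polynomial.X)
    (fun env b acc => by
      have h1 := acc.size_hd_add_size_tl
      have h2 := acc.hd.size_hd_add_size_tl
      simp only [Data.size, Polynomial.eval_add, Polynomial.eval_X, Polynomial.eval_ofNat]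
      omega)
    DComp.nil hf (DComp.cons hg DComp.nil))) DComp.nil
  refine (congrArg (DComp C) (funext fun x => ?_)).mp h
  have key : ∀ u y r, (QPuzzle.ffold (fun _ b acc => .cons acc.hd.tl (.cons (.cons b acc.hd.hd)
      acc.tl)) .nil u (.cons y r)).tl = (u.zip y).revApp r := by
    intro u
    induction u with
    | nil => intro y r; rfl
    | cons a u _ ih =>
      intro y r
      rw [QPuzzle.ffold]
      simp only [Data.hd_cons, Data.tl_cons]
      rw [ih, Data.zip, Data.revApp]
  simp only [key, Data.revApp_revApp_nil]

lemma DComp.all (hf : DComp C f) : DComp C fun x => (f x).all := by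
  have h := DComp.ffold (C := C) (H := fun _ b acc => Data.sel b acc .nil)
    (DComp.sel (DComp.hd (DComp.tl DComp.id)) (DComp.tl (DComp.tl DComp.id)) DComp.nil) 1
    (fun env b acc => by cases b <;> simp [Data.sel, Data.size])
    DComp.nil hf (DComp.cons DComp.nil DComp.nil)
  refine (congrArg (DComp C) (funext fun x => ?_)).mp h
  have h0 : ∀ u, QPuzzle.ffold (fun _ b acc => Data.sel b acc .nil) .nil u .nil = .nil := by
    intro u
    induction u with
    | nil => rfl
    | cons a u _ ih => cases a <;> simpa [QPuzzle.ffold, Data.sel] using ih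
  induction f x with
  | nil => rfl
  | cons a x _ ih =>
    cases a with
    | nil => rw [QPuzzle.ffold, Data.sel_nil, h0, Data.all, Data.sel_nil]
    | cons _ _ => rw [QPuzzle.ffold, Data.sel_cons, ih, Data.all, Data.sel_cons]

/-- Samples are pushed onto the front of the accumulator and so appear in reverse; a final `revApp`
restores the order. -/
lemma foldD_map (F : Data → PMF Data) (env x : Data) : ∀ r,
    foldD (fun w => (F (.cons w.hd w.tl.hd)).map fun y => .cons y w.tl.tl) env x r =
      (mapD F env x).map fun z => z.revApp r := by
  induction x with
  | nil => intro r; simp [foldD, mapD, PMF.pure_map, Data.revApp]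
  | cons a x _ ih =>
    intro r
    simp only [foldD, mapD, Data.hd_cons, Data.tl_cons, PMF.bind_map, PMF.map_bind, Function.comp_def, ih,
      PMF.map_comp, Data.revApp]

theorem Comp.mapD (hF : Comp C F) (he : DComp C e) (hc : DComp C c) :
    Comp C fun x => mapD F (e x) (c x) := by
  obtain ⟨p, hp⟩ := hF.size_le
  have h1 : Comp C fun w => (F (.cons w.hd w.tl.hd)).map fun y => .cons y w.tl.tl := by
    have := Comp.map (Comp.pairing (Comp.comp_left hF (DComp.cons (DComp.hd DComp.id)
      (DComp.hd (DComp.tl DComp.id))))) (DComp.cons (DComp.tl DComp.id)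
      (DComp.tl (DComp.tl (DComp.hd DComp.id))))
    simpa only [PMF.map_comp, Function.comp_def, Data.hd_cons, Data.tl_cons] using this
  have h2 := Comp.map (Comp.fold_add he hc DComp.nil h1 (g := 1 + p.comp (1 + Polynomial.X)) (by
    intro env b acc y hy
    simp only [Data.hd_cons, Data.tl_cons, PMF.support_map, Set.mem_image] at hy
    obtain ⟨z, hz, rfl⟩ := hy
    have := hp _ z hz
    simp only [Data.size] at this
    simp only [Data.size, Polynomial.eval_add, Polynomial.eval_comp, Polynomial.eval_X,
      Polynomial.eval_one, ← add_assoc]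
    omega)) (DComp.revApp DComp.id DComp.nil)
  simpa only [foldD_map, PMF.map_comp, Function.comp_def, Data.revApp_revApp_nil, pmf_map_id]
    using h2

lemma mapD_pure (f : Data → Data → Data) (env x : Data) :
    mapD (fun w => PMF.pure (f w.hd w.tl)) env x = PMF.pure (x.map f env) := by
  induction x with
  | nil => rfl
  | cons a x _ ih => simp only [mapD, ih, PMF.pure_bind, PMF.pure_map, Data.hd_cons, Data.tl_cons, Data.map]

lemma DComp.map {H : Data → Data → Data} (hH : DComp C fun w => H w.hd w.tl) (he : DComp C e)
    (hc : DComp C c) : DComp C fun x => (c x).map H (e x) := by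
  have := Comp.mapD hH he hc
  simp only [mapD_pure] at this
  exact this

end

/-! ## Running an algorithm on the segments of the quantum memory -/

lemma Runs.unique {P : Prog} {t t' : ℕ} {f : Data → Data} {s : ℕ → Data} {m : QMem}
    {D D' : PMF ((ℕ → Data) × QMem)} (h : Runs P t f s m D) (h' : Runs P t' f s m D') :
    D = D' := by
  obtain ⟨E, h1, _, h3⟩ := h 0
  obtain ⟨E', h1', _, h3'⟩ := h' 0
  have hE : E.map some = E'.map some := by
    rw [← h1 _ (le_max_left t t'), h1' _ (le_max_right t t')]
  have := congrArg (PMF.map fun o : Option Conf => o.getD ⟨s, m, 0⟩) hE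
  rw [PMF.map_comp, PMF.map_comp] at this
  have hE' : E = E' := (PMF.map_id E).symm.trans (this.trans (PMF.map_id E'))
  rw [← h3, hE', h3']

/-- Every run of at most `t` steps halts. -/
def HaltsFrom (P : Prog) (t : ℕ) (f : Data → Data) (s : ℕ → Data) (m : QMem) : Prop :=
  ∀ r ∈ (exec t P f ⟨s, m, 0⟩).support, ∃ c : Conf, r = some c ∧ c.time ≤ t

lemma Runs.haltsFrom {P : Prog} {t : ℕ} {f : Data → Data} {s : ℕ → Data} {m : QMem}
    {D : PMF ((ℕ → Data) × QMem)} (h : Runs P t f s m D) : HaltsFrom P t f s m := by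
  obtain ⟨E, h1, h2, _⟩ := h 0
  intro r hr
  rw [h1 t le_rfl, PMF.support_map] at hr
  obtain ⟨c, hc, rfl⟩ := hr
  exact ⟨c, rfl, by simpa using h2 c hc⟩

/-- Halting on all nonzero memories is inherited by runs on a segment of a larger memory. -/
lemma QPTWithState.haltsFrom_segment (M : QPTWithState) (r x : Data) {m : QMem} (hm : m ≠ 0) :
    HaltsFrom M.prog (M.bound.eval x.size) (Data.cons r) (initSt x) m := by
  intro o ho
  cases o with
  | none =>
    -- The segment may be entangled with the other qubits, so the halting hypothesis is applied to a
    -- nonzero slice on which the same failure would be possible.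
    obtain ⟨π, ⟨R, hR, rfl⟩, h1, h2⟩ := exec_slice_none (f := Data.cons r)
      (S := {π | ∃ R, ∃ hR : inSeg r R = ∅, π = QMem.slice r R hR})
      (fun ψ hψ => by
        obtain ⟨R, hR, h⟩ := QMem.exists_slice_ne_zero r hψ
        exact ⟨_, ⟨R, hR, rfl⟩, h⟩)
      (by rintro π ⟨R, hR, rfl⟩; exact QMem.isSlice_slice hR) M.prog id ⟨initSt x, m, 0⟩ hm ho
    obtain ⟨c, hc, _⟩ := M.halts x _ h1 _ h2
    cases hc
  | some d =>
    refine ⟨d, rfl, ?_⟩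
    obtain ⟨R, hR, h⟩ := QMem.exists_slice_ne_zero r ((exec_evolves _ _ _ _ ho).mem hm)
    have h1 := exec_slice M.prog (QMem.isSlice_slice hR) id ⟨initSt x, m, 0⟩ d ho h
    have h2 : QMem.slice r R hR m ≠ 0 := fun h0 => h ((exec_evolves _ _ _ _ h1).mem_zero h0)
    obtain ⟨c, hc, ht⟩ := M.halts x _ h2 _ h1
    cases hc
    exact ht

/-- The store with the given values of variables `0` to `3`. -/
def st4 (a b c d : Data) : ℕ → Data
  | 0 => a
  | 1 => b
  | 2 => c
  | 3 => d
  | _ + 4 => .nil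

lemma update_st4_zero (a b c d y : Data) : Function.update (st4 a b c d) 0 y = st4 y b c d := by
  funext i
  rcases i with _ | _ | _ | _ | i <;> simp [st4]

lemma update_st4_one (a b c d y : Data) : Function.update (st4 a b c d) 1 y = st4 a y c d := by
  funext i
  rcases i with _ | _ | _ | _ | i <;> simp [st4]

lemma update_st4_two (a b c d y : Data) : Function.update (st4 a b c d) 2 y = st4 a b y d := by
  funext i
  rcases i with _ | _ | _ | _ | i <;> simp [st4]

lemma update_st4_three (a b c d y : Data) :
    Function.update (st4 a b c d) 3 y = st4 a b c y := by
  funext i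
  rcases i with _ | _ | _ | _ | i <;> simp [st4]

lemma initSt_eq_st4 (x : Data) : initSt x = st4 x .nil .nil .nil := by
  funext i
  rcases i with _ | _ | _ | _ | i <;> simp [initSt, st4]

/-- The body of a loop that runs `B` on segment `1` with the first entry of list `0`, and collects
the outputs in list `2`. -/
def segBody (B : Prog) : Prog :=
  .seq (.callOn 3 (.var 1) B (.hd (.var 0))) (.seq (.assign 2 (.cons (.var 3) (.var 2)))
    (.seq (.assign 1 (.cons .nil (.var 1))) (.assign 0 (.tl (.var 0)))))

section

variable {A : Set QMem} (M : Alg A)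

/-- Final store and memory of `M` with input `x`, run on segment `i`. -/
def segFinal (i : ℕ) (x : Data) (m : QMem) : PMF ((ℕ → Data) × QMem) :=
  finalState (M.bound.eval x.size) M.prog (Data.cons (.num i)) (initSt x) m

/-- Run `M` on segments `i`, `i + 1`, … with the inputs from a list, and collect the outputs. -/
def segLoop : Data → ℕ → Data → QMem → PMF (Data × QMem)
  | .nil, _, res, m => PMF.pure (res, m)
  | .cons x xs, i, res, m =>
    (segFinal M i x m).bind fun d => segLoop xs (i + 1) (.cons (d.1 0) res) d.2

variable {M}

/-- The predicate `K i` on memories is what is known before segment `i` is treated; it is left open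
because the obligation algorithm maintains product states, whereas the solver only maintains
nonvanishing. The hypothesis on `R` reserves 1 + N + β for each output still to come, and `y` is
whatever the previous round left in variable `3`. -/
lemma loopRuns_segBody {K : ℕ → QMem → Prop}
    (hK : ∀ i x m, K i m →
      HaltsFrom M.prog (M.bound.eval x.size) (Data.cons (.num i)) (initSt x) m ∧
        ∀ d ∈ (segFinal M i x m).support, K (i + 1) d.2) {N R β : ℕ}
    (hβ : M.bound.eval N ≤ β) (xs : Data) :
    ∀ i res y m, K i m → xs.size + i ≤ N → res.size + xs.size * (1 + N + β) ≤ R →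
      ∃ D, LoopRuns 0 (segBody M.prog) (xs.size * (20 + 6 * N + 3 * β + R)) id
          (st4 xs (.num i) res y) m D ∧
        (D.map fun p => (p.1 2, p.2)) = segLoop M xs i res m ∧
        ∀ p ∈ D.support, (p.1 2).size ≤ R := by
  induction xs with
  | nil =>
    intro i res y m _ hN hR
    refine ⟨_, (LoopRuns.nil (by simp [st4])).mono ?_, ?_, ?_⟩
    · simp only [Data.size]
      omega
    · simp [PMF.pure_map, segLoop, st4]
    · simp only [Data.size] at hR
      simp [st4]
      omega
  | cons x xs _ ih =>
    intro i res y m hm hN hR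
    obtain ⟨hhalt, hnext⟩ := hK i x m hm
    have hx : x.size ≤ N := by simp only [Data.size] at hN; omega
    have hb : M.bound.eval x.size ≤ β := (polynomial_eval_mono M.bound hx).trans hβ
    have hsz : ∀ d ∈ (segFinal M i x m).support, (d.1 0).size ≤ N + β := fun d hd => by
      have := (mem_support_finalState hhalt hd).2 _ (size_initSt x) 0
      omega
    simp only [Data.size] at hN hR
    have hR' : res.size + (1 + N + β) + xs.size * (1 + N + β) ≤ R := by nlinarith
    have hR'' : res.size + 1 + N + β ≤ R := by omega
    have h1 := (Runs.callOn (x := 3) (r := .var 1) (e := .hd (.var 0)) (f := id)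
      (s := st4 (.cons x xs) (.num i) res y) (m := m) (runs_finalState hhalt) hsz).mono
      (t' := 3 + 4 * N + 2 * β) (by
        simp only [Expr.eval, st4, Data.hd_cons, Data.size_num]
        omega)
    have h2 : ∀ p ∈ ((segFinal M i x m).map fun d =>
        (Function.update (st4 (.cons x xs) (.num i) res y) 3 (d.1 0), d.2)).support,
        Runs (.seq (.assign 2 (.cons (.var 3) (.var 2))) (.seq (.assign 1 (.cons .nil (.var 1)))
          (.assign 0 (.tl (.var 0))))) (12 + 2 * N + R + β) id p.1 p.2
          (PMF.pure (st4 xs (.num (i + 1)) (.cons (p.1 3) res) (p.1 3), p.2)) := by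
      intro p hp
      rw [PMF.support_map] at hp
      obtain ⟨d, hd, rfl⟩ := hp
      have hd' := hsz d hd
      simp only [update_st4_three, st4]
      have e1 := Runs.assign (f := id) (s := st4 (.cons x xs) (.num i) res (d.1 0)) (m := d.2) 2
        (.cons (.var 3) (.var 2))
      have e2 := Runs.assign (f := id)
        (s := st4 (.cons x xs) (.num i) (.cons (d.1 0) res) (d.1 0)) (m := d.2) 1
        (.cons .nil (.var 1))
      have e3 := Runs.assign (f := id)
        (s := st4 (.cons x xs) (.cons .nil (.num i)) (.cons (d.1 0) res) (d.1 0)) (m := d.2) 0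
        (.tl (.var 0))
      simp only [Expr.eval, st4, update_st4_zero, update_st4_one, update_st4_two, Data.tl_cons]
        at e1 e2 e3
      have e4 := Runs.seq e1 (D₂ := fun _ => _) (by
        intro p hp
        rw [PMF.support_pure, Set.mem_singleton_iff] at hp
        subst hp
        exact Runs.seq e2 (D₂ := fun _ => _) (by
          intro p hp
          rw [PMF.support_pure, Set.mem_singleton_iff] at hp
          subst hp
          exact e3))
      rw [PMF.pure_bind, PMF.pure_bind] at e4
      refine e4.mono ?_
      simp only [Data.size, Data.size_num]
      omega
    have h3 := Runs.seq h1 h2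
    have h4 : ∀ d, ∃ D, d ∈ (segFinal M i x m).support →
        LoopRuns 0 (segBody M.prog) (xs.size * (20 + 6 * N + 3 * β + R)) id
          (st4 xs (.num (i + 1)) (.cons (d.1 0) res) (d.1 0)) d.2 D ∧
        (D.map fun p => (p.1 2, p.2)) = segLoop M xs (i + 1) (.cons (d.1 0) res) d.2 ∧
        ∀ p ∈ D.support, (p.1 2).size ≤ R := by
      intro d
      by_cases hd : d ∈ (segFinal M i x m).support
      · obtain ⟨D, hD⟩ := ih (i + 1) (.cons (d.1 0) res) (d.1 0) d.2 (hnext d hd) (by omega) (by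
          have := hsz d hd
          simp only [Data.size]
          omega)
        exact ⟨D, fun _ => hD⟩
      · exact ⟨PMF.pure d, fun h => absurd h hd⟩
    choose D hD using h4
    have h5 : (((segFinal M i x m).map fun d =>
        (Function.update (st4 (.cons x xs) (.num i) res y) 3 (d.1 0), d.2)).bind fun p =>
          PMF.pure (st4 xs (.num (i + 1)) (.cons (p.1 3) res) (p.1 3), p.2)) =
        (segFinal M i x m).map fun d =>
          (st4 xs (.num (i + 1)) (.cons (d.1 0) res) (d.1 0), d.2) := by
      rw [PMF.bind_map, ← PMF.bind_pure_comp]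
      simp [Function.comp_def]
    have h3' : Runs (segBody M.prog) (3 + 4 * N + 2 * β + (12 + 2 * N + R + β)) id
        (st4 (.cons x xs) (.num i) res y) m ((segFinal M i x m).map fun d =>
          (st4 xs (.num (i + 1)) (.cons (d.1 0) res) (d.1 0), d.2)) := h5 ▸ h3
    clear h1 h2 h3 h5
    -- `LoopRuns.cons` wants the law of the remaining loop as a function of the reached store and
    -- memory, not of the final state `d` of the subroutine, so it is chosen anew.
    have h6 : ∀ p ∈ ((segFinal M i x m).map fun d =>
          (st4 xs (.num (i + 1)) (.cons (d.1 0) res) (d.1 0), d.2)).support,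
        ∃ E, LoopRuns 0 (segBody M.prog) (xs.size * (20 + 6 * N + 3 * β + R)) id p.1 p.2 E ∧
        (E.map fun p => (p.1 2, p.2)) = segLoop M xs (i + 1) (p.1 2) p.2 ∧
        ∀ p ∈ E.support, (p.1 2).size ≤ R := by
      intro p hp
      rw [PMF.support_map] at hp
      obtain ⟨d, hd, rfl⟩ := hp
      exact ⟨D d, hD d hd⟩
    choose! E hE using h6
    refine ⟨_, (LoopRuns.cons (by simp [st4]) h3' fun p hp => (hE p hp).1).mono ?_, ?_, ?_⟩
    · simp only [Data.size]
      nlinarith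
    · rw [segLoop, PMF.bind_map, PMF.map_bind]
      refine bind_congr_support fun d hd => ?_
      exact (hE _ (by rw [PMF.support_map]; exact ⟨d, hd, rfl⟩)).2.1
    · intro p hp
      rw [PMF.mem_support_bind_iff] at hp
      obtain ⟨p', hp', hp⟩ := hp
      exact (hE p' hp').2.2 p hp

/-- An algorithm that runs `M` on consecutive segments of its memory. -/
theorem exists_segLoop_alg {pre : Data → Data} (hpre : DComp AnyProg pre) {B : Set QMem}
    {K : ℕ → QMem → Prop} (hK0 : ∀ ψ ∈ B, K 0 ψ)
    (hK : ∀ i x m, K i m →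
      HaltsFrom M.prog (M.bound.eval x.size) (Data.cons (.num i)) (initSt x) m ∧
        ∀ d ∈ (segFinal M i x m).support, K (i + 1) d.2) :
    ∃ W : Alg B, ∀ x, ∀ ψ ∈ B, W.run x ψ =
      (segLoop M (pre x) 0 .nil ψ).map fun p => (p.1.revApp .nil, p.2) := by
  obtain ⟨p, hp⟩ := hpre.size_le
  obtain ⟨P, -, hP⟩ := hpre
  obtain ⟨q, hq⟩ := hP.call
  obtain ⟨Q, -, hQ⟩ : DComp AnyProg fun x => x.revApp .nil := DComp.revApp DComp.id DComp.nil
  obtain ⟨q', hq'⟩ := hQ.call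
  set β : Polynomial ℕ := M.bound.comp p with hβ
  set R : Polynomial ℕ := 1 + p * (1 + p + β) with hR
  have key : ∀ x, ∀ ψ ∈ B, ∃ D, Runs (.seq (.call 0 P (.var 0)) (.seq (.loop 0 (segBody M.prog))
      (.call 0 Q (.var 2)))) ((q + (p * (20 + 6 * p + 3 * β + R) + q'.comp R)).eval x.size) id
      (initSt x) ψ D ∧ (D.map fun d => (d.1 0, d.2)) =
        (segLoop M (pre x) 0 .nil ψ).map fun p => (p.1.revApp .nil, p.2) := by
    intro x ψ hψ
    obtain ⟨D, h1, h2, h3⟩ := loopRuns_segBody hK (N := p.eval x.size) (β := β.eval x.size)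
      (R := R.eval x.size) (by simp [hβ]) (pre x) 0 .nil .nil ψ (hK0 ψ hψ) (hp x) (by
        have := Nat.mul_le_mul_right (1 + p.eval x.size + β.eval x.size) (hp x)
        simp only [hR, Data.size, Polynomial.eval_add, Polynomial.eval_mul, Polynomial.eval_one]
        omega)
    have e1 := Runs.of_call (F := fun x => PMF.pure (pre x)) hq (f := id)
      (s := st4 x .nil .nil .nil) (m := ψ) 0 (.var 0) (n := x.size) (by simp [Expr.eval, st4]) rfl
    simp only [PMF.pure_map, update_st4_zero, Expr.eval, st4] at e1
    have e2 := Runs.seq h1.runs (Q := .call 0 Q (.var 2)) (t₂ := q'.eval (R.eval x.size))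
      (D₂ := fun p => PMF.pure (Function.update p.1 0 ((p.1 2).revApp .nil), p.2)) (by
        intro p hp
        exact Runs.of_call (F := fun x => PMF.pure (x.revApp .nil)) hq' 0 (.var 2)
          (h3 p hp) (by simp [PMF.pure_map, Expr.eval]))
    have e3 := Runs.seq e1 (D₂ := fun _ => _) (by
      intro p hp
      rw [PMF.support_pure, Set.mem_singleton_iff] at hp
      subst hp
      exact e2)
    rw [initSt_eq_st4]
    refine ⟨_, e3.mono ?_, ?_⟩
    · simp only [Polynomial.eval_add, Polynomial.eval_mul, Polynomial.eval_comp,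
        Polynomial.eval_ofNat]
      have := Nat.mul_le_mul_right
        (20 + 6 * p.eval x.size + 3 * β.eval x.size + R.eval x.size) (hp x)
      omega
    · rw [PMF.pure_bind, PMF.map_bind, ← h2, PMF.map_comp, ← PMF.bind_pure_comp]
      simp [PMF.pure_map, Function.comp_def]
  obtain ⟨W, hW⟩ := exists_alg (A := B) fun x ψ hψ =>
    let ⟨D, hD, _⟩ := key x ψ hψ
    ⟨D, hD⟩
  refine ⟨W, fun x ψ hψ => ?_⟩
  obtain ⟨D, hD, hD'⟩ := key x ψ hψ
  rw [W.run_eq_of_runs x hψ (hW ▸ hD), hD']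

lemma segFinal_tensor {pre rest : List QMem} {ψ : QMem} (hψ : ψ ∈ A)
    (hpre : ∀ φ ∈ pre, φ ≠ 0) (hrest : ∀ φ ∈ rest, φ ≠ 0) (x : Data) :
    Runs M.prog (M.bound.eval x.size) (Data.cons (.num pre.length)) (initSt x)
        (QMem.tensor (pre ++ ψ :: rest)) (segFinal M pre.length x (QMem.tensor (pre ++ ψ :: rest))) ∧
      (segFinal M pre.length x (QMem.tensor (pre ++ ψ :: rest))).map (fun d => (d.1 0, d.2)) =
        (M.run x ψ).map fun y => (y.1, QMem.tensor (pre ++ y.2 :: rest)) := by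
  have h : Runs M.prog (M.bound.eval x.size) (Data.cons (.num pre.length)) (initSt x)
      (QMem.tensor (pre ++ ψ :: rest)) _ :=
    (M.runs x hψ).push (QMem.intertwines_tensor hpre hrest)
  have h' := runs_finalState h.haltsFrom
  refine ⟨h', ?_⟩
  rw [segFinal, h'.unique h, M.run_eq x hψ, PMF.map_comp, PMF.map_comp]
  rfl

/-- Each round moves one factor from `ψs` to the processed list `pre`. The new factor is again
nonzero, so the next factor is still embedded by an intertwiner and its run is not influenced by the
others. -/
lemma segLoop_tensor (hA : ∀ ψ ∈ A, ψ ≠ 0) (xs : List Data) :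
    ∀ (ψs pre : List QMem) (res : Data), xs.length = ψs.length → (∀ ψ ∈ ψs, ψ ∈ A) →
      (∀ φ ∈ pre, φ ≠ 0) →
      segLoop M (.list xs) pre.length res (QMem.tensor (pre ++ ψs)) =
        (independent (List.zipWith M.run xs ψs)).map fun l =>
          ((Data.list (l.map Prod.fst)).revApp res, QMem.tensor (pre ++ l.map Prod.snd)) := by
  induction xs with
  | nil =>
    intro ψs pre res hl _ _
    obtain rfl : ψs = [] := List.length_eq_zero_iff.1 hl.symm
    simp [Data.list, segLoop, independent, PMF.pure_map, Data.revApp]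
  | cons x xs ih =>
    intro ψs pre res hl hψs hpre
    obtain _ | ⟨ψ, ψs⟩ := ψs
    · simp at hl
    have hrest : ∀ φ ∈ ψs, φ ≠ 0 := fun φ hφ => hA φ (hψs φ (List.mem_cons_of_mem _ hφ))
    obtain ⟨-, h⟩ := segFinal_tensor (M := M) (hψs ψ List.mem_cons_self) hpre hrest x
    have h1 : ∀ g : Data × QMem → PMF (Data × QMem),
        ((segFinal M pre.length x (QMem.tensor (pre ++ ψ :: ψs))).bind fun d => g (d.1 0, d.2)) =
          (M.run x ψ).bind fun y => g (y.1, QMem.tensor (pre ++ y.2 :: ψs)) := by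
      intro g
      have := congrArg (fun m => PMF.bind m g) h
      simpa only [PMF.bind_map, Function.comp_def] using this
    rw [Data.list, segLoop,
      h1 fun z => segLoop M (.list xs) (pre.length + 1) (.cons z.1 res) z.2,
      List.zipWith_cons_cons, independent, PMF.map_bind]
    refine bind_congr_support fun y hy => ?_
    have hy0 : y.2 ≠ 0 := M.mem_ne_zero x (hψs ψ List.mem_cons_self)
      (hA ψ (hψs ψ List.mem_cons_self)) hy
    have h2 := ih ψs (pre ++ [y.2]) (.cons y.1 res) (by simpa using hl)
      (fun φ hφ => hψs φ (List.mem_cons_of_mem _ hφ)) (fun φ hφ => by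
        rw [List.mem_append, List.mem_singleton] at hφ
        rcases hφ with hφ | rfl
        · exact hpre φ hφ
        · exact hy0)
    simp only [List.length_append, List.length_singleton, List.append_assoc,
      List.singleton_append] at h2
    rw [h2, PMF.map_comp]
    rfl

end

/-! ## Lists as data -/

namespace Data

/-- Number of entries of a list. -/
def len : Data → ℕ
  | nil => 0
  | cons _ x => x.len + 1

lemma len_list (l : List Data) : (list l).len = l.length := by
  induction l with
  | nil => rfl
  | cons a l ih => simp only [list, len, ih, List.length_cons]

lemma len_num (k : ℕ) : (num k).len = k := by
  induction k with
  | zero => rfl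
  | succ k ih => simp only [num, len, ih]

lemma exists_eq_ofFn (d : Data) : ∀ {n : ℕ}, d.len = n →
    ∃ p : Fin n → Data, d = list (List.ofFn p) := by
  induction d with
  | nil => rintro _ rfl; exact ⟨Fin.elim0, rfl⟩
  | cons a x _ ih =>
    rintro (_ | n) h
    · simp [len] at h
    obtain ⟨p, hp⟩ := ih (n := n) (by simpa [len] using h)
    exact ⟨Fin.cons a p, by rw [List.ofFn_cons, list, ← hp]⟩

lemma map_list (f : Data → Data → Data) (env : Data) (l : List Data) :
    (list l).map f env = list (l.map (f env)) := by
  induction l with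
  | nil => rfl
  | cons a l ih => simp only [list, map, ih, List.map_cons]

lemma zip_ofFn : ∀ {n : ℕ} (p q : Fin n → Data),
    (list (List.ofFn p)).zip (list (List.ofFn q)) = list (List.ofFn fun i => cons (p i) (q i)) := by
  intro n
  induction n with
  | zero => intros; rfl
  | succ n ih => intro p q; simp only [List.ofFn_succ, list, zip, hd_cons, tl_cons, ih]

lemma all_list_ne_nil (l : List Data) : (list l).all ≠ nil ↔ ∀ a ∈ l, a ≠ nil := by
  induction l with
  | nil => simp [list, all]
  | cons a l ih => cases a <;> simp [list, all, ih]

lemma drop_eq_nil (x : Data) : ∀ y, x.drop y = nil ↔ y.len ≤ x.len := by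
  induction x with
  | nil => intro y; cases y <;> simp [drop, len]
  | cons a x _ ih => intro y; cases y <;> simp [drop, len, ih]

/-- Not `nil` if and only if two lists have the same length. -/
def lenEq (x y : Data) : Data := sel (x.drop y) nil (sel (y.drop x) nil (cons nil nil))

lemma lenEq_ne_nil (x y : Data) : x.lenEq y ≠ nil ↔ x.len = y.len := by
  have h1 := drop_eq_nil x y
  have h2 := drop_eq_nil y x
  unfold lenEq
  cases h : x.drop y with
  | nil =>
    have h1' := h1.1 h
    cases h' : y.drop x with
    | nil => have h2' := h2.1 h'; simp only [sel_nil]; simp; omega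
    | cons _ _ =>
      have h2' : ¬ x.len ≤ y.len := fun hh => by simp [h2.2 hh] at h'
      simp; omega
  | cons _ _ =>
    have h1' : ¬ y.len ≤ x.len := fun hh => by simp [h1.2 hh] at h
    simp; omega

lemma sel_ne_nil (c a : Data) : sel c a nil ≠ nil ↔ c ≠ nil ∧ a ≠ nil := by
  cases c <;> simp

end Data

lemma DComp.lenEq {C : Prog → Prop} [ProgClass C] {f g : Data → Data} (hf : DComp C f)
    (hg : DComp C g) : DComp C fun x => (f x).lenEq (g x) :=
  DComp.sel (DComp.drop hf hg) DComp.nil (DComp.sel (DComp.drop hg hf) DComp.nil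
    (DComp.cons DComp.nil DComp.nil))

/-! ## Independent samples -/

lemma independent_map {α β : Type} (f : α → β) (l : List (PMF α)) :
    independent (l.map (PMF.map f)) = (independent l).map (List.map f) := by
  induction l with
  | nil => simp [independent, PMF.pure_map]
  | cons m l ih =>
    simp only [List.map_cons, independent, ih, PMF.bind_map, PMF.map_bind, PMF.map_comp,
      Function.comp_def]

lemma mapD_list (F : Data → PMF Data) (env : Data) (l : List Data) :
    mapD F env (.list l) = (independent (l.map fun a => F (.cons env a))).map Data.list := by
  induction l with
  | nil => simp [independent, PMF.pure_map, Data.list, mapD]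
  | cons a l ih =>
    simp only [List.map_cons, independent, Data.list, mapD, ih, PMF.map_bind, PMF.map_comp,
      Function.comp_def]

lemma num_eq_list (k : ℕ) : Data.num k = .list (List.replicate k .nil) := by
  induction k with
  | zero => rfl
  | succ k ih => rw [Data.num, ih, List.replicate_succ, Data.list]

/-! ## Deterministic algorithms -/

lemma QPT.exists_eq_pure {M : QPT} (h : M.prog.IsDeterministic) :
    ∃ f : Data → Data, (∀ x, M.out x QMem.blank = PMF.pure (f x)) ∧
      DComp Prog.IsDeterministic f := by
  have key : ∀ x, ∃ y, M.out x QMem.blank = PMF.pure y := by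
    intro x
    obtain ⟨r, hr⟩ := h.exec_eq_pure (k := M.bound.eval x.size) id (Conf.init x QMem.blank 0)
    exact ⟨_, by rw [Alg.out, Alg.run, hr, PMF.pure_map, PMF.pure_map]⟩
  choose f hf using key
  refine ⟨f, hf, ?_⟩
  have := Comp.of_alg M h
  simp only [hf] at this
  exact this

lemma Prog.IsDeterministic.isClassical {P : Prog} (h : P.IsDeterministic) : P.IsClassical := by
  induction P with
  | skip => trivial
  | assign x e => trivial
  | seq P Q ihP ihQ => exact ⟨ihP h.1, ihQ h.2⟩
  | cond x P Q ihP ihQ => exact ⟨ihP h.1, ihQ h.2⟩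
  | loop x P ih => exact ih h
  | flip x => exact absurd h id
  | gateH e => exact absurd h id
  | gateT e => exact absurd h id
  | gateCNOT e e' => exact absurd h id
  | measure x e => exact absurd h id
  | call x P e ih => exact ih h
  | callOn x r P e ih => exact ih h

lemma DComp.toClassical {f : Data → Data} (h : DComp Prog.IsDeterministic f) :
    DComp Prog.IsClassical f := Comp.mono (fun _ => Prog.IsDeterministic.isClassical) h

lemma DComp.toAny {f : Data → Data} (h : DComp Prog.IsDeterministic f) :
    DComp AnyProg f := Comp.mono (fun _ _ => trivial) h

lemma EfficientlyComputable.exists_dcomp {n : ℕ → ℕ} (h : EfficientlyComputable n) :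
    ∃ f : Data → Data, DComp Prog.IsDeterministic f ∧ ∀ k, f (.num k) = .num (n k) := by
  obtain ⟨P, hP, hn⟩ := h
  obtain ⟨f, hf, hf'⟩ := QPT.exists_eq_pure hP
  refine ⟨f, hf', fun k => ?_⟩
  have := (hf (.num k)).symm.trans (hn k)
  have h2 := congrArg PMF.support this
  simpa using h2

lemma Puzzle.accepts_iff {Z : Puzzle} {vf : Data → Data}
    (hvf : ∀ x, Z.V.out x QMem.blank = PMF.pure (vf x)) (k : ℕ) (p v o : Data) (b : Bool)
    (a : Data) : Z.Accepts k p v o b a ↔ vf (.list [.num k, p, v, o, .bit b, a]) ≠ .nil := by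
  unfold Puzzle.Accepts
  rw [hvf]
  constructor
  · rintro ⟨d, hd, h⟩
    have h2 := congrArg PMF.support h
    simp only [PMF.support_pure, Set.singleton_eq_singleton_iff] at h2
    rwa [h2]
  · exact fun h => ⟨_, h, rfl⟩

/-! ## The algorithms of the repetition -/

section

variable (Z : Puzzle) {n : ℕ → ℕ}

/-- The unary number n(k) is read as a list of n(k) empty entries, over which the generator is
mapped. -/
lemma exists_repetition_gen (hn : EfficientlyComputable n) : ∃ G : QPT, G.prog.IsClassical ∧ ∀ k,
    G.out (.num k) QMem.blank =
      (independent (List.replicate (n k) (Z.gen k))).map fun l =>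
        Data.cons (.list (l.map Prod.fst)) (.list (l.map Prod.snd)) := by
  obtain ⟨nf, hnf, hnk⟩ := hn.exists_dcomp
  have h1 : Comp Prog.IsClassical fun w => Z.G.out w.hd QMem.blank :=
    Comp.comp_left (Comp.of_alg Z.G Z.G_classical) (DComp.hd DComp.id)
  have h2 := Comp.mapD h1 DComp.id hnf.toClassical
  have h3 := Comp.map h2 (f := fun x => .cons (x.map (fun _ a => a.hd) .nil)
    (x.map (fun _ a => a.tl) .nil)) (DComp.cons
      (DComp.map (DComp.hd (DComp.tl DComp.id)) DComp.nil DComp.id)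
      (DComp.map (DComp.tl (DComp.tl DComp.id)) DComp.nil DComp.id))
  obtain ⟨G, hG, hG'⟩ := h3.exists_alg
  refine ⟨G, hG, fun k => ?_⟩
  rw [hG', hnk, num_eq_list (n k), mapD_list, PMF.map_comp, List.map_replicate, Data.hd_cons,
    Puzzle.gen, ← List.map_replicate (f := PMF.map _), independent_map, PMF.map_comp]
  congr 1
  funext l
  simp only [Function.comp, Data.map_list, List.map_map]
  rfl

lemma exists_repetition_obligation : ∃ O : QPT, ∀ (k : ℕ) (p : List Data),
    O.run (.list [.num k, .list p]) QMem.blank =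
      (independent (p.map (Z.obligation k))).map fun l =>
        (Data.list (l.map Prod.fst), QMem.tensor (l.map Prod.snd)) := by
  have hblank : ∀ pre, QMem.tensor (pre ++ [QMem.blank]) = QMem.tensor pre := fun pre =>
    QMem.tensorFrom_append_blank pre 0
  have hpre : DComp AnyProg fun x =>
      x.tl.hd.map (fun env a => .cons env (.cons a .nil)) x.hd :=
    DComp.map (DComp.cons (DComp.hd DComp.id) (DComp.cons (DComp.tl DComp.id) DComp.nil))
      (DComp.hd DComp.id) (DComp.hd (DComp.tl DComp.id))
  obtain ⟨W, hW⟩ := exists_segLoop_alg (M := Z.O) hpre (B := {QMem.blank})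
    -- The first `i` segments carry a product state and all other qubits are blank; by `hblank` the
    -- next segment is a blank factor that may be adjoined freely.
    (K := fun i m => ∃ pre : List QMem, pre.length = i ∧ (∀ φ ∈ pre, φ ≠ 0) ∧
      m = QMem.tensor pre)
    (by rintro ψ rfl; exact ⟨[], rfl, by simp, rfl⟩) (by
      rintro i x m ⟨pre, rfl, hpre, rfl⟩
      obtain ⟨h1, h2⟩ := segFinal_tensor (M := Z.O) (rest := []) (ψ := QMem.blank) rfl hpre
        (by simp) x
      rw [hblank] at h1 h2
      refine ⟨h1.haltsFrom, fun d hd => ?_⟩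
      have h3 : (d.1 0, d.2) ∈ ((Z.O.run x QMem.blank).map fun y =>
          (y.1, QMem.tensor (pre ++ [y.2]))).support := by
        rw [← h2, PMF.support_map]
        exact ⟨d, hd, rfl⟩
      rw [PMF.support_map] at h3
      obtain ⟨y, hy, h3⟩ := h3
      refine ⟨pre ++ [y.2], by simp, fun φ hφ => ?_, (congrArg Prod.snd h3).symm⟩
      rw [List.mem_append, List.mem_singleton] at hφ
      rcases hφ with hφ | rfl
      · exact hpre φ hφ
      · exact Z.O.mem_ne_zero x rfl QMem.blank_ne_zero hy)
  refine ⟨W, fun k p => ?_⟩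
  have hrep : ∀ m, QMem.tensor (List.replicate m QMem.blank) = QMem.blank := by
    intro m
    induction m with
    | zero => rfl
    | succ m ih => rw [List.replicate_succ', hblank, ih]
  have h := segLoop_tensor (M := Z.O) (by rintro ψ rfl; exact QMem.blank_ne_zero)
    (p.map fun a => .list [.num k, a]) (List.replicate p.length QMem.blank) [] .nil (by simp)
    (fun ψ hψ => List.eq_of_mem_replicate hψ) (by simp)
  rw [List.nil_append, hrep] at h
  rw [hW _ _ rfl]
  simp only [Data.list, Data.tl_cons, Data.hd_cons, Data.map_list] at h ⊢
  rw [List.length_nil] at h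
  rw [h, PMF.map_comp]
  have hz : ∀ q : List Data, List.zipWith Z.O.run
      (q.map fun a => (Data.num k).cons (a.cons Data.nil))
      (List.replicate q.length QMem.blank) = q.map (Z.obligation k) := by
    intro q
    induction q with
    | nil => rfl
    | cons a q ih =>
      rw [List.map_cons, List.length_cons, List.replicate_succ, List.zipWith_cons_cons, ih,
        List.map_cons]
      rfl
  rw [hz]
  congr 1
  funext l
  simp only [Function.comp, Data.revApp_revApp_nil, List.nil_append]

/-- The law is needed on product states only, but halting is needed for every input and every
nonzero memory, hence the mere nonvanishing as invariant and `haltsFrom_segment`. -/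
lemma exists_repetition_answer : ∃ S : QPTWithState, ∀ (k m : ℕ) (p o : Fin m → Data)
    (ψ : Fin m → QMem) (b : Bool), (∀ i, ψ i ≠ 0) →
    S.out (.list [.num k, .list (List.ofFn p), .list (List.ofFn o), .bit b])
        (QMem.tensor (List.ofFn ψ)) =
      (independent (List.ofFn fun i => Z.answer k (p i) (o i) (ψ i) b)).map Data.list := by
  have hpre : DComp AnyProg fun x => (x.tl.hd.zip x.tl.tl.hd).map
      (fun env a => .list [env.hd, a.hd, a.tl, env.tl]) (.cons x.hd x.tl.tl.tl.hd) := by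
    refine DComp.map ?_ ?_ ?_
    · simp only [Data.list]
      repeat' first
        | exact DComp.id | exact DComp.nil | apply DComp.hd | apply DComp.tl | apply DComp.cons
    · repeat' first
        | exact DComp.id | exact DComp.nil | apply DComp.hd | apply DComp.tl | apply DComp.cons
    · apply DComp.zip <;> repeat' first
        | exact DComp.id | apply DComp.hd | apply DComp.tl
  obtain ⟨W, hW⟩ := exists_segLoop_alg (M := Z.S) hpre (B := {ψ | ψ ≠ 0})
    (K := fun _ m => m ≠ 0) (fun ψ hψ => hψ) (fun i x m hm =>
      have h := QPTWithState.haltsFrom_segment Z.S (.num i) x hm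
      ⟨h, fun d hd => (mem_support_finalState h hd).1 hm⟩)
  refine ⟨W, fun k m p o ψ b hψ => ?_⟩
  have hψ' : ∀ φ ∈ List.ofFn ψ, φ ≠ 0 := by
    intro φ hφ
    rw [List.mem_ofFn] at hφ
    obtain ⟨i, rfl⟩ := hφ
    exact hψ i
  have h := segLoop_tensor (M := Z.S) (fun ψ hψ => hψ)
    (List.ofFn fun i => .list [.num k, p i, o i, .bit b]) (List.ofFn ψ) [] .nil (by simp)
    hψ' (by simp)
  rw [List.nil_append, List.length_nil] at h
  rw [Alg.out, hW _ (QMem.tensor (List.ofFn ψ)) (QMem.tensorFrom_ne_zero _ 0 hψ')]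
  simp only [Data.list, Data.tl_cons, Data.hd_cons, Data.zip_ofFn, Data.map_list,
    List.map_ofFn] at h ⊢
  have hz : List.zipWith Z.S.run (List.ofFn fun i => (Data.num k).cons ((p i).cons
      ((o i).cons ((Data.bit b).cons Data.nil)))) (List.ofFn ψ) =
      List.ofFn fun i => Z.S.run ((Data.num k).cons ((p i).cons
      ((o i).cons ((Data.bit b).cons Data.nil)))) (ψ i) := by
    apply List.ext_getElem <;> simp
  simp only [Function.comp_def, Data.hd_cons, Data.tl_cons]
  rw [h, hz, PMF.map_comp, PMF.map_comp]
  have ha : (List.ofFn fun i => Z.answer k (p i) (o i) (ψ i) b) =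
      (List.ofFn fun i => Z.S.run ((Data.num k).cons ((p i).cons
      ((o i).cons ((Data.bit b).cons Data.nil)))) (ψ i)).map (PMF.map Prod.fst) := by
    rw [List.map_ofFn]
    rfl
  rw [ha, independent_map, PMF.map_comp]
  congr 1
  funext l
  simp only [Function.comp, Data.revApp_revApp_nil]

/-- `zip` follows its first list and pads the second with `nil`, so the lengths of all four lists
are compared with n(k) before the entries are verified. -/
lemma exists_repetition_verifier (hn : EfficientlyComputable n) : ∃ V : QPT, V.prog.IsDeterministic ∧ ∃ vf : Data → Data,
    (∀ x, V.out x QMem.blank = PMF.pure (vf x)) ∧ ∀ (k : ℕ) (P Q O : Data) (b : Bool) (A : Data),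
      vf (.list [.num k, P, Q, O, .bit b, A]) ≠ .nil ↔
      ∃ p v o a : Fin (n k) → Data,
        P = .list (List.ofFn p) ∧ Q = .list (List.ofFn v) ∧ O = .list (List.ofFn o) ∧
          A = .list (List.ofFn a) ∧ ∀ i, Z.Accepts k (p i) (v i) (o i) b (a i) := by
  obtain ⟨nf, hnf, hnk⟩ := hn.exists_dcomp
  obtain ⟨vf, hvf, hvf'⟩ := QPT.exists_eq_pure Z.V_deterministic
  set step : Data → Data → Data := fun env a =>
    vf (.list [env.hd, a.hd.hd.hd, a.hd.hd.tl, a.hd.tl, env.tl, a.tl]) with hstep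
  set wf : Data → Data := fun x =>
    Data.sel (x.tl.hd.lenEq (nf x.hd)) (Data.sel (x.tl.tl.hd.lenEq (nf x.hd))
      (Data.sel (x.tl.tl.tl.hd.lenEq (nf x.hd)) (Data.sel (x.tl.tl.tl.tl.tl.hd.lenEq (nf x.hd))
      ((((x.tl.hd.zip x.tl.tl.hd).zip x.tl.tl.tl.hd).zip x.tl.tl.tl.tl.tl.hd).map step
        (.cons x.hd x.tl.tl.tl.tl.hd)).all .nil) .nil) .nil) .nil with hwf
  have hwf' : DComp Prog.IsDeterministic wf := by
    have hstep' : DComp Prog.IsDeterministic fun w => step w.hd w.tl := by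
      refine DComp.comp hvf' ?_
      simp only [Data.list]
      repeat' first
        | exact DComp.id | exact DComp.nil | apply DComp.hd | apply DComp.tl | apply DComp.cons
    have hnf' : DComp Prog.IsDeterministic fun x => nf x.hd := DComp.comp hnf (DComp.hd DComp.id)
    rw [hwf]
    repeat' first
      | exact DComp.id | exact DComp.nil | exact hnf' | apply DComp.hd | apply DComp.tl
      | apply DComp.cons | apply DComp.lenEq | apply DComp.sel | apply DComp.all | apply DComp.zip
      | exact hstep' | apply DComp.map
  obtain ⟨V, hV, hV'⟩ := hwf'.exists_alg
  refine ⟨V, hV, wf, hV', fun k P Q O b A => ?_⟩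
  simp only [hwf, Data.list, Data.hd_cons, Data.tl_cons, Data.sel_ne_nil, Data.lenEq_ne_nil, hnk,
    Data.len_num]
  constructor
  · rintro ⟨h1, h2, h3, h4, h5⟩
    obtain ⟨p, rfl⟩ := P.exists_eq_ofFn h1
    obtain ⟨v, rfl⟩ := Q.exists_eq_ofFn h2
    obtain ⟨o, rfl⟩ := O.exists_eq_ofFn h3
    obtain ⟨a, rfl⟩ := A.exists_eq_ofFn h4
    refine ⟨p, v, o, a, rfl, rfl, rfl, rfl, fun i => ?_⟩
    rw [Data.zip_ofFn, Data.zip_ofFn, Data.zip_ofFn, Data.map_list, Data.all_list_ne_nil,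
      List.map_ofFn] at h5
    rw [Puzzle.accepts_iff hvf]
    exact h5 _ (List.mem_ofFn.2 ⟨i, rfl⟩)
  · rintro ⟨p, v, o, a, rfl, rfl, rfl, rfl, h⟩
    simp only [Data.len_list, List.length_ofFn, true_and]
    rw [Data.zip_ofFn, Data.zip_ofFn, Data.zip_ofFn, Data.map_list, Data.all_list_ne_nil,
      List.map_ofFn]
    intro d hd
    rw [List.mem_ofFn] at hd
    obtain ⟨i, rfl⟩ := hd
    exact (Puzzle.accepts_iff hvf _ _ _ _ _ _).1 (h i)

theorem exists_isRepetition (hn : EfficientlyComputable n) : ∃ W : Puzzle, IsRepetition Z n W := by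
  obtain ⟨G, hG, hG'⟩ := exists_repetition_gen Z hn
  obtain ⟨O, hO⟩ := exists_repetition_obligation Z
  obtain ⟨S, hS⟩ := exists_repetition_answer Z
  obtain ⟨V, hV, wf, hwf, hV'⟩ := exists_repetition_verifier Z hn
  refine ⟨⟨G, O, S, V, hG, hV⟩, fun k => ?_, fun k p _ => hO k p,
    fun k p o ψ b hψ => hS k (n k) p o ψ b hψ, fun k P Q O b A => ?_⟩
  · rw [Puzzle.gen, hG', PMF.map_comp]
    rfl
  · rw [Puzzle.accepts_iff (Z := ⟨G, _, S, V, hG, hV⟩) hwf, hV']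

end

/-! ## Powers in unary -/

lemma Data.size_revApp (x : Data) : ∀ y, (x.revApp y).size + 1 = x.size + y.size := by
  induction x with
  | nil => intro y; simp only [revApp, size]; omega
  | cons a x _ ih => intro y; simp only [revApp, size, ih]; omega

lemma Data.revApp_num (i : ℕ) : ∀ j, (num i).revApp (num j) = num (i + j) := by
  induction i with
  | zero => intro j; rw [Nat.zero_add]; rfl
  | succ i ih =>
    intro j
    have := ih (j + 1)
    rw [num] at this
    rw [num, revApp, this]
    congr 1
    omega

/-- On unary numbers `revApp` is addition, and folding it along another unary number is
multiplication. -/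
lemma exists_dcomp_pow {C : Prog → Prop} [ProgClass C] (e : ℕ) :
    ∃ f : Data → Data, DComp C f ∧ ∀ k, f (.num k) = .num (k ^ e) := by
  induction e with
  | zero => exact ⟨_, DComp.cons DComp.nil DComp.nil, fun k => by simp [Data.num]⟩
  | succ e ih =>
    obtain ⟨f, hf, hk⟩ := ih
    refine ⟨_, DComp.ffold (H := fun env _ acc => env.revApp acc) (DComp.revApp
      (DComp.hd DComp.id) (DComp.tl (DComp.tl DComp.id))) Polynomial.X (fun env b acc => by
        have := env.size_revApp acc
        simp only [Polynomial.eval_X]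
        omega) hf DComp.id DComp.nil, fun k => ?_⟩
    rw [hk]
    have key : ∀ i j m, ffold (fun env _ acc => env.revApp acc) (Data.num j) (Data.num i)
        (Data.num m) = .num (i * j + m) := by
      intro i j
      induction i with
      | zero => intro m; simp [ffold, Data.num]
      | succ i ih =>
        intro m
        rw [Data.num, ffold, Data.revApp_num, ih]
        congr 1
        ring
    have := key k (k ^ e) 0
    rw [Data.num] at this
    rw [this]
    congr 1
    ring

lemma efficientlyComputable_pow (e : ℕ) : EfficientlyComputable fun k => k ^ e := by
  obtain ⟨f, hf, hk⟩ := exists_dcomp_pow (C := Prog.IsDeterministic) e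
  obtain ⟨M, hM, hM'⟩ := hf.exists_alg
  exact ⟨M, hM, fun k => by rw [hM', hk]⟩

/-! ### Polynomial bounds and the choice of the number of repetitions -/

lemma EfficientlyComputable.exists_le_pow {n : ℕ → ℕ} (h : EfficientlyComputable n) :
    ∃ d : ℕ, ∀ᶠ k : ℕ in atTop, n k ≤ k ^ d := by
  obtain ⟨f, hf, hk⟩ := h.exists_dcomp
  obtain ⟨p, hp⟩ := hf.size_le
  have h1 : ∀ k, n k ≤ (p.comp (2 * Polynomial.X + 1)).eval k := by
    intro k
    have := hp (.num k)
    rw [hk, Data.size_num, Data.size_num] at this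
    simp only [Polynomial.eval_comp, Polynomial.eval_add, Polynomial.eval_mul, Polynomial.eval_X,
      Polynomial.eval_one, Polynomial.eval_ofNat]
    omega
  generalize p.comp (2 * Polynomial.X + 1) = q at h1
  refine ⟨q.natDegree + 1, ?_⟩
  have h2 : ∀ k : ℕ, 1 ≤ k → q.eval k ≤ (∑ i ∈ Finset.range (q.natDegree + 1), q.coeff i) *
      k ^ q.natDegree := by
    intro k hk
    rw [Polynomial.eval_eq_sum_range, Finset.sum_mul]
    refine Finset.sum_le_sum fun i hi => Nat.mul_le_mul_left _ (Nat.pow_le_pow_right hk ?_)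
    rw [Finset.mem_range] at hi
    omega
  filter_upwards [eventually_ge_atTop 1,
    eventually_ge_atTop (∑ i ∈ Finset.range (q.natDegree + 1), q.coeff i)] with k hk hk'
  calc n k ≤ q.eval k := h1 k
    _ ≤ _ := h2 k hk
    _ ≤ k * k ^ q.natDegree := Nat.mul_le_mul_right _ hk'
    _ = k ^ (q.natDegree + 1) := by ring

/-- From h ≤ 1 - k^{-d} ≤ exp(-k^{-d}), the power k^{d+1} gives exp(-k), which is below exp(-log² k)
because log² k ≤ k eventually. -/
lemma exists_efficientlyComputable_pow_le {h : ℕ → ℝ} (h0 : ∀ k, h k ∈ Set.Icc (0 : ℝ) 1)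
    (hn : Noticeable fun k => 1 - h k) : ∃ n : ℕ → ℕ, EfficientlyComputable n ∧
      ∀ᶠ k : ℕ in Filter.atTop, h k ^ n k ≤ Real.exp (-(Real.log k) ^ 2) := by
  obtain ⟨d, hd⟩ := hn
  refine ⟨_, efficientlyComputable_pow (d + 1), ?_⟩
  have hlog : ∀ᶠ k : ℕ in atTop, Real.log k ^ 2 ≤ k := by
    have h1 := (Real.isLittleO_pow_log_id_atTop (n := 2)).bound (c := 1) one_pos
    filter_upwards [tendsto_natCast_atTop_atTop.eventually h1] with k hk
    simpa using hk
  filter_upwards [hd, hlog, eventually_ge_atTop 1] with k hk hlk hk1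
  have hkpos : (0 : ℝ) < k := by exact_mod_cast hk1
  have h1 : h k ≤ Real.exp (-(1 / (k : ℝ) ^ d)) := by
    have := Real.add_one_le_exp (-(1 / (k : ℝ) ^ d))
    linarith
  calc h k ^ k ^ (d + 1) ≤ Real.exp (-(1 / (k : ℝ) ^ d)) ^ k ^ (d + 1) :=
        pow_le_pow_left₀ (h0 k).1 h1 _
    _ = Real.exp (-k) := by
        rw [← Real.exp_nat_mul]
        congr 1
        push_cast
        field_simp
        ring
    _ ≤ _ := Real.exp_le_exp.2 (by linarith)

/-! ## Independent samples -/

lemma length_of_mem_support_independent {α : Type} {L : List (PMF α)} :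
    ∀ {l : List α}, l ∈ (independent L).support → l.length = L.length := by
  induction L with
  | nil => intro l hl; simp only [independent, PMF.support_pure, Set.mem_singleton_iff] at hl; simp [hl]
  | cons m L ih =>
    intro l hl
    simp only [independent, PMF.mem_support_bind_iff, PMF.support_map, Set.mem_image] at hl
    obtain ⟨a, _, l', hl', rfl⟩ := hl
    simp [ih hl']

lemma forall_of_mem_support_independent {α : Type} {p : α → Prop} {L : List (PMF α)} :
    (∀ m ∈ L, ∀ a ∈ m.support, p a) → ∀ {l : List α}, l ∈ (independent L).support →
      ∀ a ∈ l, p a := by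
  induction L with
  | nil =>
    intro _ l hl
    simp only [independent, PMF.support_pure, Set.mem_singleton_iff] at hl
    simp [hl]
  | cons m L ih =>
    intro h l hl
    simp only [independent, PMF.mem_support_bind_iff, PMF.support_map, Set.mem_image] at hl
    obtain ⟨a, ha, l', hl', rfl⟩ := hl
    intro b hb
    rw [List.mem_cons] at hb
    rcases hb with rfl | hb
    · exact h m List.mem_cons_self b ha
    · exact ih (fun m hm => h m (List.mem_cons_of_mem _ hm)) hl' b hb

lemma independent_bind {α β : Type} (Q : α → PMF β) (L : List (PMF α)) :
    ((independent L).bind fun l => independent (l.map Q)) =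
      independent (L.map fun m => m.bind Q) := by
  induction L with
  | nil => simp [independent]
  | cons m L ih =>
    simp only [independent, List.map_cons, PMF.bind_bind, PMF.bind_map, Function.comp_def, ← ih,
      PMF.map_bind]
    congr 1
    funext a
    rw [PMF.bind_comm]

lemma independent_all_true (m : PMF Prop) (n : ℕ) :
    ((independent (List.replicate n m)).map fun l => ∀ P ∈ l, P) True = m True ^ n := by
  induction n with
  | zero => simp [independent, PMF.pure_map]
  | succ n ih =>
    rw [List.replicate_succ, independent, PMF.map_bind, PMF.bind_apply, tsum_fintype,
      Fintype.univ_Prop]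
    rw [Finset.sum_pair (by simp)]
    have hF : ((independent (List.replicate n m)).map (List.cons False)).map
        (fun l => ∀ P ∈ l, P) = PMF.pure False := by
      rw [PMF.map_comp]
      simp only [Function.comp_def, List.mem_cons, forall_eq_or_imp, false_and]
      exact PMF.map_const _ _
    rw [hF, PMF.map_comp]
    simp only [Function.comp_def, List.mem_cons, forall_eq_or_imp, true_and, PMF.pure_apply]
    rw [ih]
    simp [pow_succ, mul_comm]

/-- `R` holds for all triples of corresponding entries of three lists. -/
def AllRel {α β γ : Type} (R : α → β → γ → Prop) : List α → List β → List γ → Prop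
  | a :: l, b :: l', c :: l'' => R a b c ∧ AllRel R l l' l''
  | _, _, _ => True

lemma allRel_ofFn {α β γ : Type} (R : α → β → γ → Prop) : ∀ {n : ℕ} (f : Fin n → α)
    (g : Fin n → β) (h : Fin n → γ),
    AllRel R (List.ofFn f) (List.ofFn g) (List.ofFn h) ↔ ∀ i, R (f i) (g i) (h i) := by
  intro n
  induction n with
  | zero => intro f g h; simp [AllRel]
  | succ n ih => intro f g h; simp only [List.ofFn_succ, AllRel, ih, Fin.forall_fin_succ]

lemma exists_eq_ofFn {α : Type} : ∀ {n : ℕ} {l : List α}, l.length = n →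
    ∃ f : Fin n → α, l = List.ofFn f := by
  rintro _ l rfl
  exact ⟨l.get, (List.ofFn_get l).symm⟩

lemma Data.list_injective : Function.Injective Data.list := by
  intro l
  induction l with
  | nil => intro l' h; cases l' with
    | nil => rfl
    | cons => simp [list] at h
  | cons a l ih => intro l' h; cases l' with
    | nil => simp [list] at h
    | cons b l' => simp only [list, cons.injEq] at h; rw [h.1, ih h.2]

/-! ## Completeness of repetitions -/

namespace Puzzle

/-- Outcome of an honest run with challenge `b` for the puzzle `pv`. -/
def playOn (Z : Puzzle) (k : ℕ) (b : Bool) (pv : Data × Data) : PMF Prop :=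
  (Z.obligation k pv.1).bind fun oψ =>
    (Z.answer k pv.1 oψ.1 oψ.2 b).map fun a => Z.Accepts k pv.1 pv.2 oψ.1 b a

/-- The challenge is drawn first: in a repetition it is common to all rounds, which become
independent only when it is fixed. -/
lemma honestGame_eq (Z : Puzzle) (k : ℕ) :
    Z.honestGame k = fairCoin.bind fun b => (Z.gen k).bind (Z.playOn k b) := by
  rw [PMF.bind_comm, honestGame]
  congr 1
  funext pv
  rw [show fairCoin.bind (fun b => Z.playOn k b pv) = fairCoin.bind fun b =>
    (Z.obligation k pv.1).bind fun oψ =>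
    (Z.answer k pv.1 oψ.1 oψ.2 b).map fun a => Z.Accepts k pv.1 pv.2 oψ.1 b a from rfl,
    PMF.bind_comm]

lemma honestGame_true (Z : Puzzle) (k : ℕ) : (Z.honestGame k True).toReal =
    (((Z.gen k).bind (Z.playOn k true) True).toReal +
      ((Z.gen k).bind (Z.playOn k false) True).toReal) / 2 := by
  rw [honestGame_eq, PMF.bind_apply, tsum_fintype, Fintype.sum_bool]
  have hb : ∀ b, fairCoin b = 2⁻¹ := fun b => by simp [fairCoin]
  rw [hb, hb, ENNReal.toReal_add, ENNReal.toReal_mul, ENNReal.toReal_mul]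
  · simp only [ENNReal.toReal_inv, ENNReal.toReal_ofNat]
    ring
  · exact ENNReal.mul_ne_top (by simp) (PMF.apply_ne_top _ _)
  · exact ENNReal.mul_ne_top (by simp) (PMF.apply_ne_top _ _)

lemma obligation_ne_zero (Z : Puzzle) (k : ℕ) (p : Data) {y : Data × QMem}
    (hy : y ∈ (Z.obligation k p).support) : y.2 ≠ 0 :=
  Z.O.mem_ne_zero _ rfl QMem.blank_ne_zero hy

/-- Drawing all obligations and then all answers is the same as playing the rounds one after the
other, because the draws of different rounds commute. -/
lemma playOn_list (Z : Puzzle) (k : ℕ) (b : Bool) (l : List (Data × Data)) :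
    ((independent (l.map fun pv => Z.obligation k pv.1)).bind fun l' =>
      (independent (List.zipWith (fun pv oψ => Z.answer k pv.1 oψ.1 oψ.2 b) l l')).map fun l'' =>
        AllRel (fun pv oψ a => Z.Accepts k pv.1 pv.2 oψ.1 b a) l l' l'') =
      (independent (l.map (Z.playOn k b))).map fun Ps => ∀ P ∈ Ps, P := by
  induction l with
  | nil => simp [independent, AllRel, PMF.pure_map]
  | cons pv l ih =>
    have key : ∀ P : Prop, ((independent (l.map fun pv => Z.obligation k pv.1)).bind fun l' =>
        (independent (List.zipWith (fun pv oψ => Z.answer k pv.1 oψ.1 oψ.2 b) l l')).map fun l'' =>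
          (P ∧ AllRel (fun pv oψ a => Z.Accepts k pv.1 pv.2 oψ.1 b a) l l' l'')) =
        (independent (l.map (Z.playOn k b))).map fun Ps => P ∧ ∀ P ∈ Ps, P := by
      intro P
      have := congrArg (PMF.map fun Q => P ∧ Q) ih
      simpa only [PMF.map_bind, PMF.map_comp, Function.comp_def] using this
    simp only [List.map_cons, independent, PMF.bind_bind, PMF.bind_map, Function.comp_def,
      List.zipWith_cons_cons, PMF.map_bind, PMF.map_comp, AllRel, List.mem_cons,
      forall_eq_or_imp]
    rw [playOn, PMF.bind_bind]
    congr 1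
    funext oψ
    rw [PMF.bind_comm, PMF.bind_map]
    congr 1
    funext a
    exact key _

end Puzzle

namespace IsRepetition

variable {Z W : Puzzle} {n : ℕ → ℕ}

lemma accepts_ofFn (h : IsRepetition Z n W) (k : ℕ) (p v o a : Fin (n k) → Data) (b : Bool) :
    W.Accepts k (.list (List.ofFn p)) (.list (List.ofFn v)) (.list (List.ofFn o)) b
      (.list (List.ofFn a)) ↔ ∀ i, Z.Accepts k (p i) (v i) (o i) b (a i) := by
  rw [h.accepts]
  constructor
  · rintro ⟨p', v', o', a', hp, hv, ho, ha, hh⟩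
    obtain rfl := List.ofFn_injective (Data.list_injective hp)
    obtain rfl := List.ofFn_injective (Data.list_injective hv)
    obtain rfl := List.ofFn_injective (Data.list_injective ho)
    obtain rfl := List.ofFn_injective (Data.list_injective ha)
    exact hh
  · exact fun hh => ⟨p, v, o, a, rfl, rfl, rfl, rfl, hh⟩

lemma play_eq (h : IsRepetition Z n W) (k : ℕ) (b : Bool) :
    (W.gen k).bind (W.playOn k b) =
      (independent (List.replicate (n k) ((Z.gen k).bind (Z.playOn k b)))).map
        fun Ps => ∀ P ∈ Ps, P := by
  rw [← List.map_replicate (f := fun m : PMF (Data × Data) => m.bind (Z.playOn k b)),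
    ← independent_bind, PMF.map_bind, h.gen, PMF.bind_map]
  refine bind_congr_support fun l hl => ?_
  have hl' := length_of_mem_support_independent hl
  rw [List.length_replicate] at hl'
  rw [← Puzzle.playOn_list]
  simp only [Function.comp, Puzzle.playOn]
  rw [h.obligation k _ (by simpa using hl'), PMF.bind_map, List.map_map]
  refine bind_congr_support fun l' hl₂ => ?_
  have hl₂' := length_of_mem_support_independent hl₂
  rw [List.length_map, hl'] at hl₂'
  -- The behaviour of the repeated solver is specified for nonzero factors only.
  have h0 : ∀ y ∈ l', y.2 ≠ 0 := by
    refine forall_of_mem_support_independent (fun m hm y hy => ?_) hl₂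
    rw [List.mem_map] at hm
    obtain ⟨pv, _, rfl⟩ := hm
    exact Z.obligation_ne_zero k _ hy
  obtain ⟨g, rfl⟩ := exists_eq_ofFn hl'
  obtain ⟨g', rfl⟩ := exists_eq_ofFn hl₂'
  have hz : List.zipWith (fun pv oψ => Z.answer k pv.1 oψ.1 oψ.2 b) (List.ofFn g) (List.ofFn g') =
      List.ofFn fun i => Z.answer k (g i).1 (g' i).1 (g' i).2 b := by
    apply List.ext_getElem <;> simp
  simp only [Function.comp, List.map_ofFn]
  have := h.answer k (fun i => (g i).1) (fun i => (g' i).1) (fun i => (g' i).2) b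
    (fun i => h0 _ (List.mem_ofFn.2 ⟨i, rfl⟩))
  simp only [Function.comp_def]
  rw [this, hz, PMF.map_comp]
  refine map_congr_support fun l'' hl₃ => ?_
  have hl₃' := length_of_mem_support_independent hl₃
  rw [List.length_ofFn] at hl₃'
  obtain ⟨g'', rfl⟩ := exists_eq_ofFn hl₃'
  simp only [Function.comp_def, allRel_ofFn]
  exact propext (h.accepts_ofFn k (fun i => (g i).1) (fun i => (g i).2) (fun i => (g' i).1) g'' b)

/-- For each bit the success probability is an n-th power, to which Bernoulli's inequality applies.
The bound is linear, so it passes to the average over the two bits. -/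
lemma one_sub_le_honestGame (h : IsRepetition Z n W) (k : ℕ) :
    1 - n k * (1 - (Z.honestGame k True).toReal) ≤ (W.honestGame k True).toReal := by
  rw [Puzzle.honestGame_true, Puzzle.honestGame_true, h.play_eq, h.play_eq, independent_all_true,
    independent_all_true, ENNReal.toReal_pow, ENNReal.toReal_pow]
  set a := ((Z.gen k).bind (Z.playOn k true) True).toReal
  set b := ((Z.gen k).bind (Z.playOn k false) True).toReal
  have ha : 0 ≤ a := ENNReal.toReal_nonneg
  have hb : 0 ≤ b := ENNReal.toReal_nonneg
  have h1 := one_add_mul_le_pow (show -2 ≤ a - 1 by linarith) (n k)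
  have h2 := one_add_mul_le_pow (show -2 ≤ b - 1 by linarith) (n k)
  rw [add_sub_cancel] at h1 h2
  linarith

theorem complete (h : IsRepetition Z n W) (hn : EfficientlyComputable n)
    (hZ : Z.HasCompleteness fun _ => 1) : W.HasCompleteness fun _ => 1 := by
  obtain ⟨μ, hμ, hZ⟩ := hZ
  obtain ⟨d, hd⟩ := hn.exists_le_pow
  refine ⟨fun k => n k * (1 - (Z.honestGame k True).toReal), ?_, h.one_sub_le_honestGame⟩
  have h1 : ∀ k, (Z.honestGame k True).toReal ≤ 1 := fun k =>
    ENNReal.toReal_le_of_le_ofReal zero_le_one (by simpa using PMF.coe_le_one _ _)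
  have h2 : Negligible fun k => (k : ℝ) ^ d * μ k :=
    Asymptotics.SuperpolynomialDecay.param_pow_mul hμ d
  refine h2.trans_eventually_abs_le ?_
  filter_upwards [hd] with k hk
  have h3 := h1 k
  have h4 := hZ k
  have h5 : (n k : ℝ) ≤ (k : ℝ) ^ d := by exact_mod_cast hk
  simp only [Function.comp]
  rw [abs_of_nonneg (mul_nonneg (Nat.cast_nonneg _) (by linarith)),
    abs_of_nonneg (mul_nonneg (by positivity) (by linarith))]
  exact mul_le_mul h5 (by linarith) (by linarith) (by positivity)

end IsRepetition

/-! ## Expectations -/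

/-- Expectation of a function with values in `[0, ∞]`. -/
def mean {α : Type} (m : PMF α) (f : α → ENNReal) : ENNReal := ∑' a, m a * f a

section

variable {α β : Type}

lemma mean_pure (a : α) (f : α → ENNReal) : mean (PMF.pure a) f = f a := by
  classical
  rw [mean, tsum_eq_single a]
  · simp
  · intro b hb
    simp [PMF.pure_apply, hb]

lemma mean_bind (m : PMF α) (F : α → PMF β) (f : β → ENNReal) :
    mean (m.bind F) f = mean m fun a => mean (F a) f := by
  simp only [mean, PMF.bind_apply, ← ENNReal.tsum_mul_right, ← ENNReal.tsum_mul_left]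
  rw [ENNReal.tsum_comm]
  simp only [mul_assoc]

lemma mean_map (m : PMF α) (F : α → β) (f : β → ENNReal) :
    mean (m.map F) f = mean m fun a => f (F a) := by
  rw [← PMF.bind_pure_comp, mean_bind]
  simp only [Function.comp, mean_pure]

lemma mean_mono {m : PMF α} {f g : α → ENNReal} (h : ∀ a, f a ≤ g a) : mean m f ≤ mean m g :=
  ENNReal.tsum_le_tsum fun a => mul_le_mul_right (h a) _

lemma mean_const (m : PMF α) (c : ENNReal) : mean m (fun _ => c) = c := by
  rw [mean, ENNReal.tsum_mul_right, PMF.tsum_coe, one_mul]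

lemma mean_add (m : PMF α) (f g : α → ENNReal) :
    mean m (fun a => f a + g a) = mean m f + mean m g := by
  simp only [mean, mul_add, ENNReal.tsum_add]

lemma mean_mul_left (m : PMF α) (c : ENNReal) (f : α → ENNReal) :
    mean m (fun a => c * f a) = c * mean m f := by
  simp only [mean, ← ENNReal.tsum_mul_left, mul_left_comm]

lemma mean_comm (m : PMF α) (m' : PMF β) (f : α → β → ENNReal) :
    mean m (fun a => mean m' (f a)) = mean m' fun b => mean m fun a => f a b := by
  simp only [mean, ← ENNReal.tsum_mul_left]
  rw [ENNReal.tsum_comm]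
  simp only [mul_left_comm]

lemma mean_finset_sum {ι : Type} (m : PMF α) (s : Finset ι) (f : ι → α → ENNReal) :
    mean m (fun a => ∑ i ∈ s, f i a) = ∑ i ∈ s, mean m (f i) := by
  classical
  induction s using Finset.induction_on with
  | empty => simp [mean]
  | insert i s hi ih => simp only [Finset.sum_insert hi, mean_add, ih]

open Classical in
/-- The indicator of a proposition. -/
def ind (P : Prop) : ENNReal := if P then 1 else 0

lemma ind_le_one (P : Prop) : ind P ≤ 1 := by
  unfold ind
  split_ifs <;> simp

lemma ind_mono {P Q : Prop} (h : P → Q) : ind P ≤ ind Q := by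
  unfold ind
  split_ifs <;> simp_all

lemma ind_of_true {P : Prop} (h : P) : ind P = 1 := if_pos h

lemma ind_of_false {P : Prop} (h : ¬ P) : ind P = 0 := if_neg h

lemma mean_ind (m : PMF Prop) : mean m ind = m True := by
  rw [mean, tsum_eq_single True, ind_of_true trivial, mul_one]
  intro P hP
  rw [ind_of_false fun h => hP (by simpa using h), mul_zero]

lemma mean_le_one {m : PMF α} {f : α → ENNReal} (h : ∀ a, f a ≤ 1) : mean m f ≤ 1 :=
  (mean_mono h).trans (mean_const m 1).le

/-- An affine function is averaged and negative values are truncated to 0; truncation can only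
increase the mean on the right. This lets lower bounds that may be negative be handled in `[0, ∞]`.
-/
lemma ofReal_sub_le_mean {m : PMF α} {f : α → ℝ} {s : ℝ}
    (hs : mean m (fun a => ENNReal.ofReal (f a)) = ENNReal.ofReal s) (hs0 : 0 ≤ s) {x y : ℝ} (hy : 0 ≤ y) :
    ENNReal.ofReal (x * s - y) ≤ mean m fun a => ENNReal.ofReal (x * f a - y) := by
  rcases le_total x 0 with hx | hx
  · rw [ENNReal.ofReal_of_nonpos]
    · exact zero_le
    · nlinarith [mul_nonneg (neg_nonneg.2 hx) hs0]
  · rw [ENNReal.ofReal_sub _ hy, ENNReal.ofReal_mul hx, ← hs, ← mean_mul_left,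
      tsub_le_iff_right]
    conv_rhs => rw [← mean_const m (ENNReal.ofReal y)]
    rw [← mean_add]
    refine mean_mono fun a => ?_
    rw [← ENNReal.ofReal_mul hx]
    refine (ENNReal.ofReal_le_ofReal ?_).trans (ENNReal.ofReal_add_le (p := x * f a - y))
    linarith

end

/-! ## Repeated attempts -/

/-- Run `F` on input `env` until the result is not `nil`, at most as often as the length of the
list. -/
def retry (F : Data → PMF Data) (env c : Data) : PMF Data :=
  foldD (fun w => match w.tl.tl with
    | .nil => F w.hd
    | .cons _ _ => PMF.pure w.tl.tl) env c .nil

section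

variable (F : Data → PMF Data) (env : Data)

lemma mean_retry_aux (c : Data) (x y : Data) (g : Data → ENNReal) :
    mean (foldD (fun w => match w.tl.tl with
      | .nil => F w.hd
      | .cons _ _ => PMF.pure w.tl.tl) env c (.cons x y)) g = g (.cons x y) := by
  induction c with
  | nil => rw [foldD, mean_pure]
  | cons a c _ ih =>
    rw [foldD]
    simp only [Data.tl_cons, PMF.pure_bind]
    exact ih

/-- Let `q` be the probability of failure of one attempt and Σ the sum of q^i over i < M, with M the
length of `c`. The retried process has mean at least tΣ. Since sΣ + q^M = 1 and q^M ≤ Σ/M, it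
follows that t ≤ (s + 1/M)tΣ. Giving up after M attempts thus costs an additive 1/M in the
normalisation, however small `s` is. -/
lemma mean_le_retry (c : Data) (hc : 0 < c.len) (g : Data → ENNReal) :
    mean (F env) (fun y => ind (y ≠ .nil) * g y) ≤
      (mean (F env) (fun y => ind (y ≠ .nil)) + (c.len : ENNReal)⁻¹) * mean (retry F env c) g := by
  set s := mean (F env) fun y => ind (y ≠ .nil)
  set q := mean (F env) fun y => ind (y = .nil)
  set t := mean (F env) fun y => ind (y ≠ .nil) * g y
  have hsq : s + q = 1 := by
    rw [← mean_add]
    rw [← mean_const (F env) 1]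
    congr 1
    funext y
    by_cases hy : y = .nil
    · rw [ind_of_true hy, ind_of_false (not_not_intro hy), zero_add]
    · rw [ind_of_false hy, ind_of_true hy, add_zero]
  have hq : q ≤ 1 := hsq ▸ le_add_self
  have h1 : t * ∑ i ∈ Finset.range c.len, q ^ i ≤ mean (retry F env c) g := by
    clear hc
    induction c with
    | nil => simp [Data.len]
    | cons a c _ ih =>
      rw [retry, foldD, mean_bind]
      simp only [Data.tl_cons, Data.hd_cons]
      rw [Data.len, Finset.sum_range_succ']
      calc _ = t + q * (t * ∑ i ∈ Finset.range c.len, q ^ i) := by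
            simp only [pow_succ, ← Finset.sum_mul, pow_zero]
            ring
        _ ≤ t + q * mean (retry F env c) g := by gcongr
        _ = mean (F env) fun y => ind (y ≠ .nil) * g y + mean (retry F env c) g * ind (y = .nil) := by
            rw [mean_add, mean_mul_left, mul_comm q]
        _ ≤ _ := mean_mono fun y => by
            cases y with
            | nil => rw [ind_of_true rfl, ind_of_false (by simp), zero_mul, zero_add, mul_one, retry]
            | cons x y =>
              rw [mean_retry_aux, ind_of_true (by simp), ind_of_false (by simp)]
              simp
  have h2 : ∀ j, s * ∑ i ∈ Finset.range j, q ^ i + q ^ j = 1 := by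
    intro j
    induction j with
    | zero => simp
    | succ j ih =>
      rw [Finset.sum_range_succ, pow_succ]
      calc _ = s * ∑ i ∈ Finset.range j, q ^ i + q ^ j * (s + q) := by ring
        _ = 1 := by rw [hsq, mul_one, ih]
  have h3 : q ^ c.len ≤ (c.len : ENNReal)⁻¹ * ∑ i ∈ Finset.range c.len, q ^ i := by
    calc q ^ c.len = (c.len : ENNReal)⁻¹ * ∑ i ∈ Finset.range c.len, q ^ c.len := by
          rw [Finset.sum_const, Finset.card_range, nsmul_eq_mul, ← mul_assoc,
            ENNReal.inv_mul_cancel (by simpa using hc.ne') (by simp), one_mul]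
      _ ≤ _ := by
          refine mul_le_mul_right (Finset.sum_le_sum fun i hi => ?_) _
          exact pow_le_pow_right_of_le_one' hq (Finset.mem_range.1 hi).le
  calc t = t * (s * ∑ i ∈ Finset.range c.len, q ^ i + q ^ c.len) := by rw [h2, mul_one]
    _ ≤ t * (s * ∑ i ∈ Finset.range c.len, q ^ i +
        (c.len : ENNReal)⁻¹ * ∑ i ∈ Finset.range c.len, q ^ i) := by gcongr
    _ = (s + (c.len : ENNReal)⁻¹) * (t * ∑ i ∈ Finset.range c.len, q ^ i) := by ring
    _ ≤ _ := by gcongr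

end

/-! ## Average success probability along random extensions -/

/-- Sum of the expectations of `f` after `0, …, m - 1` random steps. -/
def sumAlong {R : Type} (ext : R → PMF R) (f : R → ENNReal) : ℕ → R → ENNReal
  | 0, _ => 0
  | m + 1, r => f r + mean (ext r) (sumAlong ext f m)

/-- The tangent to the exponential at log θ. Summed over factors with product θ^N it yields the
inequality of the means. -/
lemma le_mul_one_sub_log_add_log {θ x : ℝ} (hθ : 0 < θ) (hx : 0 < x) :
    θ * (1 - Real.log θ + Real.log x) ≤ x := by
  have h := Real.log_le_sub_one_of_pos (div_pos hx hθ)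
  rw [Real.log_div hx.ne' hθ.ne'] at h
  have h2 := mul_le_mul_of_nonneg_left h hθ.le
  have h3 : θ * (x / θ - 1) = x - θ := by field_simp
  nlinarith

/-- Without errors, `f r` is at least the mean of s(r)/s(r') over the random extension r' of r, and
the tangent inequality bounds the quotient below by θ(1 - log θ + log s(r) - log s(r')). The
logarithms telescope, so the potential θ(m(1 - log θ) + log s(r)) is a lower bound for the sum over
the `m` remaining steps. With `s + η` in place of `s` denominators stay positive, and each step
loses at most Nη/(s + η). -/
theorem le_sumAlong {Q R : Type} {μ : PMF Q} {ext : R → PMF R} {f : R → ENNReal} {s : R → ℝ}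
    {u : R → Q → ℝ} {push : Q → R → R} {len : R → ℕ} {N : ℕ} {η θ : ℝ} (hη : 0 < η)
    (hθ : 0 < θ) (hs0 : ∀ r, 0 ≤ s r) (hs1 : ∀ r, s r ≤ 1) (hu0 : ∀ r q, 0 ≤ u r q)
    (hu : ∀ r q, u r q ≤ s (push q r)) (hlen : ∀ r q, len (push q r) = len r + 1)
    (hmean : ∀ r, len r < N → mean μ (fun q => ENNReal.ofReal (u r q)) = ENNReal.ofReal (s r))
    (hext : ∀ r, len r < N → ∀ g : R → ENNReal, mean μ (fun q => ENNReal.ofReal (u r q) *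
      g (push q r)) ≤ ENNReal.ofReal (s r + η) * mean (ext r) g)
    (hf : ∀ r, len r < N → mean μ (fun q => ENNReal.ofReal (u r q / (s (push q r) + η))) ≤ f r) :
    ∀ m r, len r + m = N → ENNReal.ofReal (θ * (m * (1 - Real.log θ) +
      (Real.log (s r + η) - Real.log (1 + η))) - m * N * η / (s r + η)) ≤ sumAlong ext f m r := by
  have hpos : ∀ r, 0 < s r + η := fun r => by linarith [hs0 r]
  have hlog : ∀ r, Real.log (s r + η) ≤ Real.log (1 + η) := fun r =>
    Real.log_le_log (hpos r) (by linarith [hs1 r])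
  have hθ1 : θ * (1 - Real.log θ) ≤ 1 := by
    simpa using le_mul_one_sub_log_add_log hθ one_pos
  intro m
  induction m with
  | zero =>
    intro r _
    rw [ENNReal.ofReal_of_nonpos]
    · exact zero_le
    · simp only [Nat.cast_zero, zero_mul, zero_add, zero_div, sub_zero]
      exact mul_nonpos_of_nonneg_of_nonpos hθ.le (by linarith [hlog r])
  | succ m ih =>
    intro r hr
    have hrN : len r < N := by omega
    have hmN : ((m + 1 : ℕ) : ℝ) ≤ N := by exact_mod_cast (by omega : m + 1 ≤ N)
    set A : ℝ := θ * ((m + 1 : ℕ) * (1 - Real.log θ) +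
      (Real.log (s r + η) - Real.log (1 + η))) with hA
    -- The tangent inequality at 1 gives θ(1 - log θ) ≤ 1, so each step contributes at most 1; this
    -- caps the loss below.
    have hAN : A ≤ N := by
      have h1 : A = (m + 1 : ℕ) * (θ * (1 - Real.log θ)) +
        θ * (Real.log (s r + η) - Real.log (1 + η)) := by rw [hA]; ring
      have h2 := mul_le_mul_of_nonneg_left hθ1 (Nat.cast_nonneg (m + 1) : (0 : ℝ) ≤ (m + 1 : ℕ))
      have h3 := mul_nonpos_of_nonneg_of_nonpos hθ.le (sub_nonpos.2 (hlog r))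
      linarith
    set y : ℝ := m * N * η / (s r + η) with hy
    have hy0 : 0 ≤ y := by have := hpos r; positivity
    -- The density of the extension is u/(s + η), of total mass s/(s + η) instead of 1. The missing
    -- mass costs Aη/(s + η) ≤ Nη/(s + η), one more unit of the error term.
    have hreal : A - (m + 1 : ℕ) * N * η / (s r + η) ≤ A / (s r + η) * s r - y := by
      have := hpos r
      have h1 : A / (s r + η) * s r = A - A * η / (s r + η) := by field_simp; ring
      have h2 : A * η / (s r + η) ≤ N * η / (s r + η) := by gcongr
      have h3 : ((m + 1 : ℕ) : ℝ) * N * η / (s r + η) = y + N * η / (s r + η) := by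
        rw [hy]; push_cast; ring
      linarith
    -- The tangent inequality at (s + η)/(s' + η), weighted by u/(s + η). The error term passes from
    -- s' to s since u ≤ s'.
    have hpoint : ∀ q, A / (s r + η) * u r q - y ≤ u r q / (s (push q r) + η) +
        (s r + η)⁻¹ * (u r q * (θ * (m * (1 - Real.log θ) + (Real.log (s (push q r) + η) -
          Real.log (1 + η))) - m * N * η / (s (push q r) + η))) := by
      intro q
      set s' := s (push q r)
      have hs' : 0 < s' + η := hpos _
      have hsr := hpos r
      have h1 := le_mul_one_sub_log_add_log hθ (div_pos hsr hs')
      rw [Real.log_div hsr.ne' hs'.ne'] at h1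
      have h2 : u r q / (s' + η) ≤ 1 := by
        rw [div_le_one hs']
        linarith [hu r q]
      have h3 := mul_le_mul_of_nonneg_left h1 (div_nonneg (hu0 r q) hsr.le)
      have h4 : u r q / (s r + η) * ((s r + η) / (s' + η)) = u r q / (s' + η) := by
        field_simp
      have h5 : (s r + η)⁻¹ * (u r q * (m * N * η / (s' + η))) = u r q / (s' + η) * y := by
        rw [hy]; field_simp
      have h6 := mul_le_mul_of_nonneg_right h2 hy0
      have h7 : A / (s r + η) * u r q = u r q / (s r + η) * (θ * (1 - Real.log θ +
          (Real.log (s r + η) - Real.log (s' + η)))) + (s r + η)⁻¹ * (u r q * (θ * (m *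
          (1 - Real.log θ) + (Real.log (s' + η) - Real.log (1 + η))))) := by
        rw [hA]; push_cast; ring
      rw [mul_sub, mul_sub, h5, h7]
      rw [h4] at h3
      linarith
    have hinv : ENNReal.ofReal (s r + η) * ENNReal.ofReal (s r + η)⁻¹ = 1 := by
      rw [← ENNReal.ofReal_mul (hpos r).le, mul_inv_cancel₀ (hpos r).ne', ENNReal.ofReal_one]
    calc _ ≤ ENNReal.ofReal (A / (s r + η) * s r - y) := ENNReal.ofReal_le_ofReal hreal
      _ ≤ mean μ fun q => ENNReal.ofReal (A / (s r + η) * u r q - y) :=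
          ofReal_sub_le_mean (hmean r hrN) (hs0 r) hy0
      _ ≤ mean μ fun q => ENNReal.ofReal (u r q / (s (push q r) + η)) +
            ENNReal.ofReal (s r + η)⁻¹ * (ENNReal.ofReal (u r q) *
              sumAlong ext f m (push q r)) := mean_mono fun q => by
          refine (ENNReal.ofReal_le_ofReal (hpoint q)).trans (ENNReal.ofReal_add_le.trans ?_)
          gcongr
          rw [ENNReal.ofReal_mul (inv_nonneg.2 (hpos r).le), ENNReal.ofReal_mul (hu0 r q)]
          gcongr
          exact ih _ (by rw [hlen]; omega)
      _ = mean μ (fun q => ENNReal.ofReal (u r q / (s (push q r) + η))) +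
            ENNReal.ofReal (s r + η)⁻¹ * mean μ fun q => ENNReal.ofReal (u r q) *
              sumAlong ext f m (push q r) := by rw [mean_add, mean_mul_left]
      _ ≤ f r + ENNReal.ofReal (s r + η)⁻¹ * (ENNReal.ofReal (s r + η) *
            mean (ext r) (sumAlong ext f m)) := by
          gcongr
          · exact hf r hrN
          · exact hext r hrN _
      _ = _ := by rw [← mul_assoc, mul_comm (ENNReal.ofReal (s r + η)⁻¹), hinv, one_mul, sumAlong]

lemma sumAlong_foldD (F : Data → PMF Data) (env : Data) (f : Data → ENNReal) (m : ℕ) : ∀ r,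
    sumAlong (fun r => F (.cons env (.cons .nil r))) f m r =
      ∑ j ∈ Finset.range m, mean (foldD F env (.num j) r) f := by
  induction m with
  | zero => intro r; rfl
  | succ m ih =>
    intro r
    rw [sumAlong, Finset.sum_range_succ', add_comm, Data.num, foldD, mean_pure, funext ih,
      mean_finset_sum]
    simp only [Data.num, foldD, mean_bind]

/-! ## Random indices -/

/-- Remainder modulo the length of `c`, for lists with less than twice as many entries. -/
def Data.reduce (c x : Data) : Data := sel (c.drop (.cons .nil x)) (c.drop x) x

lemma Data.drop_num (c : Data) : ∀ j, c.drop (num j) = num (j - c.len) := by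
  induction c with
  | nil => intro j; rfl
  | cons a c _ ih =>
    rintro (_ | j)
    · simpa [num, drop, len] using ih 0
    · simpa [num, drop, len] using ih j

/-- Dropping from a list with one entry more distinguishes j ≥ `c.len` from j < `c.len`; a single
subtraction then suffices. -/
lemma Data.reduce_num {c : Data} {j : ℕ} (h : j < 2 * c.len) :
    c.reduce (num j) = num (j % c.len) := by
  have h1 : Data.cons .nil (num j) = num (j + 1) := rfl
  rw [reduce, h1, drop_num, drop_num]
  by_cases hj : j < c.len
  · rw [Nat.sub_eq_zero_of_le hj, Nat.mod_eq_of_lt hj]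
    rfl
  · rw [show j + 1 - c.len = (j - c.len) + 1 by omega, Nat.mod_eq_sub_mod (by omega),
      Nat.mod_eq_of_lt (by omega)]
    rfl

/-- Append a random binary digit to the index `w.tl.tl`, modulo the length of `w.hd`. -/
def digit (w : Data) : PMF Data :=
  (fairCoin.map Data.bit).map fun b => w.hd.reduce (w.tl.tl.revApp (w.tl.tl.revApp b))

lemma digit_num {c : Data} {j : ℕ} (hj : j < c.len) (a : Data) :
    digit (.cons c (.cons a (.num j))) =
      fairCoin.map fun b => .num ((2 * j + b.toNat) % c.len) := by
  rw [digit, PMF.map_comp]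
  congr 1
  funext b
  have hb : Data.bit b = .num b.toNat := by cases b <;> rfl
  have h2 : b.toNat ≤ 1 := Bool.toNat_le b
  simp only [Function.comp, Data.hd_cons, Data.tl_cons, hb, Data.revApp_num]
  rw [show j + (j + b.toNat) = 2 * j + b.toNat by ring, Data.reduce_num (by omega)]

lemma mean_fairCoin (f : Bool → ENNReal) : mean fairCoin f = 2⁻¹ * (f false + f true) := by
  rw [mean, tsum_fintype, Fintype.sum_bool]
  simp [fairCoin, mul_add, add_comm]

/-- Appending `t` random digits to j gives 2^t j + x with x uniform below 2^t, and reducing at each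
step agrees with reducing at the end. -/
lemma mean_digits {c : Data} (g : Data → ENNReal) (t : ℕ) : ∀ j, j < c.len →
    mean (foldD digit c (.num t) (.num j)) g =
      (2⁻¹) ^ t * ∑ x ∈ Finset.range (2 ^ t), g (.num ((2 ^ t * j + x) % c.len)) := by
  induction t with
  | zero => intro j hj; simp [foldD, mean_pure, Data.num, Nat.mod_eq_of_lt hj]
  | succ t ih =>
    intro j hj
    have hstep : ∀ y : ℕ, ∀ x, (2 ^ t * (y % c.len) + x) % c.len = (2 ^ t * y + x) % c.len := fun y x => by
      simp [Nat.add_mod, Nat.mul_mod]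
    rw [Data.num, foldD, mean_bind, digit_num hj, mean_map, mean_fairCoin,
      ih _ (Nat.mod_lt _ (by omega)), ih _ (Nat.mod_lt _ (by omega)), ← mul_add, ← mul_assoc,
      ← pow_succ', pow_succ 2 t, mul_two, Finset.sum_range_add]
    simp only [hstep, Bool.toNat_false, Bool.toNat_true]
    congr 3 <;> funext x <;> congr 2 <;> ring_nf

/-- Every residue is hit at least ⌊N/m⌋ times. -/
lemma sum_le_sum_mod (m : ℕ) (g : ℕ → ENNReal) (N : ℕ) :
    (N / m : ℕ) * ∑ x ∈ Finset.range m, g x ≤ ∑ x ∈ Finset.range N, g (x % m) := by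
  have key : ∀ q : ℕ, q * ∑ x ∈ Finset.range m, g x = ∑ x ∈ Finset.range (q * m), g (x % m) := by
    intro q
    induction q with
    | zero => simp
    | succ q ih =>
      rw [Nat.succ_mul, Finset.sum_range_add, ← ih]
      push_cast
      rw [add_mul, one_mul]
      congr 1
      refine Finset.sum_congr rfl fun x hx => ?_
      rw [Nat.mul_add_mod', Nat.mod_eq_of_lt (Finset.mem_range.1 hx)]
  rw [key]
  exact Finset.sum_le_sum_of_subset (Finset.range_mono (Nat.div_mul_le_self _ _))

/-- A truly uniform index would need divisions of the coin space that fair bits do not allow. Each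
index has probability at least 2^{-t}⌊2^t/m⌋, so an average `x` over indices drops by at most m/2^t.
-/
lemma sub_le_mean_digits {c : Data} (hm : 0 < c.len) (g : Data → ENNReal) (t : ℕ) {x : ℝ}
    (hx : x ≤ 1) (hg : ENNReal.ofReal (c.len * x) ≤ ∑ j ∈ Finset.range c.len, g (.num j)) :
    ENNReal.ofReal (x - c.len / 2 ^ t) ≤ mean (foldD digit c (.num t) .nil) g := by
  have h1 := mean_digits g t 0 hm
  set m := c.len with hmc
  simp only [mul_zero, zero_add] at h1
  rcases le_total x 0 with hx0 | hx0
  · rw [ENNReal.ofReal_of_nonpos]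
    · exact zero_le
    · have : (0 : ℝ) ≤ m / 2 ^ t := by positivity
      linarith
  rw [show Data.nil = .num 0 from rfl, h1]
  refine le_trans ?_ (mul_le_mul_right ((mul_le_mul_right hg _).trans
    (sum_le_sum_mod m (fun j => g (.num j)) (2 ^ t))) _)
  have h2 : ((2 : ENNReal)⁻¹) ^ t = ENNReal.ofReal ((2⁻¹ : ℝ) ^ t) := by
    rw [ENNReal.ofReal_pow (by norm_num), ENNReal.ofReal_inv_of_pos (by norm_num)]
    simp
  rw [h2, ← ENNReal.ofReal_natCast, ← ENNReal.ofReal_mul (by positivity),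
    ← ENNReal.ofReal_mul (by positivity)]
  refine ENNReal.ofReal_le_ofReal ?_
  have hm' : (0 : ℝ) < m := by exact_mod_cast hm
  have h3 : (2 : ℝ) ^ t ≤ (2 ^ t / m : ℕ) * m + m := by
    have := (Nat.lt_div_mul_add (a := 2 ^ t) hm).le
    exact_mod_cast this
  have h4 : x - m / 2 ^ t ≤ (1 - m / 2 ^ t) * x := by
    have : (0 : ℝ) ≤ m / 2 ^ t := by positivity
    nlinarith
  refine h4.trans ?_
  have h5 : (2⁻¹ : ℝ) ^ t * ((2 ^ t / m : ℕ) * (m * x)) = ((2 ^ t / m : ℕ) * m) / 2 ^ t * x := by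
    rw [inv_pow]; ring
  rw [h5]
  gcongr
  rw [sub_le_iff_le_add, ← add_div, le_div_iff₀ (by positivity), one_mul]
  exact h3

/-! ## The reduction to a single instance -/

section

variable (G T : Data → PMF Data) (c : Data → Data)

/-- Not `nil` if and only if all entries of the list `z` of answers are correct for the
corresponding entries of the list `qs` of instances. -/
def okList (w qs z : Data) : Data := ((qs.zip z).map (fun env a => c (.cons env a)) w).all

/-- For an input `(k, r, m)`, sample as many instances as `m` has entries, and run `T` on the
puzzles of the list `r` (in reverse order) followed by the puzzles of these instances. The result is
`nil` unless all answers for the sampled instances are correct. -/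
def attempt (w : Data) : PMF Data :=
  (mapD (fun x => G x.hd) w.hd w.tl.tl).bind fun qs =>
    (T (.cons w.hd (w.tl.hd.revApp (qs.map (fun _ a => a.hd) .nil)))).map fun z =>
      Data.sel (okList c w.hd qs (w.tl.hd.drop z)) (.cons qs z) .nil

/-- Attempts until success for the list `r` of puzzles, with environment `(k, n, M)`: at most `M`
attempts with lists of `n` puzzles. -/
def attempts (env r : Data) : PMF Data :=
  retry (attempt G T c) (.cons env.hd (.cons r (r.drop env.tl.hd))) env.tl.tl

/-- Extend the list `r` of puzzles by the first sampled puzzle of a successful attempt, for an input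
`(env, b, r)`. -/
def extend (w : Data) : PMF Data :=
  (attempts G T c w.hd w.tl.tl).map fun x => .cons x.hd.hd.hd w.tl.tl

/-- The answer for the puzzle `p` in a successful attempt for the list `p, r`, for an input
`(env, p, r)`. -/
def online (w : Data) : PMF Data :=
  (attempts G T c w.hd w.tl).map fun x => (w.tl.tl.drop x.tl).hd

/-- Put the puzzle `p` at a random position, after random successful extensions, for an input
`(env, p)`. -/
def embed (w : Data) : PMF Data :=
  (foldD digit (.cons .nil w.hd.tl.hd.tl) w.hd.tl.tl .nil).bind fun i =>
    (foldD (extend G T c) w.hd i .nil).bind fun r => online G T c (.cons w.hd (.cons w.tl r))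

end

lemma mem_support_retry {F : Data → PMF Data} {env c y : Data} (h : y ∈ (retry F env c).support) :
    y = .nil ∨ y ∈ (F env).support := by
  refine mem_support_foldD (env := env) (J := fun _ y => y = .nil ∨ y ∈ (F env).support) ?_ c
    .nil (Or.inl rfl) y h
  intro a c acc hacc y hy
  cases acc with
  | nil => exact Or.inr hy
  | cons a' b =>
    simp only [Data.tl_cons, PMF.support_pure, Set.mem_singleton_iff] at hy
    rwa [hy]

section

variable {C : Prog → Prop} [ProgClass C] {F G T : Data → PMF Data} {c e f : Data → Data}

lemma Comp.retry (hF : Comp C F) (he : DComp C e) (hc : DComp C c) :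
    Comp C fun x => retry F (e x) (c x) := by
  obtain ⟨p, hp⟩ := hF.size_le
  have h1 : DComp C fun w => w.tl.tl := DComp.tl (DComp.tl DComp.id)
  refine Comp.fold_add he hc DComp.nil
    (Comp.sel h1 h1 (Comp.comp_left hF (DComp.hd DComp.id))) (g := p) ?_
  intro env b acc y hy
  cases acc with
  | nil =>
    have h1 := hp env y hy
    have h2 := polynomial_eval_mono p (Nat.le_add_right env.size b.size)
    simp only at h2
    omega
  | cons a' b' =>
    simp only [Data.tl_cons, PMF.support_pure, Set.mem_singleton_iff] at hy
    rw [hy]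
    omega

lemma Comp.map₂ {H : Data → Data → Data} (hF : Comp C F) (hH : DComp C fun w => H w.hd w.tl) :
    Comp C fun x => (F x).map (H x) := by
  simpa only [PMF.map_comp, Function.comp_def, Data.hd_cons, Data.tl_cons] using
    Comp.map (Comp.pairing hF) hH

lemma Comp.attempt (hG : Comp C G) (hT : Comp C T) (hc : DComp C c) :
    Comp C (attempt G T c) := by
  have h1 : Comp C fun w => QPuzzle.mapD (fun x => G x.hd) w.hd w.tl.tl :=
    Comp.mapD (Comp.comp_left hG (DComp.hd DComp.id)) (DComp.hd DComp.id)
      (DComp.tl (DComp.tl DComp.id))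
  refine Comp.bind h1 (Comp.map₂ (Comp.comp_left hT ?_) ?_)
  · repeat' first
      | exact DComp.id | exact DComp.nil | apply DComp.hd | apply DComp.tl | apply DComp.cons
      | apply DComp.revApp | refine DComp.map (H := fun _ a => a.hd) ?_ ?_ ?_
  · have h2 : DComp C fun w => c (.cons w.hd w.tl) :=
      DComp.comp hc (DComp.cons (DComp.hd DComp.id) (DComp.tl DComp.id))
    unfold okList
    repeat' first
      | exact DComp.id | exact DComp.nil | exact h2 | apply DComp.hd | apply DComp.tl
      | apply DComp.cons | apply DComp.sel | apply DComp.drop | apply DComp.all | apply DComp.zip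
      | refine DComp.map (H := fun env a => c (.cons env a)) ?_ ?_ ?_

lemma Comp.attempts (hG : Comp C G) (hT : Comp C T) (hc : DComp C c) (he : DComp C e)
    (hf : DComp C f) : Comp C fun x => attempts G T c (e x) (f x) :=
  Comp.retry (Comp.attempt hG hT hc) (DComp.cons (DComp.hd he)
    (DComp.cons hf (DComp.drop hf (DComp.hd (DComp.tl he))))) (DComp.tl (DComp.tl he))

lemma Comp.extend (hG : Comp C G) (hT : Comp C T) (hc : DComp C c) : Comp C (extend G T c) := by
  refine Comp.map₂ (H := fun w x => .cons x.hd.hd.hd w.tl.tl) (Comp.attempts hG hT hc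
    (DComp.hd DComp.id) (DComp.tl (DComp.tl DComp.id))) ?_
  repeat' first
    | exact DComp.id | apply DComp.hd | apply DComp.tl | apply DComp.cons

lemma Comp.online (hG : Comp C G) (hT : Comp C T) (hc : DComp C c) : Comp C (online G T c) := by
  refine Comp.map₂ (H := fun w x => (w.tl.tl.drop x.tl).hd) (Comp.attempts hG hT hc
    (DComp.hd DComp.id) (DComp.tl DComp.id)) ?_
  repeat' first
    | exact DComp.id | apply DComp.hd | apply DComp.tl | apply DComp.drop

lemma hd_mem_support_mapD {w m qs : Data} (h : qs ∈ (mapD F w m).support) :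
    qs.hd = .nil ∨ ∃ a, qs.hd ∈ (F (.cons w a)).support := by
  cases m with
  | nil =>
    simp only [mapD, PMF.support_pure, Set.mem_singleton_iff] at h
    exact Or.inl (by rw [h]; rfl)
  | cons a m =>
    simp only [mapD, PMF.mem_support_bind_iff, PMF.support_map, Set.mem_image] at h
    obtain ⟨q, hq, qs', _, rfl⟩ := h
    exact Or.inr ⟨a, hq⟩

lemma mem_support_attempt {w x : Data} (h : x ∈ (attempt G T c w).support) :
    x.hd.hd = .nil ∨ x.hd.hd ∈ (G w.hd).support := by
  simp only [QPuzzle.attempt, PMF.mem_support_bind_iff, PMF.support_map, Set.mem_image] at h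
  obtain ⟨qs, hqs, z, _, rfl⟩ := h
  cases okList c w.hd qs (w.tl.hd.drop z) with
  | nil => exact Or.inl rfl
  | cons _ _ =>
    rcases hd_mem_support_mapD hqs with h | ⟨a, h⟩
    · exact Or.inl h
    · exact Or.inr h

/-- Of a successful run only a generated puzzle is kept, whose size depends on the security
parameter and not on the prefix. So every extension adds a bounded amount, although the answers of
the solver may be polynomially longer than its input. -/
lemma Comp.fold_extend (hG : Comp C G) (hT : Comp C T) (hc : DComp C c) {c' a : Data → Data}
    (he : DComp C e) (hc' : DComp C c') (ha : DComp C a) :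
    Comp C fun x => foldD (QPuzzle.extend G T c) (e x) (c' x) (a x) := by
  obtain ⟨p, hp⟩ := hG.size_le
  refine Comp.fold_add he hc' ha (Comp.extend hG hT hc) (g := 2 + p) ?_
  intro env b acc y hy
  simp only [QPuzzle.extend, QPuzzle.attempts, PMF.support_map, Set.mem_image, Data.hd_cons,
    Data.tl_cons] at hy
  obtain ⟨x, hx, rfl⟩ := hy
  have h1 : x.hd.hd.size ≤ 1 + p.eval (env.size + b.size) := by
    rcases mem_support_retry hx with rfl | hx
    · simp [Data.size]
    rcases mem_support_attempt hx with h | h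
    · simp [h, Data.size]
    · have h2 := hp _ _ h
      have h3 := polynomial_eval_mono p (show env.hd.size ≤ env.size + b.size from
        env.size_hd_le.trans (Nat.le_add_right _ _))
      simp only [Data.hd_cons] at h2 h3
      omega
  have h2 := x.hd.hd.size_hd_le
  simp only [Data.size, Polynomial.eval_add, Polynomial.eval_ofNat]
  omega

lemma Comp.digit : Comp AnyProg digit := by
  have h1 := Comp.map₂ (H := fun w b => w.hd.reduce (w.tl.tl.revApp (w.tl.tl.revApp b))) Comp.flip
    (by
      unfold Data.reduce
      repeat' first
        | exact DComp.id | exact DComp.nil | apply DComp.hd | apply DComp.tl | apply DComp.drop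
        | apply DComp.revApp | apply DComp.sel | apply DComp.cons)
  exact h1

lemma Data.len_le_size (d : Data) : d.len ≤ d.size := by
  induction d with
  | nil => simp [len]
  | cons a b _ ih => simp only [len, size]; omega

/-- The extra `nil` in front makes the modulus positive for every input, so the index stays below it
and small even on malformed data. -/
lemma Comp.fold_digit {f g : Data → Data} (hf : DComp AnyProg f) (hg : DComp AnyProg g) :
    Comp AnyProg fun x => foldD QPuzzle.digit (.cons .nil (f x)) (g x) .nil := by
  have he := DComp.cons DComp.nil hf
  obtain ⟨p, hp⟩ := he.size_le
  refine Comp.fold he hg DComp.nil Comp.digit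
    (J := fun x _ acc => ∃ j, acc = .num j ∧ j < (Data.cons .nil (f x)).len)
    (fun x => ⟨0, rfl, by simp [Data.len]⟩) ?_ (r := 2 * p + 1) ?_
  · rintro x b d _ ⟨j, rfl, hj⟩ y hy
    rw [digit_num hj, PMF.support_map] at hy
    obtain ⟨b', _, rfl⟩ := hy
    exact ⟨_, rfl, Nat.mod_lt _ (by omega)⟩
  · rintro x d _ ⟨j, rfl, hj⟩
    have h1 := hp x
    have h2 := (Data.cons .nil (f x)).len_le_size
    rw [Data.size_num]
    simp only [Polynomial.eval_add, Polynomial.eval_mul, Polynomial.eval_ofNat,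
      Polynomial.eval_one]
    omega

end

lemma Comp.embed {G T : Data → PMF Data} {c : Data → Data} (hG : Comp AnyProg G)
    (hT : Comp AnyProg T) (hc : DComp AnyProg c) : Comp AnyProg (embed G T c) := by
  refine Comp.bind (Comp.fold_digit (f := fun w => w.hd.tl.hd.tl) ?_ ?_)
    (Comp.bind (Comp.fold_extend hG hT hc ?_ ?_ ?_) (Comp.comp_left (Comp.online hG hT hc) ?_))
  all_goals repeat' first
    | exact DComp.id | exact DComp.nil | apply DComp.hd | apply DComp.tl | apply DComp.cons

/-! ## The success probability of the reduction -/

lemma Data.drop_tl (r : Data) : ∀ z : Data, r.drop z.tl = (r.drop z).tl := by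
  induction r with
  | nil => intro z; rfl
  | cons a r _ ih => intro z; exact ih z.tl

section

variable (G T : Data → PMF Data) (c : Data → Data)

lemma okList_cons (w q qs z : Data) : okList c w (.cons q qs) z ≠ .nil ↔
    c (.cons w (.cons q z.hd)) ≠ .nil ∧ okList c w qs z.tl ≠ .nil := by
  simp only [okList, Data.zip, Data.map, Data.all, Data.sel_ne_nil]

/-- The probability that an attempt succeeds. -/
def rate (w r m : Data) : ENNReal :=
  mean (attempt G T c (.cons w (.cons r m))) fun x => ind (x ≠ .nil)

/-- The probability that an attempt for the list `q, r` succeeds, with a correct answer for the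
instance `q`. -/
def rateAt (w r m q : Data) : ENNReal :=
  mean (attempt G T c (.cons w (.cons (.cons q.hd r) m))) fun x => ind (x ≠ .nil) *
    ind (c (.cons w (.cons q (r.drop x.tl).hd)) ≠ .nil)

lemma rate_le_one (w r m : Data) : rate G T c w r m ≤ 1 := mean_le_one fun _ => ind_le_one _

lemma rateAt_le_rate (w r m q : Data) :
    rateAt G T c w r m q ≤ rate G T c w (.cons q.hd r) m :=
  mean_mono fun _ => mul_le_of_le_one_right' (ind_le_one _)

/-- Moving the first fresh instance `q` into the prefix leaves the list handed to `T` unchanged;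
only the check of `q` is split off. So a function of the first fresh instance on successful runs has
mean weighted by `rateAt`. -/
lemma mean_attempt_cons (w r m b : Data) (g : Data → ENNReal) :
    mean (attempt G T c (.cons w (.cons r (.cons b m)))) (fun x => ind (x ≠ .nil) * g x.hd.hd) =
      mean (G w) fun q => rateAt G T c w r m q * g q := by
  simp only [rateAt, attempt, mapD, mean_bind, mean_map, Data.hd_cons, Data.tl_cons, Data.map,
    Data.revApp]
  congr 1
  funext q
  rw [mul_comm, ← mean_mul_left]
  congr 1
  funext qs
  rw [← mean_mul_left]
  congr 1
  funext z
  have h1 := okList_cons c w q qs (r.drop z)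
  simp only [Data.drop, Data.drop_tl]
  rcases hA : okList c w (.cons q qs) (r.drop z) with _ | ⟨a, a'⟩
  · rw [hA] at h1
    rw [Data.sel_nil, ind_of_false (by simp), zero_mul]
    rcases hB : okList c w qs (r.drop z).tl with _ | ⟨_, _⟩
    · rw [Data.sel_nil, ind_of_false (P := Data.nil ≠ Data.nil) (by simp), zero_mul, mul_zero]
    · rw [hB] at h1
      rw [Data.sel_cons, ← Data.drop_tl, Data.tl_cons, ind_of_false (P := c _ ≠ .nil) (by simpa using h1),
        mul_zero, mul_zero]
  · rw [hA] at h1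
    have h2 := h1.1 (by simp)
    rcases hB : okList c w qs (r.drop z).tl with _ | ⟨_, _⟩
    · exact absurd hB h2.2
    · rw [Data.sel_cons, Data.sel_cons, ← Data.drop_tl, Data.tl_cons, ind_of_true h2.1,
        ind_of_true (by simp), ind_of_true (by simp)]
      simp [mul_comm]

lemma mean_rateAt (w r m b : Data) : mean (G w) (rateAt G T c w r m) = rate G T c w r (.cons b m) := by
  have := mean_attempt_cons G T c w r m b fun _ => 1
  simp only [mul_one] at this
  exact this.symm

/-- The law of `extend` dominates the ideal density of the extension, up to the error 1/M of
`mean_le_retry`. -/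
lemma mean_rateAt_le (w r m b : Data) (n : Data) {M : Data} (hM : 0 < M.len)
    (hr : r.drop n = .cons b m) (g : Data → ENNReal) :
    mean (G w) (fun q => rateAt G T c w r m q * g (.cons q.hd r)) ≤
      (rate G T c w r (.cons b m) + (M.len : ENNReal)⁻¹) *
        mean (extend G T c (.cons (.cons w (.cons n M)) (.cons .nil r))) g := by
  rw [← mean_attempt_cons G T c w r m b fun q => g (.cons q.hd r)]
  refine (mean_le_retry _ _ M hM _).trans_eq ?_
  rw [extend, mean_map, attempts]
  simp only [Data.hd_cons, Data.tl_cons, hr, rate]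

/-- Solving `q` online is conditioning on success over the prefix `q, r`, without using the key of
`q`. -/
lemma rateAt_le (w r m q : Data) (n : Data) {M : Data} (hM : 0 < M.len)
    (hr : (Data.cons q.hd r).drop n = m) :
    rateAt G T c w r m q ≤ (rate G T c w (.cons q.hd r) m + (M.len : ENNReal)⁻¹) *
      mean (online G T c (.cons (.cons w (.cons n M)) (.cons q.hd r)))
        fun e => ind (c (.cons w (.cons q e)) ≠ .nil) := by
  refine (mean_le_retry _ _ M hM _).trans_eq ?_
  rw [online, mean_map, attempts]
  simp only [Data.hd_cons, Data.tl_cons, hr, rate]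

/-- `le_sumAlong` with θ = ε^{1/N} and η = 1/M bounds the sum over positions: since N log θ = log ε,
the logarithmic terms cancel and θN remains. Dividing by N gives the average, and N/2^M is the bias
of the random position. -/
theorem le_mean_embed (w : Data) {N M : ℕ} (hN : 0 < N) (hM : 0 < M) {ε : ℝ} (hε : 0 < ε)
    (h : ENNReal.ofReal ε ≤ rate G T c w .nil (.num N)) :
    ENNReal.ofReal (ε ^ (1 / N : ℝ) - (N + 1) / (M * ε) - N / 2 ^ M) ≤
      mean (G w) fun q => mean (embed G T c (.cons (.cons w (.cons (.num N) (.num M))) q.hd))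
        fun e => ind (c (.cons w (.cons q e)) ≠ .nil) := by
  set env : Data := .cons w (.cons (.num N) (.num M)) with henv
  set f : Data → ENNReal := fun r => mean (G w) fun q =>
    mean (online G T c (.cons env (.cons q.hd r))) fun e => ind (c (.cons w (.cons q e)) ≠ .nil)
    with hf
  set s : Data → ℝ := fun r => (rate G T c w r (r.drop (.num N))).toReal with hs
  set u : Data → Data → ℝ := fun r q =>
    (rateAt G T c w r ((Data.cons q.hd r).drop (.num N)) q).toReal with hu
  set η : ℝ := (M : ℝ)⁻¹ with hη
  have hM' : (0 : ℝ) < M := by exact_mod_cast hM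
  have hN' : (0 : ℝ) < N := by exact_mod_cast hN
  have hη0 : 0 < η := by positivity
  have htop : ∀ r m, rate G T c w r m ≠ ⊤ := fun r m =>
    ((rate_le_one G T c w r m).trans_lt ENNReal.one_lt_top).ne
  have htop' : ∀ r m q, rateAt G T c w r m q ≠ ⊤ := fun r m q =>
    ((rateAt_le_rate G T c w r m q).trans_lt (htop _ _).lt_top).ne
  have hηM : ((Data.num M).len : ENNReal)⁻¹ = ENNReal.ofReal η := by
    rw [Data.len_num, hη, ENNReal.ofReal_inv_of_pos hM', ENNReal.ofReal_natCast]
  have hMl : 0 < (Data.num M).len := by rwa [Data.len_num]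
  have hdrop : ∀ r : Data, r.len < N → ∀ p,
      r.drop (.num N) = .cons .nil ((Data.cons p r).drop (.num N)) := by
    intro r hr p
    rw [Data.drop_num, Data.drop_num, Data.len, show N - r.len = (N - (r.len + 1)) + 1 by omega]
    rfl
  have hsη : ∀ r, rate G T c w r (r.drop (.num N)) + ((Data.num M).len : ENNReal)⁻¹ =
      ENNReal.ofReal (s r + η) := by
    intro r
    rw [hηM, ENNReal.ofReal_add ENNReal.toReal_nonneg hη0.le,
      ENNReal.ofReal_toReal (htop _ _)]
  have hs1 : ∀ r, s r ≤ 1 := fun r => by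
    have := ENNReal.toReal_mono ENNReal.one_ne_top (rate_le_one G T c w r (r.drop (.num N)))
    simpa using this
  have hlen : ∀ r q : Data, (Data.cons q.hd r).len = r.len + 1 := fun _ _ => rfl
  have hε1 : ε ≤ s .nil := by
    have := ENNReal.toReal_mono (htop _ _) h
    rwa [ENNReal.toReal_ofReal hε.le] at this
  set θ : ℝ := ε ^ (1 / N : ℝ) with hθ
  have hθ0 : 0 < θ := Real.rpow_pos_of_pos hε _
  have hθ1 : θ ≤ 1 := Real.rpow_le_one hε.le (hε1.trans (hs1 _)) (by positivity)
  have hL := le_sumAlong (μ := G w) (ext := fun r => extend G T c (.cons env (.cons .nil r)))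
    (f := f) (s := s) (u := u) (push := fun q r => .cons q.hd r) (len := Data.len) (N := N) hη0 hθ0
    (fun _ => ENNReal.toReal_nonneg) hs1 (fun _ _ => ENNReal.toReal_nonneg)
    (fun r q => ENNReal.toReal_mono (htop _ _) (rateAt_le_rate G T c w r _ q)) hlen
    (fun r hr => by
      simp only [hu, hs, ENNReal.ofReal_toReal (htop' _ _ _), ENNReal.ofReal_toReal (htop _ _)]
      rw [hdrop r hr .nil]
      exact mean_rateAt G T c w r _ .nil)
    (fun r hr g => by
      rw [← hsη]
      simp only [hu, ENNReal.ofReal_toReal (htop' _ _ _)]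
      rw [hdrop r hr .nil]
      exact mean_rateAt_le G T c w r _ .nil (.num N) hMl (hdrop r hr .nil) g)
    (fun r hr => mean_mono fun q => by
      have hpos : 0 < s (.cons q.hd r) + η := add_pos_of_nonneg_of_pos ENNReal.toReal_nonneg hη0
      rw [ENNReal.ofReal_div_of_pos hpos, ENNReal.ofReal_toReal (htop' _ _ _), ← hsη]
      refine ENNReal.div_le_of_le_mul' ?_
      exact rateAt_le G T c w r _ q (.num N) hMl rfl)
    N .nil (by simp [Data.len])
  rw [sumAlong_foldD] at hL
  set g : Data → ENNReal := fun i => mean (foldD (extend G T c) env i .nil) f with hg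
  -- For N > 0 the guard against an empty modulus in `embed` changes nothing.
  have hcons : Data.cons .nil (Data.num N).tl = .num N := by
    obtain ⟨N, rfl⟩ := Nat.exists_eq_succ_of_ne_zero hN.ne'
    rfl
  have hmain : (mean (G w) fun q => mean (embed G T c (.cons env q.hd))
      fun e => ind (c (.cons w (.cons q e)) ≠ .nil)) =
      mean (foldD digit (.num N) (.num M) .nil) g := by
    simp only [embed, mean_bind, Data.hd_cons, Data.tl_cons, henv, hcons]
    -- The position, and then the prefix, are drawn independently of the challenge, so they may be
    -- drawn first.
    rw [mean_comm]
    congr 1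
    funext i
    rw [mean_comm]
  rw [hmain]
  have hx : θ - (N + 1) / (M * ε) ≤ 1 := by
    have : 0 ≤ (N + 1) / (M * ε) := by positivity
    linarith
  have hfin := sub_le_mean_digits (c := .num N) (by rwa [Data.len_num]) g M hx (by
    rw [Data.len_num]
    refine le_trans (ENNReal.ofReal_le_ofReal ?_) hL
    have h1 : Real.log θ = 1 / N * Real.log ε := Real.log_rpow hε _
    have hsp : 0 < s .nil + η := by linarith
    have h2 : Real.log ε ≤ Real.log (s .nil + η) := Real.log_le_log hε (by linarith)
    have h3 : Real.log (1 + η) ≤ η := by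
      have := Real.log_le_sub_one_of_pos (show 0 < 1 + η by linarith)
      linarith
    have h4 : N * N * η / (s .nil + η) ≤ N * N * η / ε := by
      gcongr
      linarith
    have h5 : (N : ℝ) * (1 - Real.log θ) = N - Real.log ε := by
      rw [h1]; field_simp
    have h6 : θ * (N - η) ≤ θ * (N * (1 - Real.log θ) +
        (Real.log (s .nil + η) - Real.log (1 + η))) := by
      gcongr
      linarith
    -- The loss from log(1 + η) ≤ η, in a form that combines with N²η/ε to N(N + 1)/(Mε).
    have h7 : θ * η ≤ N * η / ε := by
      have hε2 : ε ≤ 1 := hε1.trans (hs1 _)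
      have hN1 : (1 : ℝ) ≤ N := by exact_mod_cast hN
      rw [le_div_iff₀ hε]
      calc θ * η * ε ≤ 1 * η * 1 := by gcongr
        _ ≤ N * η := by nlinarith
    have h8 : (N : ℝ) * (θ - (N + 1) / (M * ε)) = θ * N - N * η / ε - N * N * η / ε := by
      rw [hη]; field_simp; ring
    linarith)
  rw [Data.len_num] at hfin
  exact hfin

end

/-! ## Hardness of repetitions -/

/-- The answers of a solver for a repetition, listed together with the puzzles. -/
def answers (T : QPT) (w : Data) : PMF Data :=
  (T.out (.list [w.hd, w.tl]) QMem.blank).map fun y =>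
    ((w.tl.zip y.hd).zip y.tl.hd).zip y.tl.tl.hd

/-- Verify both answers `e` to the instance `q`, for an input `(k, q, e)`. -/
def bothOk (vf : Data → Data) (w : Data) : Data :=
  .sel (vf (.list [w.hd, w.tl.hd.hd, w.tl.hd.tl, w.tl.tl.hd.hd.tl, .bit false, w.tl.tl.hd.tl]))
    (vf (.list [w.hd, w.tl.hd.hd, w.tl.hd.tl, w.tl.tl.hd.hd.tl, .bit true, w.tl.tl.tl])) .nil

lemma comp_answers (T : QPT) : Comp AnyProg (answers T) := by
  refine Comp.map₂ (H := fun w y => ((w.tl.zip y.hd).zip y.tl.hd).zip y.tl.tl.hd)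
    (Comp.comp_left (Comp.of_alg T trivial) ?_) ?_
  all_goals
    try simp only [Data.list]
    repeat' first
      | exact DComp.id | exact DComp.nil | apply DComp.hd | apply DComp.tl | apply DComp.cons
      | apply DComp.zip

lemma dcomp_bothOk {vf : Data → Data} (h : DComp AnyProg vf) : DComp AnyProg (bothOk vf) := by
  have hb := fun b => DComp.bit (C := AnyProg) b
  refine DComp.sel (DComp.comp h ?_) (DComp.comp h ?_) DComp.nil
  all_goals
    simp only [Data.list]
    repeat' first
      | exact DComp.id | exact DComp.nil | exact hb _ | apply DComp.hd | apply DComp.tl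
      | apply DComp.cons

namespace Puzzle

variable {Z : Puzzle}

lemma bothOk_iff {vf : Data → Data} (hvf : ∀ x, Z.V.out x QMem.blank = PMF.pure (vf x)) (k : ℕ)
    (q e : Data) : bothOk vf (.cons (.num k) (.cons q e)) ≠ .nil ↔
      Z.Accepts k q.hd q.tl e.hd.hd.tl false e.hd.tl ∧
        Z.Accepts k q.hd q.tl e.hd.hd.tl true e.tl := by
  rw [accepts_iff hvf, accepts_iff hvf, bothOk, Data.sel_ne_nil]
  rfl

lemma solveBothGame_true (S : QPT) (k : ℕ) : Z.solveBothGame S k True =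
    mean (Z.gen k) fun pv => mean (S.out (.list [.num k, pv.1]) QMem.blank) fun y =>
      ind (Z.Accepts k pv.1 pv.2 y.hd false y.tl.hd ∧
        Z.Accepts k pv.1 pv.2 y.hd true y.tl.tl.hd) := by
  rw [← mean_ind, solveBothGame, mean_bind]
  simp only [mean_map]

end Puzzle

/-- If the repeated verifier accepts both answers, all lists have length n(k) and every instance is
solved. Only this implication is needed; an attempt may also count malformed outputs as successes.
-/
lemma IsRepetition.solveBothGame_le_rate {Z W : Puzzle} {n : ℕ → ℕ} (h : IsRepetition Z n W)
    (T : QPT) {vf : Data → Data} (hvf : ∀ x, Z.V.out x QMem.blank = PMF.pure (vf x)) (k : ℕ) :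
    W.solveBothGame T k True ≤ rate (fun w => Z.G.out w QMem.blank) (answers T) (bothOk vf)
      (.num k) .nil (.num (n k)) := by
  rw [Puzzle.solveBothGame_true, h.gen, Puzzle.gen, ← List.map_replicate (f := PMF.map _),
    independent_map, mean_map, mean_map, rate, attempt, mean_bind]
  simp only [Data.hd_cons, Data.tl_cons, mean_map, Data.revApp, Data.drop]
  rw [num_eq_list (n k), mapD_list, List.map_replicate, mean_map, Data.hd_cons]
  refine mean_mono fun l => ?_
  rw [Data.map_list, answers, mean_map]
  simp only [Data.hd_cons, Data.tl_cons, List.map_map]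
  refine mean_mono fun y => ind_mono ?_
  rintro ⟨h1, h2⟩
  obtain ⟨p, v, o, a, hp, hv, ho, ha, hok⟩ := (h.accepts _ _ _ _ _ _).1 h1
  obtain ⟨p', v', o', a', hp', hv', ho', ha', hok'⟩ := (h.accepts _ _ _ _ _ _).1 h2
  have hl : l.length = n k := by
    have := congrArg List.length (Data.list_injective hp)
    simpa using this
  obtain ⟨q, rfl⟩ := exists_eq_ofFn hl
  rw [List.map_ofFn] at hp hp' hv hv'
  obtain rfl := List.ofFn_injective (Data.list_injective hp)
  obtain rfl := List.ofFn_injective (Data.list_injective hp')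
  obtain rfl := List.ofFn_injective (Data.list_injective hv)
  obtain rfl := List.ofFn_injective (Data.list_injective hv')
  obtain rfl := List.ofFn_injective (Data.list_injective (ho.symm.trans ho'))
  rw [Data.sel_ne_nil]
  refine ⟨?_, by simp⟩
  rw [okList, List.map_ofFn, ho, ha, ha', Data.zip_ofFn, Data.zip_ofFn, Data.zip_ofFn,
    Data.zip_ofFn, Data.map_list, Data.all_list_ne_nil, List.map_ofFn]
  intro d hd
  rw [List.mem_ofFn] at hd
  obtain ⟨i, rfl⟩ := hd
  exact (Puzzle.bothOk_iff hvf _ _ _).2 ⟨hok i, hok' i⟩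

/-- The solver is `embed` with N = n(k) and M = k^e, both computed in unary inside the algorithm;
one `S` serves all k. -/
lemma IsRepetition.exists_solver {Z W : Puzzle} {n : ℕ → ℕ} (h : IsRepetition Z n W)
    (hn : EfficientlyComputable n) (T : QPT) (e : ℕ) : ∃ S : QPT, ∀ k ≠ 0, n k ≠ 0 →
      ∀ ε, 0 < ε → ε = (W.solveBothGame T k True).toReal →
        ε ^ (1 / n k : ℝ) - (n k + 1) / ((k ^ e : ℕ) * ε) - n k / 2 ^ k ^ e ≤
          (Z.solveBothGame S k True).toReal := by
  obtain ⟨nf, hnf, hnk⟩ := hn.exists_dcomp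
  obtain ⟨mf, hmf, hmk⟩ := exists_dcomp_pow (C := AnyProg) e
  obtain ⟨vf, hvf, hvf'⟩ := QPT.exists_eq_pure Z.V_deterministic
  have h1 : Comp AnyProg fun x => (embed (fun w => Z.G.out w QMem.blank) (answers T) (bothOk vf)
      (.cons (.cons x.hd (.cons (nf x.hd) (mf x.hd))) x.tl.hd)).map fun a =>
        .list [a.hd.hd.tl, a.hd.tl, a.tl] := by
    have h2 := DComp.comp hnf.toAny (DComp.hd DComp.id)
    have h3 := DComp.comp hmf (DComp.hd DComp.id)
    refine Comp.map (Comp.comp_left (Comp.embed (Comp.of_alg Z.G trivial) (comp_answers T)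
      (dcomp_bothOk hvf'.toAny)) ?_) ?_
    all_goals
      try simp only [Data.list]
      repeat' first
        | exact DComp.id | exact DComp.nil | exact h2 | exact h3 | apply DComp.hd
        | apply DComp.tl | apply DComp.cons
  obtain ⟨S, _, hS⟩ := h1.exists_alg
  refine ⟨S, fun k hk hnk0 ε hε hεk => ?_⟩
  have h2 : ENNReal.ofReal ε ≤ rate (fun w => Z.G.out w QMem.blank) (answers T) (bothOk vf)
      (.num k) .nil (.num (n k)) := by
    rw [hεk, ENNReal.ofReal_toReal (PMF.apply_ne_top _ _)]
    exact h.solveBothGame_le_rate T hvf k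
  have h3 := le_mean_embed _ _ _ _ (Nat.pos_of_ne_zero hnk0)
    (Nat.pos_of_ne_zero (pow_ne_zero e hk)) hε h2
  rw [← ENNReal.ofReal_le_iff_le_toReal (PMF.apply_ne_top _ _)]
  refine h3.trans_eq ?_
  rw [Puzzle.solveBothGame_true, Puzzle.gen, mean_map]
  simp only [hS, mean_map, Data.list, Data.hd_cons, Data.tl_cons, hnk, hmk,
    Puzzle.bothOk_iff hvf]

/-! ### From the solver to negligible winning probability -/

lemma negligible_of_le {f : ℕ → ℝ} (h0 : ∀ k, 0 ≤ f k)
    (h : ∀ c : ℕ, ∀ᶠ k : ℕ in atTop, f k ≤ 1 / (k : ℝ) ^ c) : Negligible f := by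
  intro c
  refine squeeze_zero' (Eventually.of_forall fun k => mul_nonneg (by positivity) (h0 k)) ?_
    tendsto_one_div_atTop_nhds_zero_nat
  filter_upwards [h (c + 1), eventually_gt_atTop 0] with k hk hk0
  have hk' : (0 : ℝ) < k := by exact_mod_cast hk0
  calc (k : ℝ) ^ c * f k ≤ (k : ℝ) ^ c * (1 / (k : ℝ) ^ (c + 1)) := by gcongr
    _ = 1 / k := by rw [pow_succ]; field_simp

/-- On [0, 1] the n-th power is Lipschitz with constant n, so a gap between powers forces a gap
between bases. -/
lemma sub_div_le_sub_of_pow {a h : ℝ} {n : ℕ} (hn : n ≠ 0) (ha0 : 0 ≤ a) (ha1 : a ≤ 1)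
    (hh0 : 0 ≤ h) (hh1 : h ≤ 1) (hlt : h ^ n ≤ a ^ n) : (a ^ n - h ^ n) / n ≤ a - h := by
  have hle : h ≤ a := (pow_le_pow_iff_left₀ hh0 ha0 hn).1 hlt
  have h1 := abs_pow_sub_pow_le a h n
  rw [abs_of_nonneg (sub_nonneg.2 hlt), abs_of_nonneg (sub_nonneg.2 hle), abs_of_nonneg ha0,
    abs_of_nonneg hh0] at h1
  have h2 : max a h ^ (n - 1) ≤ 1 := pow_le_one₀ (le_max_of_le_left ha0) (max_le ha1 hh1)
  have hn' : (0 : ℝ) < n := by exact_mod_cast Nat.pos_of_ne_zero hn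
  rw [div_le_iff₀ hn']
  have h3 : 0 ≤ (a - h) * n := mul_nonneg (sub_nonneg.2 hle) hn'.le
  nlinarith

/-- If ε exceeds k^{-c} at a large k, the solver beats h(k) by at least ε/(2n) minus the sampling
error, hence by more than k^{-(c+d)}/4; but its advantage is at most the negligible μ(k). -/
theorem IsRepetition.hard {Z W : Puzzle} {n : ℕ → ℕ} (hW : IsRepetition Z n W)
    (hn : EfficientlyComputable n) {h : ℕ → ℝ} (h0 : ∀ k, h k ∈ Set.Icc (0 : ℝ) 1)
    (hZ : Z.IsHard h)
    (hh : ∀ᶠ k : ℕ in Filter.atTop, h k ^ n k ≤ Real.exp (-(Real.log k) ^ 2)) :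
    W.IsHard fun _ => 0 := by
  intro T
  refine ⟨fun k => (W.solveBothGame T k True).toReal, negligible_of_le
    (fun _ => ENNReal.toReal_nonneg) fun c => ?_, fun k => by rw [zero_add]⟩
  obtain ⟨d, hd⟩ := hn.exists_le_pow
  -- The sampling error is at most 3k^{c+d}/M and must be at most k^{-(c+d)}/4. This requires M ≥
  -- 12k^{2(c+d)}, which the extra factor k provides for k ≥ 12.
  obtain ⟨S, hS⟩ := hW.exists_solver hn T (2 * c + 2 * d + 1)
  obtain ⟨μ, hμ, hSμ⟩ := hZ S
  have hlog : ∀ᶠ k : ℕ in atTop, (c + 1 : ℝ) ≤ Real.log k :=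
    (Real.tendsto_log_atTop.comp tendsto_natCast_atTop_atTop).eventually_ge_atTop _
  filter_upwards [hd, hh, hlog, (hμ (c + d)).eventually_lt_const (by norm_num : (0 : ℝ) < 1 / 4),
    eventually_ge_atTop 12] with k hdk hhk hlk hμk hk
  by_contra! hlt
  have hk0 : k ≠ 0 := by omega
  have hkr : (12 : ℝ) ≤ k := by exact_mod_cast hk
  have hkpos : (0 : ℝ) < k := by linarith
  set ε := (W.solveBothGame T k True).toReal with hε
  have hxpos : 0 < 1 / (k : ℝ) ^ c := by positivity
  have hε0 : 0 < ε := hxpos.trans hlt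
  have hε1 : ε ≤ 1 := ENNReal.toReal_le_of_le_ofReal zero_le_one (by simpa using PMF.coe_le_one _ _)
  have hhk' : h k ^ n k ≤ ε / 2 := by
    have h1 : (c : ℝ) * Real.log k + Real.log 2 ≤ Real.log k ^ 2 := by
      have : Real.log 2 ≤ Real.log k := Real.log_le_log (by norm_num) (by linarith)
      have h2 : 0 ≤ Real.log k := by
        have : (0 : ℝ) ≤ c := Nat.cast_nonneg c
        linarith
      nlinarith
    calc h k ^ n k ≤ _ := hhk
      _ ≤ Real.exp (-(c * Real.log k + Real.log 2)) := Real.exp_le_exp.2 (by linarith)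
      _ = 1 / (k : ℝ) ^ c / 2 := by
          rw [neg_add, Real.exp_add, Real.exp_neg, Real.exp_neg, Real.exp_nat_mul,
            Real.exp_log hkpos, Real.exp_log (by norm_num)]
          ring
      _ ≤ ε / 2 := by linarith
  -- With no repetitions the power of h would be 1, above ε/2.
  have hnk : n k ≠ 0 := by
    intro hz
    rw [hz, pow_zero] at hhk'
    linarith
  have hnpos : (0 : ℝ) < n k := by exact_mod_cast Nat.pos_of_ne_zero hnk
  have hn1 : (1 : ℝ) ≤ n k := by exact_mod_cast Nat.pos_of_ne_zero hnk
  have hndr : (n k : ℝ) ≤ (k : ℝ) ^ d := by exact_mod_cast hdk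
  have h1 := (hS k hk0 hnk ε hε0 hε).trans (hSμ k)
  have h2 : (ε ^ (1 / n k : ℝ)) ^ n k = ε := by
    rw [one_div, Real.rpow_inv_natCast_pow hε0.le hnk]
  have h3 := sub_div_le_sub_of_pow (a := ε ^ (1 / n k : ℝ)) hnk (by positivity)
    (Real.rpow_le_one hε0.le hε1 (by positivity)) (h0 k).1 (h0 k).2 (by rw [h2]; linarith)
  rw [h2] at h3
  set M : ℕ := k ^ (2 * c + 2 * d + 1) with hM
  have hMpos : (0 : ℝ) < M := by rw [hM]; positivity
  have hM2 : (M : ℝ) ≤ 2 ^ M := by exact_mod_cast (Nat.lt_two_pow_self (n := M)).le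
  -- The bias of the random position is absorbed into the error of the repeated attempts.
  have h4 : (n k : ℝ) / 2 ^ M ≤ n k / (M * ε) := by
    gcongr
    exact (mul_le_of_le_one_right hMpos.le hε1).trans hM2
  have h5 : ((n k : ℝ) + 1) / (M * ε) + n k / (M * ε) ≤ 3 * k ^ d * k ^ c / M := by
    have h6 : ((n k : ℝ) + 1) / (M * ε) + n k / (M * ε) = (2 * n k + 1) / M * (1 / ε) := by
      field_simp; ring
    have h7 : 1 / ε ≤ (k : ℝ) ^ c := by
      rw [div_le_iff₀ hε0]
      rw [div_lt_iff₀ (by positivity)] at hlt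
      linarith
    calc _ = (2 * n k + 1) / M * (1 / ε) := h6
      _ ≤ (3 * k ^ d) / M * k ^ c := by
          gcongr
          linarith
      _ = _ := by ring
  have h8 : 3 * (k : ℝ) ^ d * k ^ c / M ≤ 1 / 4 / k ^ (c + d) := by
    rw [hM, div_le_div_iff₀ (by positivity) (by positivity)]
    push_cast
    have : (k : ℝ) ^ (2 * c + 2 * d + 1) = k ^ (c + d) * k ^ (c + d) * k := by ring
    rw [this, mul_assoc 3, ← pow_add, add_comm d c]
    have h9 : (0 : ℝ) < (k : ℝ) ^ (c + d) * k ^ (c + d) := by positivity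
    nlinarith
  have h10 : μ k < 1 / 4 / k ^ (c + d) := by
    rw [lt_div_iff₀ (by positivity)]
    linarith
  have h11 : 1 / 2 / (k : ℝ) ^ (c + d) ≤ (ε - h k ^ n k) / n k := by
    calc 1 / 2 / (k : ℝ) ^ (c + d) = 1 / (k : ℝ) ^ c / 2 / k ^ d := by
          rw [pow_add]; field_simp
      _ ≤ ε / 2 / n k := by gcongr
      _ ≤ _ := by gcongr; linarith
  have h12 : 1 / 2 / (k : ℝ) ^ (c + d) = 1 / 4 / (k : ℝ) ^ (c + d) + 1 / 4 / (k : ℝ) ^ (c + d) := by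
    ring
  linarith

end QPuzzle

end

theorem mainTheorem5 (Z : QPuzzle.Puzzle) (h : ℕ → ℝ) (hZ : Z.IsWeak h) :
    (∃ n : ℕ → ℕ, QPuzzle.EfficientlyComputable n ∧
      ∀ᶠ k : ℕ in Filter.atTop, h k ^ n k ≤ Real.exp (-(Real.log k) ^ 2)) ∧
    ∀ n : ℕ → ℕ, QPuzzle.EfficientlyComputable n →
      (∀ᶠ k : ℕ in Filter.atTop, h k ^ n k ≤ Real.exp (-(Real.log k) ^ 2)) →
      (∃ W : QPuzzle.Puzzle, QPuzzle.IsRepetition Z n W) ∧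
      ∀ W : QPuzzle.Puzzle, QPuzzle.IsRepetition Z n W → W.IsStrong :=
  ⟨QPuzzle.exists_efficientlyComputable_pow_le hZ.mem_unit hZ.noticeable, fun _ hn hh =>
    ⟨QPuzzle.exists_isRepetition Z hn, fun _ hW =>
      ⟨hW.complete hn hZ.complete, hW.hard hn hZ.mem_unit hZ.hard hh⟩⟩⟩
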